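/- **Tail covariance of the generalized skew-Laplace distribution.** *Notation.* For $g:[0,\infty)\to\mathbb R$ put $\overline G(u)=\int_u^\infty g(v)\,dv$, $\overline{\mathcal G}(u)=\int_u^\infty\overline G(v)\,dv$. For a generator $g$ and $m\ge 1$ let $c_m(g)=\frac{\Gamma(m/2)}{(2\pi)^{m/2}}\big[\int_0^\infty s^{m/2-1}g(s)\,ds\big]^{-1}$, and $c_0(g)=1/g(0)$ ($\mathbb R^0$ is a point of mass one). $E_m(\mu,\Sigma,g)$ is the law with density $\frac{c_m(g)}{\sqrt{|\Sigma|}}\,g\big(\tfrac12(x-\mu)^T\Sigma^{-1}(x-\mu)\big)$. For $H:\mathbb R\to[0,1]$ with $H(-s)=1-H(s)$ and $\gamma\in\mathbb R^m$, $GSE_m(\mu,\Sigma,\gamma,g,H)$ is the law with density $\frac{2c_m(g)}{\sqrt{|\Sigma|}}\,g\big(\tfrac12(y-\mu)^T\Sigma^{-1}(y-\mu)\big)\,H\big(\gamma^T\Sigma^{-1/2}(y-\mu)\big)$. Inequalities between vectors are componentwise; for a density $f$ write $\overline E^{t}_f[h]=\int_{\{x>t\}}h(x)f(x)\,dx$ and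 $\overline F_f(t)=\int_{\{x>t\}}f(x)\,dx$. For a random vector $X$, $MTCE_X(t)=E[X\mid X>t]$ and $MTCov_X(t)=E[(X-MTCE_X(t))(X-MTCE_X(t))^T\mid X>t]$; $VaR_q(X)$ is the vector of the marginal quantiles $\inf\{x: F_{X_k}(x)\ge q_k\}$. Let $g(u)=e^{-\sqrt{2u}}$, $n\ge1$, $\mu,\gamma\in\mathbb R^n$, $\Sigma$ positive definite, $q\in(0,1)^n$, and let $Y$ be a random vector in $\mathbb R^n$, $Z=\Sigma^{-1/2}(Y-\mu)$, $\lambda=\Sigma^{-1/2}(VaR_q(Y)-\mu)$. A subscript $-k$ (or $-ij$) means that the $k$-th (or $i$-th and $j$-th) entry is removed. Let $W_{-k}$, $V_{-k}$, $U_{-ij}$ ($i\ne j$) have the densities $c^*_{n-1,k}\overline G(\tfrac12w^Tw+\tfrac12\lambda_k^2)$ and $c^{**}_{n-1,k}\overline{\mathcal G}(\tfrac12v^Tv+\tfrac12\lambda_k^2)$ on $\mathbb R^{n-1}$ and $c^{**}_{n-2,ij}\overline{\mathcal G}(\tfrac12u^Tu+\tfrac12\lambda_i^2+\tfrac12\lambda_j^2)$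 on $\mathbb R^{n-2}$, where the constants are $c_{n-1}$, $c_{n-1}$, $c_{n-2}$ of the respective shifted generators. Let $\xi_k$ (filled with $W_{-k}$), $\eta_k$ (filled with $V_{-k}$) be the vectors with $k$-th entry $\lambda_k$, and $\tau_{ij}$ (filled with $U_{-ij}$) the one with $i$-th and $j$-th entries $\lambda_i,\lambda_j$. Write $c_n=c_n(g)$, $c_n^*=c_n(\overline G)$, $c_n^{**}=c_n(\overline{\mathcal G})$, $X^{**}\sim E_n(0,I,\overline{\mathcal G})$, $M\sim E_n(0,I,g)$. **(1)** For $t\ge0$: $\overline G(t)=(1+\sqrt{2t})e^{-\sqrt{2t}}$ and $\overline{\mathcal G}(t)=(3+2t+3\sqrt{2t})e^{-\sqrt{2t}}$; moreover $$c_n=\frac{\Gamma(n/2)}{2\pi^{n/2}\Gamma(n)},\quad c_n^*=\frac{n\Gamma(n/2)}{2\pi^{n/2}\Gamma(n+2)},\quad c_n^{**}=\frac{n(n+2)\Gamma(n/2)}{2\pi^{n/2}\Gamma(n+4)}.$$ **(2)** Put $\beta(x)=(1+\sqrt x)e^{-\sqrt x}$, $\kappa(x)=(3+x+3\sqrt x)e^{-\sqrt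 x}$. The densities are $f_{W_{-k}}(w)=c^*_{n-1,k}\,\beta(w^Tw+\lambda_k^2)$, $f_{V_{-k}}(v)=c^{**}_{n-1,k}\,\kappa(v^Tv+\lambda_k^2)$, $f_{U_{-ij}}(u)=c^{**}_{n-2,ij}\,\kappa(u^Tu+\lambda_i^2+\lambda_j^2)$; these, and the densities of $X^{**}$ and $M$, have integral $1$. For $n\ge2$ let $I_k=\int_0^\infty t^{\frac{n-3}2}\beta(2t+\lambda_k^2)\,dt$, $J_k=\int_0^\infty t^{\frac{n-3}2}\kappa(2t+\lambda_k^2)\,dt$; then $$c^*_{n-1,k}=\frac{\Gamma(\frac{n-1}2)}{(2\pi)^{(n-1)/2}I_k},\quad c^{**}_{n-1,k}=\frac{\Gamma(\frac{n-1}2)}{(2\pi)^{(n-1)/2}J_k},\quad \frac{c_n}{c^*_{n-1,k}}=\frac{\Gamma(\frac n2)2^{(n-3)/2}}{\Gamma(n)\Gamma(\frac{n-1}2)\sqrt\pi}I_k,\quad \frac{c_n}{c^{**}_{n-1,k}}=\frac{\Gamma(\frac n2)2^{(n-3)/2}}{\Gamma(n)\Gamma(\frac{n-1}2)\sqrt\pi}J_k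 .$$ For $n\ge3$, $i\ne j$ let $K_{ij}=\int_0^\infty t^{\frac{n-4}2}\kappa(2t+\lambda_i^2+\lambda_j^2)\,dt$; then $$c^{**}_{n-2,ij}=\frac{\Gamma(\frac{n-2}2)}{(2\pi)^{(n-2)/2}K_{ij}},\qquad \frac{c_n}{c^{**}_{n-2,ij}}=\frac{(n-2)\,2^{(n-6)/2}}{\Gamma(n)\,\pi}K_{ij}.$$ **(3)** Let $H$ be measurable with values in $[0,1]$ and $H(-s)=1-H(s)$, and let $Y\sim GSE_n(\mu,\Sigma,\gamma,g,H)$. Then $Z\sim GSE_n(0,I,\gamma,g,H)$, all second moments of $Y$ and $Z$ are finite, and with $\Omega:=MTCov_Z(\lambda)$ the conditional covariance matrix of $Y$ given $\{Z>\lambda\}$ is $\Sigma^{1/2}\Omega\Sigma^{1/2}$. If $\Sigma$ is diagonal, then $MTCov_Y(VaR_q(Y))=\Sigma^{1/2}\Omega\Sigma^{1/2}$. **(4)** Suppose in addition that $H$ is differentiable, that $H'$ is absolutely continuous on bounded intervals, that $P(Z>\lambda)>0$, and that the tail expectations of $H'$ and $H''$ below exist (as absolutely convergent integrals). Let $f_Z$,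 $f_{Z^*}$ be the densities of $GSE_n(0,I,\gamma,g,H)$, $GSE_n(0,I,\gamma,\overline G,H)$ and write $\overline F_Z,\overline F_{Z^*}$ for their tail functions at $\lambda$, and $m=MTCE_Z(\lambda)$. Then for $i\neq j$ $$\Omega_{ij}=\frac2{\overline F_Z}\Big\{\tfrac{c_n}{c^{**}_{n-2,ij}}\overline E^{\lambda_{-ij}}_{U_{-ij}}[H(\gamma^T\tau_{ij})]+\tfrac{c_n}{c^{**}_{n-1,i}}\gamma_j\overline E^{\lambda_{-i}}_{V_{-i}}[H'(\gamma^T\eta_i)]+\tfrac{c_n}{c^{**}_{n-1,j}}\gamma_i\overline E^{\lambda_{-j}}_{V_{-j}}[H'(\gamma^T\eta_j)]+(n+3)(n+1)\gamma_i\gamma_j\overline E^{\lambda}_{X^{**}}[H''(\gamma^TX^{**})]\Big\}-m_im_j,$$ $$\Omega_{ii}=\frac2{\overline F_Z}\Big\{\tfrac{c_n}{c^{*}_{n-1,i}}\lambda_i\overline E^{\lambda_{-i}}_{W_{-i}}[H(\gamma^T\xi_i)]+\tfrac{c_n}{c^{**}_{n-1,i}}\gamma_i\overline E^{\lambda_{-i}}_{V_{-i}}[H'(\gamma^T\eta_i)]+(n+3)(n+1)\gamma_i^2\overline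 E^{\lambda}_{X^{**}}[H''(\gamma^TX^{**})]\Big\}+(n+1)\frac{\overline F_{Z^*}}{\overline F_Z}-m_i^2,$$ $$m_k=\frac2{\overline F_Z}\Big\{\tfrac{c_n}{c^*_{n-1,k}}\overline E^{\lambda_{-k}}_{W_{-k}}[H(\gamma^T\xi_k)]+\gamma_k\overline E^\lambda_M\big[(1+\sqrt{M^TM})H'(\gamma^TM)\big]\Big\}.$$ **(5)** (Skew-Laplace.) Let $la(s)=\frac12e^{-|s|}$ and $La(s)=\int_{-\infty}^s la$. If $Y\sim GSE_n(\mu,\Sigma,\gamma,g,La)$, then $P(Z>\lambda)>0$ and the three formulas of (4) hold with $H=La$, $H'=la$ and $H''(\gamma^TX^{**})$ replaced by $-\frac{\gamma^TX^{**}}{|\gamma^TX^{**}|}\,la(\gamma^TX^{**})$. **(6)** (Symmetric Laplace, $H=\frac12$.) If $Y\sim E_n(\mu,\Sigma,g)$, then $Z\sim E_n(0,I,g)$, $P(Z>\lambda)>0$, and, with $Z^*\sim E_n(0,I,\overline G)$ and all tail functions of $Z,Z^*$ at $\lambda$, $$\Omega_{ij}=\frac1{\overline F_Z}\frac{c_n}{c^{**}_{n-2,ij}}\overline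 F_{U_{-ij}}(\lambda_{-ij})-m_im_j\ (i\ne j),\qquad \Omega_{ii}=\frac1{\overline F_Z}\frac{c_n}{c^*_{n-1,i}}\lambda_i\overline F_{W_{-i}}(\lambda_{-i})+(n+1)\frac{\overline F_{Z^*}}{\overline F_Z}-m_i^2,$$ $$m_k=\frac1{\overline F_Z}\frac{c_n}{c^*_{n-1,k}}\overline F_{W_{-k}}(\lambda_{-k}).$$ -/

import Mathlib

open MeasureTheory ProbabilityTheory Set Real Matrix
open scoped MatrixOrder

noncomputable section

namespace SkewLaplace

/-! ### Density generators and their normalizing constants -/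

/-- The cumulative generator `u ↦ ∫_u^∞ g(v) dv` of a generator `g`. The second cumulative
generator is `cumGen (cumGen g)`. -/
def cumGen (g : ℝ → ℝ) (u : ℝ) : ℝ := ∫ v in Ioi u, g v

/-- The normalizing constant of a generator `g` in dimension `m`,
`Γ(m/2) / (2π)^(m/2) * (∫_0^∞ s^(m/2-1) g(s) ds)⁻¹` for `m ≥ 1`. In dimension `0` the space is one
point of mass one, and the constant that makes `c * g(0)` have total mass one is `1 / g(0)`. -/
def normConst (m : ℕ) (g : ℝ → ℝ) : ℝ :=
  if m = 0 then (g 0)⁻¹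
  else Real.Gamma ((m : ℝ) / 2) / (2 * π) ^ ((m : ℝ) / 2)
    * (∫ s in Ioi (0 : ℝ), s ^ ((m : ℝ) / 2 - 1) * g s)⁻¹

section Densities

variable {ι : Type*} [Fintype ι]

/-- Density of the spherical distribution `E_m(0, I_m, g)`, where `m` is the size of `ι`. -/
def sphDensity (g : ℝ → ℝ) (x : ι → ℝ) : ℝ :=
  normConst (Fintype.card ι) g * g ((1 / 2) * (x ⬝ᵥ x))

/-- Density of the elliptical distribution `E_m(μ, Σ, g)`. -/
def ellDensity [DecidableEq ι] (μ : ι → ℝ) (Sg : Matrix ι ι ℝ) (g : ℝ → ℝ) (x : ι → ℝ) : ℝ :=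
  normConst (Fintype.card ι) g / √(Sg.det) * g ((1 / 2) * ((x - μ) ⬝ᵥ (Sg⁻¹ *ᵥ (x - μ))))

/-- The map `y ↦ Σ^(-1/2) (y - μ)`, with the positive definite square root of `Σ`. -/
def standardize [DecidableEq ι] (μ : ι → ℝ) (Sg : Matrix ι ι ℝ) (y : ι → ℝ) : ι → ℝ :=
  (CFC.sqrt Sg)⁻¹ *ᵥ (y - μ)

/-- Density of the generalized skew-elliptical distribution `GSE_m(μ, Σ, g, H)` with skewing
function `H : ℝ^m → ℝ`. -/
def gseDensity [DecidableEq ι] (μ : ι → ℝ) (Sg : Matrix ι ι ℝ) (g : ℝ → ℝ) (H : (ι → ℝ) → ℝ)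
    (y : ι → ℝ) : ℝ :=
  2 * ellDensity μ Sg g y * H (standardize μ Sg y)

/-- The measure on `ℝ^m` with Lebesgue density `f`. -/
def lawOf (f : (ι → ℝ) → ℝ) : Measure (ι → ℝ) :=
  volume.withDensity fun x => ENNReal.ofReal (f x)

/-- The region `{x | x > t}` (componentwise strict inequality). -/
def tailSet (t : ι → ℝ) : Set (ι → ℝ) := {x | ∀ k, t k < x k}

/-- Tail expectation `∫_t^∞ h(x) f(x) dx` of `h` under the density `f`. -/
def tailExp (f : (ι → ℝ) → ℝ) (t : ι → ℝ) (h : (ι → ℝ) → ℝ) : ℝ :=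
  ∫ x in tailSet t, h x * f x

/-- The integrand of `tailExp f t h` is integrable: the tail expectation exists. -/
def HasTailExp (f : (ι → ℝ) → ℝ) (t : ι → ℝ) (h : (ι → ℝ) → ℝ) : Prop :=
  IntegrableOn (fun x => h x * f x) (tailSet t)

/-- Tail function `∫_t^∞ f(x) dx` of the density `f`. -/
def tailFn (f : (ι → ℝ) → ℝ) (t : ι → ℝ) : ℝ := ∫ x in tailSet t, f x

end Densities

/-! ### Value at risk, multivariate tail conditional expectation and tail covariance -/

section Risk

variable {Ω : Type*} [MeasurableSpace Ω]

/-- The `q`-th quantile `inf {x | F_X(x) ≥ q}`. -/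
def valueAtRisk (P : Measure Ω) (q : ℝ) (X : Ω → ℝ) : ℝ :=
  sInf {x : ℝ | q ≤ P.real {ω | X ω ≤ x}}

/-- The vector of marginal quantiles. -/
def vectorVaR {ι : Type*} (P : Measure Ω) (q : ι → ℝ) (X : Ω → ι → ℝ) : ι → ℝ :=
  fun k => valueAtRisk P (q k) fun ω => X ω k

/-- The event `{X > t}`. -/
def exceed {ι : Type*} (X : Ω → ι → ℝ) (t : ι → ℝ) : Set Ω := {ω | ∀ k, t k < X ω k}

/-- `E[X | A]`. -/
def condMean {ι : Type*} (P : Measure Ω) (A : Set Ω) (X : Ω → ι → ℝ) : ι → ℝ :=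
  fun k => ∫ ω, X ω k ∂(ProbabilityTheory.cond P A)

/-- `E[(X - E[X | A]) (X - E[X | A])ᵀ | A]`. -/
def condCov {ι : Type*} (P : Measure Ω) (A : Set Ω) (X : Ω → ι → ℝ) : Matrix ι ι ℝ :=
  Matrix.of fun i j =>
    ∫ ω, (X ω i - condMean P A X i) * (X ω j - condMean P A X j) ∂(ProbabilityTheory.cond P A)

/-- Multivariate tail conditional expectation `E[X | X > t]`. -/
def MTCE {ι : Type*} (P : Measure Ω) (X : Ω → ι → ℝ) (t : ι → ℝ) : ι → ℝ :=
  condMean P (exceed X t) X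

/-- Multivariate tail covariance at the threshold `t`. -/
def MTCov {ι : Type*} (P : Measure Ω) (X : Ω → ι → ℝ) (t : ι → ℝ) : Matrix ι ι ℝ :=
  condCov P (exceed X t) X

end Risk

/-! ### The lower dimensional elliptical vectors `W_{-k}`, `V_{-k}`, `U_{-ij}` -/

section Reduced

variable {n : ℕ}

/-- `λ_{-k}`: the vector `λ` with the `k`-th entry removed. -/
def drop (lam : Fin n → ℝ) (k : Fin n) : {l : Fin n // l ≠ k} → ℝ := fun l => lam l

/-- `λ_{-ij}`: the vector `λ` with the `i`-th and `j`-th entries removed. -/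
def drop₂ (lam : Fin n → ℝ) (i j : Fin n) : {l : Fin n // l ≠ i ∧ l ≠ j} → ℝ := fun l => lam l

/-- The vector with `k`-th entry `λ_k` and other entries from `w`. -/
def put (lam : Fin n → ℝ) (k : Fin n) (w : {l : Fin n // l ≠ k} → ℝ) : Fin n → ℝ :=
  fun l => if h : l ≠ k then w ⟨l, h⟩ else lam l

/-- The vector with `i`-th and `j`-th entries `λ_i`, `λ_j` and other entries from `u`. -/
def put₂ (lam : Fin n → ℝ) (i j : Fin n) (u : {l : Fin n // l ≠ i ∧ l ≠ j} → ℝ) : Fin n → ℝ :=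
  fun l => if h : l ≠ i ∧ l ≠ j then u ⟨l, h⟩ else lam l

/-- Generator of `W_{-k}`: the first cumulative generator shifted by `λ_k² / 2`. -/
def genW (g : ℝ → ℝ) (lam : Fin n → ℝ) (k : Fin n) (u : ℝ) : ℝ :=
  cumGen g (u + (1 / 2) * lam k ^ 2)

/-- Generator of `V_{-k}`: the second cumulative generator shifted by `λ_k² / 2`. -/
def genV (g : ℝ → ℝ) (lam : Fin n → ℝ) (k : Fin n) (u : ℝ) : ℝ :=
  cumGen (cumGen g) (u + (1 / 2) * lam k ^ 2)

/-- Generator of `U_{-ij}`: the second cumulative generator shifted by `λ_i² / 2 + λ_j² / 2`. -/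
def genU (g : ℝ → ℝ) (lam : Fin n → ℝ) (i j : Fin n) (u : ℝ) : ℝ :=
  cumGen (cumGen g) (u + (1 / 2) * lam i ^ 2 + (1 / 2) * lam j ^ 2)

/-- `c*_{n-1,k}`. -/
def constW (g : ℝ → ℝ) (lam : Fin n → ℝ) (k : Fin n) : ℝ := normConst (n - 1) (genW g lam k)

/-- `c**_{n-1,k}`. -/
def constV (g : ℝ → ℝ) (lam : Fin n → ℝ) (k : Fin n) : ℝ := normConst (n - 1) (genV g lam k)

/-- `c**_{n-2,ij}` (used for `i ≠ j`). -/
def constU (g : ℝ → ℝ) (lam : Fin n → ℝ) (i j : Fin n) : ℝ := normConst (n - 2) (genU g lam i j)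

/-- Density of `W_{-k}`. -/
def densW (g : ℝ → ℝ) (lam : Fin n → ℝ) (k : Fin n) (w : {l : Fin n // l ≠ k} → ℝ) : ℝ :=
  constW g lam k * genW g lam k ((1 / 2) * (w ⬝ᵥ w))

/-- Density of `V_{-k}`. -/
def densV (g : ℝ → ℝ) (lam : Fin n → ℝ) (k : Fin n) (v : {l : Fin n // l ≠ k} → ℝ) : ℝ :=
  constV g lam k * genV g lam k ((1 / 2) * (v ⬝ᵥ v))

/-- Density of `U_{-ij}` (used for `i ≠ j`). -/
def densU (g : ℝ → ℝ) (lam : Fin n → ℝ) (i j : Fin n)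
    (u : {l : Fin n // l ≠ i ∧ l ≠ j} → ℝ) : ℝ :=
  constU g lam i j * genU g lam i j ((1 / 2) * (u ⬝ᵥ u))

end Reduced

/-! ### The Laplace generator and the univariate Laplace distribution -/

/-- The generator `g(u) = exp(-√(2u))`. -/
def lapGen (u : ℝ) : ℝ := Real.exp (-√(2 * u))

/-- Density of the standard Laplace distribution on `ℝ`. -/
def lapPdf (x : ℝ) : ℝ := Real.exp (-|x|) / 2

/-- Distribution function of the standard Laplace distribution on `ℝ`. -/
def lapCdf (x : ℝ) : ℝ := ∫ t in Iic x, lapPdf t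

/-- `H : ℝ → ℝ` takes values in `[0, 1]` and satisfies `H(-x) = 1 - H(x)`. -/
def IsSkewing (H : ℝ → ℝ) : Prop :=
  (∀ x, 0 ≤ H x ∧ H x ≤ 1) ∧ ∀ x, H (-x) = 1 - H x

/-- The law `GSLa_n(μ, Σ, γ, H)`: the generalized skew-elliptical law with the Laplace generator
and skewing function `z ↦ H(γᵀ z)`. -/
def gsLaplaceLaw {n : ℕ} (μ : Fin n → ℝ) (Sg : Matrix (Fin n) (Fin n) ℝ) (γ : Fin n → ℝ)
    (H : ℝ → ℝ) : Measure (Fin n → ℝ) :=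
  lawOf (gseDensity μ Sg lapGen fun z => H (γ ⬝ᵥ z))

end SkewLaplace

end

open SkewLaplace

noncomputable section

namespace SkewLaplace

/-!
Everything rests on a Stein type identity. The spherical density generated by `cumGen g` is, up to
normalization, an antiderivative of `-x_k g(|x|² / 2)` in each coordinate, so integrating
`x_k h(x) g(|x|² / 2)` by parts over the orthant `{x > λ}` turns the factor `x_k` into a boundary
term on the face `{x_k = λ_k}`, where the same density is generated by a shift of `cumGen g`, and a
bulk term with `∂_k h` and generator `cumGen g`. For `h(x) = H(γᵀ x)` one application gives the
tail conditional expectation and two give the mixed and pure second moments. The generators that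
are continuous, positive, rapidly decreasing and do not drop too fast under shifts form a class
that is stable under shifts and `cumGen`, so the identity can be iterated. An affine change of
variables reduces `Y` to `Z`, and for the Laplace generator all constants are Gamma integrals.
-/

open Filter Topology

/-! ### Regular generators -/

theorem integrableOn_Ioi_of_continuous {f : ℝ → ℝ} {a : ℝ} (hf : Continuous f)
    (h_int : IntegrableOn f (Ioi a)) (b : ℝ) : IntegrableOn f (Ioi b) := by
  rcases le_total a b with hab | hab
  · exact h_int.mono_set (Ioi_subset_Ioi hab)
  · rw [← Ioc_union_Ioi_eq_Ioi hab]
    exact hf.integrableOn_Ioc.union h_int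

theorem cumGen_comp_add_right (g : ℝ → ℝ) (a u : ℝ) :
    cumGen (fun v => g (v + a)) u = cumGen g (u + a) := by
  have h_preimage : (· + a) ⁻¹' Ioi (u + a) = Ioi u := by ext; simp
  rw [cumGen, cumGen, ← h_preimage]
  exact (measurePreserving_add_right volume a).setIntegral_preimage_emb
    (measurableEmbedding_addRight a) g _

/-- The class of density generators for which the tail moment identities are proved: continuous
functions, positive and rapidly decreasing on `[0, ∞)`, that a shift to the right decreases by at
most a bounded factor. The class is stable under shifts and under `cumGen`, so the identities can
be iterated. -/
structure IsRegularGen (g : ℝ → ℝ) : Prop where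
  continuous : Continuous g
  pos : ∀ t, 0 ≤ t → 0 < g t
  rapid_decay : ∀ k : ℕ, ∃ C, ∀ t, 0 ≤ t → (1 + t) ^ k * g t ≤ C
  le_mul_shift : ∀ δ, 0 ≤ δ → ∃ C, ∀ t, 0 ≤ t → g t ≤ C * g (t + δ)

theorem isRegularGen_lapGen : IsRegularGen lapGen where
  continuous := by unfold lapGen; fun_prop
  pos _ _ := Real.exp_pos _
  rapid_decay k := by
    refine ⟨(2 * k).factorial * Real.exp 1, fun t ht => ?_⟩
    have h_one_add : 1 + t ≤ (1 + √(2 * t)) ^ 2 := by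
      nlinarith [sq_sqrt (show 0 ≤ 2 * t by positivity), sqrt_nonneg (2 * t)]
    have h_pow := (div_le_iff₀' (by positivity)).1
      (Real.pow_div_factorial_le_exp (1 + √(2 * t)) (by positivity) (2 * k))
    calc (1 + t) ^ k * lapGen t ≤ ((1 + √(2 * t)) ^ 2) ^ k * Real.exp (-√(2 * t)) := by
          unfold lapGen; gcongr
      _ ≤ (2 * k).factorial * Real.exp (1 + √(2 * t)) * Real.exp (-√(2 * t)) := by
          rw [← pow_mul]; gcongr
      _ = (2 * k).factorial * Real.exp 1 := by
          rw [mul_assoc, ← Real.exp_add, add_neg_cancel_right]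
  le_mul_shift δ hδ := by
    refine ⟨Real.exp √(2 * δ), fun t ht => ?_⟩
    have h_sqrt : √(2 * (t + δ)) ≤ √(2 * t) + √(2 * δ) := by
      refine (Real.sqrt_le_left (by positivity)).2 ?_
      nlinarith [sq_sqrt (show 0 ≤ 2 * t by positivity), sq_sqrt (show 0 ≤ 2 * δ by positivity),
        mul_nonneg (sqrt_nonneg (2 * t)) (sqrt_nonneg (2 * δ))]
    rw [lapGen, lapGen, ← Real.exp_add, Real.exp_le_exp]
    linarith

namespace IsRegularGen

variable {g : ℝ → ℝ}

theorem comp_add_right (hg : IsRegularGen g) {a : ℝ} (ha : 0 ≤ a) :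
    IsRegularGen fun u => g (u + a) where
  continuous := hg.continuous.comp (by fun_prop)
  pos t ht := hg.pos _ (by positivity)
  rapid_decay k := by
    obtain ⟨C, hC⟩ := hg.rapid_decay k
    refine ⟨C, fun t ht => le_trans ?_ (hC (t + a) (by positivity))⟩
    have := hg.pos (t + a) (by positivity)
    gcongr
    linarith
  le_mul_shift δ hδ := by
    obtain ⟨C, hC⟩ := hg.le_mul_shift δ hδ
    refine ⟨C, fun t ht => ?_⟩
    rw [add_right_comm]
    exact hC (t + a) (by positivity)

theorem integrableOn_pow_mul (hg : IsRegularGen g) (k : ℕ) :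
    IntegrableOn (fun v => (1 + v) ^ k * g v) (Ioi 0) := by
  obtain ⟨C, hC⟩ := hg.rapid_decay (k + 2)
  have h_meas : Continuous fun v => (1 + v) ^ k * g v := by have := hg.continuous; fun_prop
  refine ((integrable_inv_one_add_sq.const_mul C).integrableOn).mono'
    h_meas.aestronglyMeasurable (ae_restrict_of_forall_mem measurableSet_Ioi fun v hv => ?_)
  have hv0 : (0 : ℝ) < v := hv
  have := hg.pos v hv0.le
  rw [norm_of_nonneg (by positivity), ← div_eq_mul_inv, le_div_iff₀ (by positivity)]
  calc (1 + v) ^ k * g v * (1 + v ^ 2) ≤ (1 + v) ^ k * g v * (1 + v) ^ 2 := by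
        gcongr; nlinarith
    _ = (1 + v) ^ (k + 2) * g v := by ring
    _ ≤ C := hC v hv0.le

theorem integrableOn_Ioi (hg : IsRegularGen g) (u : ℝ) : IntegrableOn g (Ioi u) :=
  integrableOn_Ioi_of_continuous hg.continuous (by simpa using hg.integrableOn_pow_mul 0) u

theorem hasDerivAt_cumGen (hg : IsRegularGen g) (u : ℝ) : HasDerivAt (cumGen g) (-g u) u := by
  have h_eq : cumGen g = fun x => cumGen g u - ∫ t in u..x, g t := by
    ext x
    rw [eq_sub_iff_add_eq', cumGen, intervalIntegral.integral_interval_add_Ioi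
      (hg.integrableOn_Ioi u) (hg.integrableOn_Ioi x), cumGen]
  rw [h_eq]
  exact (hg.continuous.integral_hasStrictDerivAt u u).hasDerivAt.const_sub _

theorem antitoneOn_cumGen (hg : IsRegularGen g) : AntitoneOn (cumGen g) (Ici 0) :=
  fun s hs _ _ hst => setIntegral_mono_set (hg.integrableOn_Ioi s)
    (ae_restrict_of_forall_mem measurableSet_Ioi fun v hv => (hg.pos v (le_trans hs hv.le)).le)
    (Ioi_subset_Ioi hst).eventuallyLE

theorem cumGen_pos (hg : IsRegularGen g) {t : ℝ} (ht : 0 ≤ t) : 0 < cumGen g t := by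
  refine (setIntegral_pos_iff_support_of_nonneg_ae (ae_restrict_of_forall_mem measurableSet_Ioi
    fun v hv => (hg.pos v (ht.trans hv.le)).le) (hg.integrableOn_Ioi t)).2 ?_
  have h_sub : Ioi t ⊆ Function.support g := fun v hv => (hg.pos v (ht.trans (le_of_lt hv))).ne'
  simp [inter_eq_right.2 h_sub]

protected theorem cumGen (hg : IsRegularGen g) : IsRegularGen (cumGen g) where
  continuous := continuous_iff_continuousAt.2 fun u => (hg.hasDerivAt_cumGen u).continuousAt
  pos _ ht := hg.cumGen_pos ht
  rapid_decay k := by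
    refine ⟨∫ v in Ioi 0, (1 + v) ^ k * g v, fun t ht => ?_⟩
    have h_int := hg.integrableOn_pow_mul k
    have h_sub : Ioi t ⊆ Ioi 0 := Ioi_subset_Ioi ht
    rw [cumGen, ← integral_const_mul]
    refine (setIntegral_mono_on ((hg.integrableOn_Ioi t).const_mul _) (h_int.mono_set h_sub)
      measurableSet_Ioi fun v hv => ?_).trans (setIntegral_mono_set h_int
        (ae_restrict_of_forall_mem measurableSet_Ioi fun v hv => ?_) h_sub.eventuallyLE)
    · have hv : t < v := hv
      have := hg.pos v (by linarith)
      gcongr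
    · have hv : 0 < v := hv
      have := hg.pos v hv.le
      positivity
  le_mul_shift δ hδ := by
    obtain ⟨C, hC⟩ := hg.le_mul_shift δ hδ
    refine ⟨C, fun t ht => ?_⟩
    rw [← cumGen_comp_add_right, cumGen, cumGen, ← integral_const_mul]
    exact setIntegral_mono_on (hg.integrableOn_Ioi t)
      (((hg.comp_add_right hδ).integrableOn_Ioi t).const_mul C) measurableSet_Ioi
      fun v hv => hC v (ht.trans hv.le)

end IsRegularGen

/-! ### Spherical densities -/

section Integrable

variable {ι : Type*} [Fintype ι]

theorem dotProduct_self_nonneg (x : ι → ℝ) : 0 ≤ x ⬝ᵥ x :=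
  Finset.sum_nonneg fun i _ => mul_self_nonneg (x i)

theorem abs_le_sqrt_dotProduct_self (x : ι → ℝ) (i : ι) : |x i| ≤ √(x ⬝ᵥ x) := by
  refine abs_le_sqrt ?_
  simp only [dotProduct, ← sq]
  exact Finset.single_le_sum (f := fun i => x i ^ 2) (fun j _ => sq_nonneg _) (Finset.mem_univ i)

theorem norm_le_sqrt_dotProduct_self (x : ι → ℝ) : ‖x‖ ≤ √(x ⬝ᵥ x) :=
  (pi_norm_le_iff_of_nonneg (sqrt_nonneg _)).2 (abs_le_sqrt_dotProduct_self x)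

theorem continuous_comp_half_dotProduct_self {G : ℝ → ℝ} (hG : Continuous G) :
    Continuous fun x : ι → ℝ => G ((1 / 2) * (x ⬝ᵥ x)) :=
  hG.comp (by unfold dotProduct; fun_prop)

namespace IsRegularGen

variable {g : ℝ → ℝ}

theorem comp_half_dotProduct_self_pos (hg : IsRegularGen g) (x : ι → ℝ) :
    0 < g ((1 / 2) * (x ⬝ᵥ x)) :=
  hg.pos _ (by have := dotProduct_self_nonneg x; positivity)

theorem exists_one_add_sqrt_pow_mul_le (hg : IsRegularGen g) (k : ℕ) :
    ∃ C, ∀ x : ι → ℝ, (1 + √(x ⬝ᵥ x)) ^ k * g ((1 / 2) * (x ⬝ᵥ x)) ≤ C := by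
  obtain ⟨C, hC⟩ := hg.rapid_decay k
  refine ⟨4 ^ k * C, fun x => ?_⟩
  have hx := dotProduct_self_nonneg x
  have hgx := hg.comp_half_dotProduct_self_pos x
  have h_sq : 1 + √(x ⬝ᵥ x) ≤ 4 * (1 + (1 / 2) * (x ⬝ᵥ x)) := by
    nlinarith [sq_sqrt hx, sq_nonneg (√(x ⬝ᵥ x) - 1)]
  calc (1 + √(x ⬝ᵥ x)) ^ k * g ((1 / 2) * (x ⬝ᵥ x))
      ≤ (4 * (1 + (1 / 2) * (x ⬝ᵥ x))) ^ k * g ((1 / 2) * (x ⬝ᵥ x)) := by gcongr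
    _ = 4 ^ k * ((1 + (1 / 2) * (x ⬝ᵥ x)) ^ k * g ((1 / 2) * (x ⬝ᵥ x))) := by
        rw [mul_pow, mul_assoc]
    _ ≤ 4 ^ k * C := by gcongr; exact hC _ (by positivity)

theorem integrable_mul (hg : IsRegularGen g) {h : (ι → ℝ) → ℝ} (h_meas : AEStronglyMeasurable h)
    {C : ℝ} {k : ℕ} (h_le : ∀ x, |h x| ≤ C * (1 + √(x ⬝ᵥ x)) ^ k) :
    Integrable fun x => h x * g ((1 / 2) * (x ⬝ᵥ x)) := by
  set m := Fintype.card ι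
  obtain ⟨K, hK⟩ := hg.exists_one_add_sqrt_pow_mul_le (ι := ι) (k + (m + 1))
  have h_dom : Integrable fun x : ι → ℝ => C * K * (1 + ‖x‖) ^ (-((m + 1 : ℕ) : ℝ)) :=
    (integrable_one_add_norm (by simp [m])).const_mul _
  refine h_dom.mono' (h_meas.mul
    (continuous_comp_half_dotProduct_self hg.continuous).aestronglyMeasurable)
    (Eventually.of_forall fun x => ?_)
  have hgx := hg.comp_half_dotProduct_self_pos x
  have hC : 0 ≤ C := nonneg_of_mul_nonneg_left ((abs_nonneg _).trans (h_le x))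
    (by have := sqrt_nonneg (x ⬝ᵥ x); positivity)
  rw [rpow_neg (by positivity), rpow_natCast, ← div_eq_mul_inv, le_div_iff₀ (by positivity),
    norm_mul, norm_of_nonneg hgx.le]
  calc |h x| * g ((1 / 2) * (x ⬝ᵥ x)) * (1 + ‖x‖) ^ (m + 1)
      ≤ C * (1 + √(x ⬝ᵥ x)) ^ k * g ((1 / 2) * (x ⬝ᵥ x)) * (1 + √(x ⬝ᵥ x)) ^ (m + 1) := by
        gcongr
        · exact h_le x
        · exact norm_le_sqrt_dotProduct_self x
    _ = C * ((1 + √(x ⬝ᵥ x)) ^ (k + (m + 1)) * g ((1 / 2) * (x ⬝ᵥ x))) := by ring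
    _ ≤ C * K := by gcongr; exact hK x

theorem integrable (hg : IsRegularGen g) :
    Integrable fun x : ι → ℝ => g ((1 / 2) * (x ⬝ᵥ x)) := by
  simpa using hg.integrable_mul (h := fun _ => 1) (by fun_prop) (C := 1) (k := 0) (by simp)

theorem integral_pos (hg : IsRegularGen g) : 0 < ∫ x : ι → ℝ, g ((1 / 2) * (x ⬝ᵥ x)) := by
  rw [integral_pos_iff_support_of_nonneg (fun x => (hg.comp_half_dotProduct_self_pos x).le)
    hg.integrable, Function.support_eq_univ fun x => (hg.comp_half_dotProduct_self_pos x).ne']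
  exact Measure.measure_univ_pos.2 (NeZero.ne _)

end IsRegularGen

end Integrable

theorem integral_rpow_half_sub_one_mul (m : ℝ) (f : ℝ → ℝ) :
    ∫ s in Ioi (0 : ℝ), s ^ (m / 2 - 1) * f s =
      2 ^ (1 - m / 2) * ∫ x in Ioi (0 : ℝ), x ^ (m - 1) * f ((1 / 2) * x ^ 2) := by
  have h_scale : ∫ s in Ioi (0 : ℝ), s ^ (m / 2 - 1) * f s =
      (1 / 2) * ∫ s in Ioi (0 : ℝ), (1 / 2 * s) ^ (m / 2 - 1) * f (1 / 2 * s) := by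
    rw [integral_comp_mul_left_Ioi (fun s => s ^ (m / 2 - 1) * f s) 0 one_half_pos, mul_zero,
      smul_eq_mul]
    ring
  rw [h_scale, ← integral_comp_rpow_Ioi_of_pos (p := 2)
    (g := fun s => (1 / 2 * s) ^ (m / 2 - 1) * f (1 / 2 * s)) two_pos,
    ← integral_const_mul, ← integral_const_mul]
  refine setIntegral_congr_fun measurableSet_Ioi fun x hx => ?_
  have hx0 : (0 : ℝ) < x := hx
  have h_pow : (1 / 2 * x ^ 2) ^ (m / 2 - 1) = 2 ^ (1 - m / 2) * (x ^ (m - 1) * x⁻¹) := by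
    rw [mul_rpow (by norm_num) (by positivity), one_div, inv_rpow (by norm_num), ← rpow_neg
      (by norm_num), ← rpow_natCast, ← rpow_mul hx0.le, ← rpow_neg_one x, ← rpow_add hx0]
    congr 2 <;> (push_cast; ring)
  simp only [smul_eq_mul, rpow_ofNat]
  rw [h_pow]
  norm_num
  field_simp

theorem volume_real_unitBall_euclideanSpace (ι : Type*) [Fintype ι] [Nonempty ι] :
    (volume : Measure (EuclideanSpace ℝ ι)).real (Metric.ball 0 1) =
      π ^ ((Fintype.card ι : ℝ) / 2) / Real.Gamma ((Fintype.card ι : ℝ) / 2 + 1) := by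
  have : 0 < Real.Gamma ((Fintype.card ι : ℝ) / 2 + 1) := Real.Gamma_pos_of_pos (by positivity)
  rw [measureReal_def, EuclideanSpace.volume_ball, ENNReal.ofReal_one, one_pow, one_mul,
    ENNReal.toReal_ofReal (by positivity), sqrt_eq_rpow, ← rpow_natCast, ← rpow_mul pi_pos.le,
    one_div_mul_eq_div]

theorem integral_euclideanSpace_comp_half_norm_sq {ι : Type*} [Fintype ι] (f : ℝ → ℝ) :
    ∫ x : EuclideanSpace ℝ ι, f ((1 / 2) * ‖x‖ ^ 2) =
      ∫ x : ι → ℝ, f ((1 / 2) * (x ⬝ᵥ x)) := by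
  rw [← (EuclideanSpace.volume_preserving_symm_measurableEquiv_toLp ι).symm.integral_comp
    (MeasurableEquiv.measurableEmbedding _)]
  simp [EuclideanSpace.norm_sq_eq, dotProduct, ← sq]

theorem integral_comp_half_dotProduct_self {ι : Type*} [Fintype ι] [Nonempty ι] (f : ℝ → ℝ) :
    ∫ x : ι → ℝ, f ((1 / 2) * (x ⬝ᵥ x)) =
      (2 * π) ^ ((Fintype.card ι : ℝ) / 2) / Real.Gamma ((Fintype.card ι : ℝ) / 2) *
        ∫ s in Ioi (0 : ℝ), s ^ ((Fintype.card ι : ℝ) / 2 - 1) * f s := by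
  have h_card : 0 < Fintype.card ι := Fintype.card_pos
  have h_pow : ∫ y in Ioi (0 : ℝ), y ^ (Fintype.card ι - 1) • f (1 / 2 * y ^ 2) =
      ∫ x in Ioi (0 : ℝ), x ^ ((Fintype.card ι : ℝ) - 1) * f (1 / 2 * x ^ 2) := by
    simp only [smul_eq_mul, ← rpow_natCast, Nat.cast_sub (Nat.succ_le_of_lt h_card), Nat.cast_one]
  rw [← integral_euclideanSpace_comp_half_norm_sq,
    integral_fun_norm_addHaar volume fun r => f ((1 / 2) * r ^ 2),
    volume_real_unitBall_euclideanSpace, integral_rpow_half_sub_one_mul, finrank_euclideanSpace,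
    h_pow, Real.Gamma_add_one (by positivity), mul_rpow (by norm_num) pi_pos.le,
    rpow_sub two_pos, rpow_one]
  have : 0 < Real.Gamma ((Fintype.card ι : ℝ) / 2) :=
    Real.Gamma_pos_of_pos (by positivity)
  simp only [nsmul_eq_mul, smul_eq_mul]
  field_simp

theorem normConst_card_eq_inv_integral (ι : Type*) [Fintype ι] (G : ℝ → ℝ) :
    normConst (Fintype.card ι) G = (∫ x : ι → ℝ, G ((1 / 2) * (x ⬝ᵥ x)))⁻¹ := by
  rcases isEmpty_or_nonempty ι with h | h
  · simp [normConst, dotProduct, measureReal_def, volume_pi]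
  · rw [normConst, if_neg Fintype.card_ne_zero, integral_comp_half_dotProduct_self, mul_inv,
      inv_div]

section SphDensity

variable {ι : Type*} [Fintype ι] {g : ℝ → ℝ}

theorem IsRegularGen.normConst_pos (hg : IsRegularGen g) (m : ℕ) : 0 < normConst m g := by
  rw [← Fintype.card_fin m, normConst_card_eq_inv_integral]
  exact inv_pos.2 hg.integral_pos

theorem IsRegularGen.integral_sphDensity (hg : IsRegularGen g) :
    ∫ x : ι → ℝ, sphDensity g x = 1 := by
  simp only [sphDensity, integral_const_mul, normConst_card_eq_inv_integral]
  exact inv_mul_cancel₀ hg.integral_pos.ne'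

theorem IsRegularGen.sphDensity_pos (hg : IsRegularGen g) (x : ι → ℝ) : 0 < sphDensity g x :=
  mul_pos (hg.normConst_pos _) (hg.comp_half_dotProduct_self_pos x)

theorem tailExp_sphDensity (g : ℝ → ℝ) (t : ι → ℝ) (h : (ι → ℝ) → ℝ) :
    tailExp (sphDensity g) t h =
      normConst (Fintype.card ι) g * ∫ x in tailSet t, h x * g ((1 / 2) * (x ⬝ᵥ x)) := by
  simp only [tailExp, sphDensity, ← integral_const_mul, mul_left_comm]

theorem IsRegularGen.div_normConst_mul_tailExp (hg : IsRegularGen g) (c : ℝ) (t : ι → ℝ)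
    (h : (ι → ℝ) → ℝ) :
    c / normConst (Fintype.card ι) g * tailExp (sphDensity g) t h =
      c * ∫ x in tailSet t, h x * g ((1 / 2) * (x ⬝ᵥ x)) := by
  rw [tailExp_sphDensity, ← mul_assoc, div_mul_cancel₀ _ (hg.normConst_pos _).ne']

theorem IsRegularGen.hasTailExp_sphDensity_iff (hg : IsRegularGen g) (t : ι → ℝ)
    (h : (ι → ℝ) → ℝ) :
    HasTailExp (sphDensity g) t h ↔
      IntegrableOn (fun x => h x * g ((1 / 2) * (x ⬝ᵥ x))) (tailSet t) := by
  simp only [HasTailExp, sphDensity, mul_left_comm (h _)]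
  exact integrable_const_mul_iff (hg.normConst_pos _).ne'.isUnit _

theorem IsRegularGen.hasTailExp_of_abs_le (hg : IsRegularGen g) (t : ι → ℝ) {h : (ι → ℝ) → ℝ}
    (h_meas : Measurable h) {C : ℝ} {k : ℕ} (h_le : ∀ x, |h x| ≤ C * (1 + √(x ⬝ᵥ x)) ^ k) :
    HasTailExp (sphDensity g) t h :=
  (hg.hasTailExp_sphDensity_iff t h).2
    (hg.integrable_mul h_meas.aestronglyMeasurable h_le).integrableOn

end SphDensity

/-! ### Cumulative generators and normalizing constants of the Laplace generator -/

theorem IsRegularGen.cumGen_eq_comp_sqrt {g p q : ℝ → ℝ} (hg : IsRegularGen g)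
    (hp : ∀ r, HasDerivAt p (-(r * q r)) r) (hp_lim : Tendsto p atTop (𝓝 0))
    (hgq : ∀ v, 0 ≤ v → g v = q √(2 * v)) {t : ℝ} (ht : 0 ≤ t) : cumGen g t = p √(2 * t) := by
  have hp_cont : Continuous p := continuous_iff_continuousAt.2 fun r => (hp r).continuousAt
  have h_deriv : ∀ v ∈ Ioi t, HasDerivAt (fun v => p √(2 * v)) (-g v) v := fun v hv => by
    have hv0 : 0 < v := ht.trans_lt hv
    have h_sqrt := ((hasDerivAt_id v).const_mul 2).sqrt (by simpa using hv0.ne')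
    refine ((hp _).comp v h_sqrt).congr_deriv ?_
    rw [hgq v hv0.le]
    simp only [id]
    field_simp
  have h_lim : Tendsto (fun v => p √(2 * v)) atTop (𝓝 0) :=
    hp_lim.comp (tendsto_sqrt_atTop.comp (tendsto_id.const_mul_atTop two_pos))
  have h_FTC := integral_Ioi_of_hasDerivAt_of_tendsto
    (by fun_prop : Continuous fun v => p √(2 * v)).continuousWithinAt h_deriv
    (hg.integrableOn_Ioi t).neg h_lim
  rwa [integral_neg, zero_sub, neg_inj] at h_FTC

theorem tendsto_quadratic_mul_exp_neg (a b c : ℝ) :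
    Tendsto (fun r : ℝ => (a + b * r + c * r ^ 2) * Real.exp (-r)) atTop (𝓝 0) := by
  have h_lim := (((tendsto_pow_mul_exp_neg_atTop_nhds_zero 0).const_mul a).add
    ((tendsto_pow_mul_exp_neg_atTop_nhds_zero 1).const_mul b)).add
    ((tendsto_pow_mul_exp_neg_atTop_nhds_zero 2).const_mul c)
  simp only [mul_zero, add_zero] at h_lim
  exact h_lim.congr fun r => by ring

theorem hasDerivAt_quadratic_mul_exp_neg (a b c r : ℝ) :
    HasDerivAt (fun r : ℝ => (a + b * r + c * r ^ 2) * Real.exp (-r))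
      ((b - a + (2 * c - b) * r - c * r ^ 2) * Real.exp (-r)) r := by
  refine (((((hasDerivAt_id r).const_mul b).const_add a).add
    (((hasDerivAt_id r).pow 2).const_mul c)).mul (hasDerivAt_neg r).exp).congr_deriv ?_
  simp only [id, Pi.add_apply, Pi.pow_apply]
  ring

theorem cumGen_lapGen {t : ℝ} (ht : 0 ≤ t) :
    cumGen lapGen t = (1 + √(2 * t)) * Real.exp (-√(2 * t)) := by
  rw [isRegularGen_lapGen.cumGen_eq_comp_sqrt (q := fun r => Real.exp (-r))
    (fun r => (hasDerivAt_quadratic_mul_exp_neg 1 1 0 r).congr_deriv (by ring))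
    (tendsto_quadratic_mul_exp_neg 1 1 0) (fun v _ => rfl) ht]
  ring

theorem cumGen_cumGen_lapGen {t : ℝ} (ht : 0 ≤ t) :
    cumGen (cumGen lapGen) t = (3 + 2 * t + 3 * √(2 * t)) * Real.exp (-√(2 * t)) := by
  rw [isRegularGen_lapGen.cumGen.cumGen_eq_comp_sqrt (q := fun r => (1 + r) * Real.exp (-r))
    (fun r => (hasDerivAt_quadratic_mul_exp_neg 3 3 1 r).congr_deriv (by ring))
    (tendsto_quadratic_mul_exp_neg 3 3 1) (fun v hv => cumGen_lapGen hv) ht,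
    sq_sqrt (by positivity)]
  ring

theorem integral_rpow_mul_quadratic_mul_exp_neg {s : ℝ} (hs : 0 < s) (a b c : ℝ) :
    ∫ x in Ioi (0 : ℝ), x ^ (s - 1) * ((a + b * x + c * x ^ 2) * Real.exp (-x)) =
      (a + b * s + c * (s * (s + 1))) * Real.Gamma s := by
  have h_int : ∀ r : ℝ, 0 < r → IntegrableOn (fun x : ℝ => Real.exp (-x) * x ^ (r - 1)) (Ioi 0) :=
    fun r hr => Real.GammaIntegral_convergent hr
  have h_int₀ := (h_int s hs).const_mul a
  have h_int₁ := (h_int (s + 1) (by positivity)).const_mul b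
  have h_int₂ := (h_int (s + 1 + 1) (by positivity)).const_mul c
  have h_expand : EqOn
      (fun x : ℝ => x ^ (s - 1) * ((a + b * x + c * x ^ 2) * Real.exp (-x)))
      (fun x => a * (Real.exp (-x) * x ^ (s - 1)) + b * (Real.exp (-x) * x ^ (s + 1 - 1)) +
        c * (Real.exp (-x) * x ^ (s + 1 + 1 - 1))) (Ioi 0) := by
    intro x hx
    have hx0 : x ≠ 0 := (mem_Ioi.1 hx).ne'
    have h_pow₁ : x ^ (s + 1 - 1) = x ^ (s - 1) * x := by rw [← rpow_add_one hx0]; ring_nf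
    have h_pow₂ : x ^ (s + 1 + 1 - 1) = x ^ (s - 1) * x * x := by
      rw [← rpow_add_one hx0, ← rpow_add_one hx0]; ring_nf
    simp only [h_pow₁, h_pow₂]
    ring
  rw [setIntegral_congr_fun measurableSet_Ioi h_expand,
    integral_add (by exact h_int₀.add h_int₁) h_int₂, integral_add h_int₀ h_int₁,
    integral_const_mul, integral_const_mul, integral_const_mul,
    ← Real.Gamma_eq_integral hs, ← Real.Gamma_eq_integral (by positivity),
    ← Real.Gamma_eq_integral (by positivity), Real.Gamma_add_one (s := s + 1) (by positivity),
    Real.Gamma_add_one hs.ne']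
  ring

section Constants

variable {n : ℕ}

theorem normConst_quadratic_mul_exp_neg_sqrt (hn : 1 ≤ n) {G : ℝ → ℝ} {a b c : ℝ}
    (hG : ∀ t, 0 ≤ t → G t = (a + b * √(2 * t) + c * (2 * t)) * Real.exp (-√(2 * t))) :
    normConst n G = Real.Gamma ((n : ℝ) / 2) /
      (2 * π ^ ((n : ℝ) / 2) * ((a + b * n + c * (n * (n + 1))) * Real.Gamma n)) := by
  have h_polar : EqOn (fun x : ℝ => x ^ ((n : ℝ) - 1) * G ((1 / 2) * x ^ 2))
      (fun x => x ^ ((n : ℝ) - 1) * ((a + b * x + c * x ^ 2) * Real.exp (-x))) (Ioi 0) := by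
    intro x hx
    have h_two : 2 * (1 / 2 * x ^ 2) = x ^ 2 := by ring
    simp only [hG _ (show 0 ≤ 1 / 2 * x ^ 2 by positivity), h_two, sqrt_sq (mem_Ioi.1 hx).le]
  rw [normConst, if_neg (by omega), integral_rpow_half_sub_one_mul,
    setIntegral_congr_fun measurableSet_Ioi h_polar,
    integral_rpow_mul_quadratic_mul_exp_neg (by positivity), mul_rpow (by norm_num) pi_pos.le,
    rpow_sub two_pos, rpow_one]
  field_simp

theorem normConst_lapGen (hn : 1 ≤ n) :
    normConst n lapGen = Real.Gamma ((n : ℝ) / 2) / (2 * π ^ ((n : ℝ) / 2) * Real.Gamma n) := by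
  rw [normConst_quadratic_mul_exp_neg_sqrt hn (a := 1) (b := 0) (c := 0)
    fun t _ => by simp [lapGen]]
  simp

theorem normConst_cumGen_lapGen (hn : 1 ≤ n) :
    normConst n (cumGen lapGen) =
      n * Real.Gamma ((n : ℝ) / 2) / (2 * π ^ ((n : ℝ) / 2) * Real.Gamma (n + 2)) := by
  have hn0 : (0 : ℝ) < n := by exact_mod_cast hn
  have := Real.Gamma_pos_of_pos hn0
  rw [normConst_quadratic_mul_exp_neg_sqrt hn (a := 1) (b := 1) (c := 0) fun t ht => by
    rw [cumGen_lapGen ht]; ring, show (n : ℝ) + 2 = n + 1 + 1 by ring,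
    Real.Gamma_add_one (s := (n : ℝ) + 1) (by positivity), Real.Gamma_add_one hn0.ne']
  field_simp
  ring

theorem normConst_cumGen_cumGen_lapGen (hn : 1 ≤ n) :
    normConst n (cumGen (cumGen lapGen)) =
      n * (n + 2) * Real.Gamma ((n : ℝ) / 2) / (2 * π ^ ((n : ℝ) / 2) * Real.Gamma (n + 4)) := by
  have hn0 : (0 : ℝ) < n := by exact_mod_cast hn
  have := Real.Gamma_pos_of_pos hn0
  rw [normConst_quadratic_mul_exp_neg_sqrt hn (a := 3) (b := 3) (c := 1) fun t ht => by
    rw [cumGen_cumGen_lapGen ht]; ring, show (n : ℝ) + 4 = n + 1 + 1 + 1 + 1 by ring,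
    Real.Gamma_add_one (s := (n : ℝ) + 1 + 1 + 1) (by positivity),
    Real.Gamma_add_one (s := (n : ℝ) + 1 + 1) (by positivity),
    Real.Gamma_add_one (s := (n : ℝ) + 1) (by positivity), Real.Gamma_add_one hn0.ne']
  rw [show (3 + 3 * n + 1 * (n * (n + 1)) : ℝ) = (n + 1) * (n + 1 + 1 + 1) by ring]
  field_simp
  ring

theorem normConst_lapGen_div_cumGen (hn : 1 ≤ n) :
    normConst n lapGen / normConst n (cumGen lapGen) = n + 1 := by
  have hn0 : (0 : ℝ) < n := by exact_mod_cast hn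
  have := Real.Gamma_pos_of_pos hn0
  have := Real.Gamma_pos_of_pos (half_pos hn0)
  rw [normConst_lapGen hn, normConst_quadratic_mul_exp_neg_sqrt hn (G := cumGen lapGen)
    (a := 1) (b := 1) (c := 0) fun t ht => by rw [cumGen_lapGen ht]; ring]
  field_simp
  ring

theorem normConst_lapGen_div_cumGen_cumGen (hn : 1 ≤ n) :
    normConst n lapGen / normConst n (cumGen (cumGen lapGen)) = (n + 3) * (n + 1) := by
  have hn0 : (0 : ℝ) < n := by exact_mod_cast hn
  have := Real.Gamma_pos_of_pos hn0
  have := Real.Gamma_pos_of_pos (half_pos hn0)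
  rw [normConst_lapGen hn, normConst_quadratic_mul_exp_neg_sqrt hn (G := cumGen (cumGen lapGen))
    (a := 3) (b := 3) (c := 1) fun t ht => by rw [cumGen_cumGen_lapGen ht]; ring]
  field_simp
  ring

theorem cumGen_lapGen_half_mul {t : ℝ} (ht : 0 ≤ t) :
    cumGen lapGen ((1 / 2) * t) = (1 + √t) * lapGen ((1 / 2) * t) := by
  rw [cumGen_lapGen (by positivity), lapGen, ← mul_assoc, mul_one_div_cancel two_ne_zero, one_mul]

end Constants

/-! ### The reduced densities -/

section ReducedDensities

variable {n : ℕ} {g : ℝ → ℝ}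

theorem card_ne (k : Fin n) : Fintype.card {l : Fin n // l ≠ k} = n - 1 := by
  simp [Fintype.card_subtype_compl]

theorem card_ne_and_ne {i j : Fin n} (hij : i ≠ j) :
    Fintype.card {l : Fin n // l ≠ i ∧ l ≠ j} = n - 2 := by
  have h_filter :
      Finset.univ.filter (fun l : Fin n => l ≠ i ∧ l ≠ j) = ({i, j} : Finset (Fin n))ᶜ := by
    ext l; simp
  rw [Fintype.card_subtype, h_filter, Finset.card_compl, Finset.card_pair hij, Fintype.card_fin]

theorem densW_eq_sphDensity (g : ℝ → ℝ) (lam : Fin n → ℝ) (k : Fin n) :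
    densW g lam k = sphDensity (genW g lam k) := by
  ext w
  rw [densW, constW, sphDensity, card_ne]

theorem densV_eq_sphDensity (g : ℝ → ℝ) (lam : Fin n → ℝ) (k : Fin n) :
    densV g lam k = sphDensity (genV g lam k) := by
  ext v
  rw [densV, constV, sphDensity, card_ne]

theorem densU_eq_sphDensity (g : ℝ → ℝ) (lam : Fin n → ℝ) {i j : Fin n} (hij : i ≠ j) :
    densU g lam i j = sphDensity (genU g lam i j) := by
  ext u
  rw [densU, constU, sphDensity, card_ne_and_ne hij]

namespace IsRegularGen

protected theorem genW (hg : IsRegularGen g) (lam : Fin n → ℝ) (k : Fin n) :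
    IsRegularGen (genW g lam k) :=
  hg.cumGen.comp_add_right (by positivity)

protected theorem genV (hg : IsRegularGen g) (lam : Fin n → ℝ) (k : Fin n) :
    IsRegularGen (genV g lam k) :=
  hg.cumGen.cumGen.comp_add_right (by positivity)

protected theorem genU (hg : IsRegularGen g) (lam : Fin n → ℝ) (i j : Fin n) :
    IsRegularGen (genU g lam i j) := by
  have h_shift := hg.cumGen.cumGen.comp_add_right
    (show 0 ≤ 1 / 2 * lam i ^ 2 + 1 / 2 * lam j ^ 2 by positivity)
  simp only [← add_assoc] at h_shift
  exact h_shift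

theorem integral_densW (hg : IsRegularGen g) (lam : Fin n → ℝ) (k : Fin n) :
    ∫ w, densW g lam k w = 1 := by
  rw [densW_eq_sphDensity, (hg.genW lam k).integral_sphDensity]

theorem integral_densV (hg : IsRegularGen g) (lam : Fin n → ℝ) (k : Fin n) :
    ∫ v, densV g lam k v = 1 := by
  rw [densV_eq_sphDensity, (hg.genV lam k).integral_sphDensity]

theorem integral_densU (hg : IsRegularGen g) (lam : Fin n → ℝ) {i j : Fin n} (hij : i ≠ j) :
    ∫ u, densU g lam i j u = 1 := by
  rw [densU_eq_sphDensity g lam hij, (hg.genU lam i j).integral_sphDensity]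

end IsRegularGen

variable (lam : Fin n → ℝ)

theorem genW_lapGen (k : Fin n) {t : ℝ} (ht : 0 ≤ t) : genW lapGen lam k t =
    (1 + √(2 * t + lam k ^ 2)) * Real.exp (-√(2 * t + lam k ^ 2)) := by
  rw [genW, cumGen_lapGen (by positivity)]
  ring_nf

theorem genV_lapGen (k : Fin n) {t : ℝ} (ht : 0 ≤ t) : genV lapGen lam k t =
    (3 + (2 * t + lam k ^ 2) + 3 * √(2 * t + lam k ^ 2)) *
      Real.exp (-√(2 * t + lam k ^ 2)) := by
  rw [genV, cumGen_cumGen_lapGen (by positivity)]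
  ring_nf

theorem genU_lapGen (i j : Fin n) {t : ℝ} (ht : 0 ≤ t) : genU lapGen lam i j t =
    (3 + (2 * t + lam i ^ 2 + lam j ^ 2) + 3 * √(2 * t + lam i ^ 2 + lam j ^ 2)) *
      Real.exp (-√(2 * t + lam i ^ 2 + lam j ^ 2)) := by
  rw [genU, cumGen_cumGen_lapGen (by positivity)]
  ring_nf

theorem densW_lapGen (k : Fin n) (w : {l : Fin n // l ≠ k} → ℝ) : densW lapGen lam k w =
    constW lapGen lam k * (1 + √(w ⬝ᵥ w + lam k ^ 2)) * Real.exp (-√(w ⬝ᵥ w + lam k ^ 2)) := by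
  rw [densW, genW_lapGen lam k (by have := dotProduct_self_nonneg w; positivity),
    show 2 * (1 / 2 * (w ⬝ᵥ w)) = w ⬝ᵥ w by ring, mul_assoc]

theorem densV_lapGen (k : Fin n) (v : {l : Fin n // l ≠ k} → ℝ) : densV lapGen lam k v =
    constV lapGen lam k * (3 + (v ⬝ᵥ v + lam k ^ 2) + 3 * √(v ⬝ᵥ v + lam k ^ 2)) *
      Real.exp (-√(v ⬝ᵥ v + lam k ^ 2)) := by
  rw [densV, genV_lapGen lam k (by have := dotProduct_self_nonneg v; positivity),
    show 2 * (1 / 2 * (v ⬝ᵥ v)) = v ⬝ᵥ v by ring, mul_assoc]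

theorem densU_lapGen (i j : Fin n) (u : {l : Fin n // l ≠ i ∧ l ≠ j} → ℝ) :
    densU lapGen lam i j u = constU lapGen lam i j *
      (3 + (u ⬝ᵥ u + lam i ^ 2 + lam j ^ 2) + 3 * √(u ⬝ᵥ u + lam i ^ 2 + lam j ^ 2)) *
        Real.exp (-√(u ⬝ᵥ u + lam i ^ 2 + lam j ^ 2)) := by
  rw [densU, genU_lapGen lam i j (by have := dotProduct_self_nonneg u; positivity),
    show 2 * (1 / 2 * (u ⬝ᵥ u)) = u ⬝ᵥ u by ring, mul_assoc]

theorem normConst_sub_one (hn : 2 ≤ n) (G : ℝ → ℝ) :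
    normConst (n - 1) G = Real.Gamma (((n : ℝ) - 1) / 2) / (2 * π) ^ (((n : ℝ) - 1) / 2) *
      (∫ t in Ioi (0 : ℝ), t ^ (((n : ℝ) - 3) / 2) * G t)⁻¹ := by
  rw [normConst, if_neg (by omega), Nat.cast_sub (by omega),
    show (((n : ℝ) - (1 : ℕ)) / 2 - 1) = ((n : ℝ) - 3) / 2 by push_cast; ring, Nat.cast_one]

theorem normConst_sub_two (hn : 3 ≤ n) (G : ℝ → ℝ) :
    normConst (n - 2) G = Real.Gamma (((n : ℝ) - 2) / 2) / (2 * π) ^ (((n : ℝ) - 2) / 2) *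
      (∫ t in Ioi (0 : ℝ), t ^ (((n : ℝ) - 4) / 2) * G t)⁻¹ := by
  rw [normConst, if_neg (by omega), Nat.cast_sub (by omega),
    show (((n : ℝ) - (2 : ℕ)) / 2 - 1) = ((n : ℝ) - 4) / 2 by push_cast; ring, Nat.cast_ofNat]

theorem constW_lapGen (hn : 2 ≤ n) (k : Fin n) : constW lapGen lam k =
    Real.Gamma (((n : ℝ) - 1) / 2) / (2 * π) ^ (((n : ℝ) - 1) / 2) *
      (∫ t in Ioi (0 : ℝ), t ^ (((n : ℝ) - 3) / 2) *
        (1 + √(2 * t + lam k ^ 2)) * Real.exp (-√(2 * t + lam k ^ 2)))⁻¹ := by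
  rw [constW, normConst_sub_one hn]
  congr 2
  refine setIntegral_congr_fun measurableSet_Ioi fun t ht => ?_
  simp only [genW_lapGen lam k (le_of_lt ht), mul_assoc]

theorem constV_lapGen (hn : 2 ≤ n) (k : Fin n) : constV lapGen lam k =
    Real.Gamma (((n : ℝ) - 1) / 2) / (2 * π) ^ (((n : ℝ) - 1) / 2) *
      (∫ t in Ioi (0 : ℝ), t ^ (((n : ℝ) - 3) / 2) *
        (3 + (2 * t + lam k ^ 2) + 3 * √(2 * t + lam k ^ 2)) *
        Real.exp (-√(2 * t + lam k ^ 2)))⁻¹ := by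
  rw [constV, normConst_sub_one hn]
  congr 2
  refine setIntegral_congr_fun measurableSet_Ioi fun t ht => ?_
  simp only [genV_lapGen lam k (le_of_lt ht), mul_assoc]

theorem constU_lapGen (hn : 3 ≤ n) (i j : Fin n) : constU lapGen lam i j =
    Real.Gamma (((n : ℝ) - 2) / 2) / (2 * π) ^ (((n : ℝ) - 2) / 2) *
      (∫ t in Ioi (0 : ℝ), t ^ (((n : ℝ) - 4) / 2) *
        (3 + (2 * t + lam i ^ 2 + lam j ^ 2) + 3 * √(2 * t + lam i ^ 2 + lam j ^ 2)) *
        Real.exp (-√(2 * t + lam i ^ 2 + lam j ^ 2)))⁻¹ := by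
  rw [constU, normConst_sub_two hn]
  congr 2
  refine setIntegral_congr_fun measurableSet_Ioi fun t ht => ?_
  simp only [genU_lapGen lam i j (le_of_lt ht), mul_assoc]

theorem normConst_lapGen_div_sub_one (hn : 2 ≤ n) (I : ℝ) :
    normConst n lapGen /
        (Real.Gamma (((n : ℝ) - 1) / 2) / (2 * π) ^ (((n : ℝ) - 1) / 2) * I⁻¹) =
      Real.Gamma ((n : ℝ) / 2) * 2 ^ (((n : ℝ) - 3) / 2) /
        (Real.Gamma n * Real.Gamma (((n : ℝ) - 1) / 2) * √π) * I := by
  have h_two_le : (2 : ℝ) ≤ n := by exact_mod_cast hn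
  have h_pow : (2 * π) ^ (((n : ℝ) - 1) / 2) =
      2 ^ (((n : ℝ) - 3) / 2) * 2 * (π ^ ((n : ℝ) / 2) * (√π)⁻¹) := by
    rw [mul_rpow two_pos.le pi_pos.le, ← rpow_add_one two_ne_zero, sqrt_eq_rpow,
      ← rpow_neg pi_pos.le, ← rpow_add pi_pos]
    ring_nf
  have : 0 < Real.Gamma (((n : ℝ) - 1) / 2) := Real.Gamma_pos_of_pos (by linarith)
  have : 0 < Real.Gamma (n : ℝ) := Real.Gamma_pos_of_pos (by linarith)
  rw [div_mul_eq_div_div, div_inv_eq_mul, normConst_lapGen (by omega), h_pow]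
  field_simp

theorem normConst_lapGen_div_sub_two (hn : 3 ≤ n) (I : ℝ) :
    normConst n lapGen /
        (Real.Gamma (((n : ℝ) - 2) / 2) / (2 * π) ^ (((n : ℝ) - 2) / 2) * I⁻¹) =
      ((n : ℝ) - 2) * 2 ^ (((n : ℝ) - 6) / 2) / (Real.Gamma n * π) * I := by
  have h_three_le : (3 : ℝ) ≤ n := by exact_mod_cast hn
  have h_pow : (2 * π) ^ (((n : ℝ) - 2) / 2) =
      2 ^ (((n : ℝ) - 6) / 2) * 4 * (π ^ ((n : ℝ) / 2) * π⁻¹) := by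
    rw [mul_rpow two_pos.le pi_pos.le, show (4 : ℝ) = 2 ^ (2 : ℝ) by norm_num,
      ← rpow_add two_pos, ← rpow_neg_one π, ← rpow_add pi_pos]
    ring_nf
  have h_Gamma : Real.Gamma ((n : ℝ) / 2) =
      ((n : ℝ) - 2) / 2 * Real.Gamma (((n : ℝ) - 2) / 2) := by
    rw [← Real.Gamma_add_one (by linarith)]; ring_nf
  have : 0 < Real.Gamma (((n : ℝ) - 2) / 2) := Real.Gamma_pos_of_pos (by linarith)
  have : 0 < Real.Gamma (n : ℝ) := Real.Gamma_pos_of_pos (by linarith)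
  rw [div_mul_eq_div_div, div_inv_eq_mul, normConst_lapGen (by omega), h_pow, h_Gamma]
  field_simp
  ring

theorem normConst_lapGen_div_constW (hn : 2 ≤ n) (k : Fin n) :
    normConst n lapGen / constW lapGen lam k =
      Real.Gamma ((n : ℝ) / 2) * 2 ^ (((n : ℝ) - 3) / 2) /
          (Real.Gamma n * Real.Gamma (((n : ℝ) - 1) / 2) * √π) *
        ∫ t in Ioi (0 : ℝ), t ^ (((n : ℝ) - 3) / 2) *
          (1 + √(2 * t + lam k ^ 2)) * Real.exp (-√(2 * t + lam k ^ 2)) := by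
  rw [constW_lapGen lam hn, normConst_lapGen_div_sub_one hn]

theorem normConst_lapGen_div_constV (hn : 2 ≤ n) (k : Fin n) :
    normConst n lapGen / constV lapGen lam k =
      Real.Gamma ((n : ℝ) / 2) * 2 ^ (((n : ℝ) - 3) / 2) /
          (Real.Gamma n * Real.Gamma (((n : ℝ) - 1) / 2) * √π) *
        ∫ t in Ioi (0 : ℝ), t ^ (((n : ℝ) - 3) / 2) *
          (3 + (2 * t + lam k ^ 2) + 3 * √(2 * t + lam k ^ 2)) *
          Real.exp (-√(2 * t + lam k ^ 2)) := by
  rw [constV_lapGen lam hn, normConst_lapGen_div_sub_one hn]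

theorem normConst_lapGen_div_constU (hn : 3 ≤ n) (i j : Fin n) :
    normConst n lapGen / constU lapGen lam i j =
      ((n : ℝ) - 2) * 2 ^ (((n : ℝ) - 6) / 2) / (Real.Gamma n * π) *
        ∫ t in Ioi (0 : ℝ), t ^ (((n : ℝ) - 4) / 2) *
          (3 + (2 * t + lam i ^ 2 + lam j ^ 2) + 3 * √(2 * t + lam i ^ 2 + lam j ^ 2)) *
          Real.exp (-√(2 * t + lam i ^ 2 + lam j ^ 2)) := by
  rw [constU_lapGen lam hn, normConst_lapGen_div_sub_two hn]

end ReducedDensities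

/-! ### Singling out one coordinate of an orthant -/

section Coordinates

variable {ι : Type*}

/-- The vector `v` without its `k`-th entry: the analogue of `drop` for an arbitrary index type,
so that the operation can be iterated. -/
def removeCoord (v : ι → ℝ) (k : ι) : {l : ι // l ≠ k} → ℝ := fun l => v l

theorem measurableSet_tailSet [Countable ι] (t : ι → ℝ) : MeasurableSet (tailSet t) := by
  have h_iInter : tailSet t = ⋂ k, {x | t k < x k} := by ext x; simp [tailSet]
  rw [h_iInter]
  exact MeasurableSet.iInter fun k => measurableSet_lt measurable_const (measurable_pi_apply k)

variable [DecidableEq ι]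

/-- The vector with `k`-th entry `s` and the other entries from `w`: the analogue of `put` with a
free `k`-th entry. -/
def insertCoord (k : ι) (s : ℝ) (w : {l : ι // l ≠ k} → ℝ) : ι → ℝ :=
  fun l => if h : l ≠ k then w ⟨l, h⟩ else s

@[simp] theorem insertCoord_self (k : ι) (s : ℝ) (w : {l : ι // l ≠ k} → ℝ) :
    insertCoord k s w k = s := by
  simp [insertCoord]

theorem insertCoord_of_ne {k l : ι} (h : l ≠ k) (s : ℝ) (w : {l : ι // l ≠ k} → ℝ) :
    insertCoord k s w l = w ⟨l, h⟩ := by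
  simp [insertCoord, h]

/-- The splitting of `ℝ^ι` into the coordinates other than `k` and the `k`-th one. -/
def insertCoordEquiv (k : ι) : (({l : ι // l ≠ k} → ℝ) × ℝ) ≃ᵐ (ι → ℝ) :=
  letI : Unique {l : ι // ¬ l ≠ k} := ⟨⟨⟨k, by simp⟩⟩, fun l => Subtype.ext (not_not.1 l.2)⟩
  ((MeasurableEquiv.refl _).prodCongr (MeasurableEquiv.funUnique {l : ι // ¬ l ≠ k} ℝ).symm).trans
    (MeasurableEquiv.piEquivPiSubtypeProd (fun _ : ι => ℝ) (fun l => l ≠ k)).symm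

theorem insertCoordEquiv_apply (k : ι) (p : ({l : ι // l ≠ k} → ℝ) × ℝ) :
    insertCoordEquiv k p = insertCoord k p.2 p.1 := rfl

theorem insertCoordEquiv_preimage_tailSet (lam : ι → ℝ) (k : ι) :
    insertCoordEquiv k ⁻¹' tailSet lam = tailSet (removeCoord lam k) ×ˢ Ioi (lam k) := by
  ext ⟨w, s⟩
  simp only [mem_preimage, insertCoordEquiv_apply, tailSet, mem_prod, mem_Ioi, mem_ofPred_eq]
  constructor
  · intro h
    exact ⟨fun l => by have := h l; rwa [insertCoord_of_ne l.2] at this,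
      by simpa only [insertCoord_self] using h k⟩
  · rintro ⟨hw, hs⟩ l
    by_cases hl : l = k
    · rwa [hl, insertCoord_self]
    · rw [insertCoord_of_ne hl]; exact hw ⟨l, hl⟩

theorem continuous_insertCoord (k : ι) :
    Continuous fun p : ({l : ι // l ≠ k} → ℝ) × ℝ => insertCoord k p.2 p.1 := by
  refine continuous_pi fun l => ?_
  by_cases hl : l = k
  · subst hl; simpa only [insertCoord_self] using continuous_snd
  · simp only [insertCoord_of_ne hl]; fun_prop

variable [Fintype ι]

theorem dotProduct_insertCoord (k : ι) (s : ℝ) (w : {l : ι // l ≠ k} → ℝ) (v : ι → ℝ) :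
    v ⬝ᵥ insertCoord k s w = removeCoord v k ⬝ᵥ w + v k * s := by
  simp only [dotProduct]
  rw [← Fintype.sum_subtype_add_sum_subtype (fun l => l ≠ k) (fun i => v i * insertCoord k s w i)]
  congr 1
  · exact Finset.sum_congr rfl fun l _ => by rw [insertCoord_of_ne l.2]; rfl
  · have h_eq : ∀ l : {l : ι // ¬ l ≠ k}, v l * insertCoord k s w l = v k * s := fun l => by
      rw [not_not.1 l.2, insertCoord_self]
    rw [Finset.sum_congr rfl fun l _ => h_eq l, Finset.sum_const, Finset.card_univ]
    simp

theorem half_insertCoord_dotProduct_self (k : ι) (s : ℝ) (w : {l : ι // l ≠ k} → ℝ) :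
    (1 / 2) * (insertCoord k s w ⬝ᵥ insertCoord k s w) =
      (1 / 2) * (w ⬝ᵥ w) + (1 / 2) * s ^ 2 := by
  have h_remove : removeCoord (insertCoord k s w) k = w :=
    funext fun l => insertCoord_of_ne l.2 _ _
  rw [dotProduct_insertCoord, insertCoord_self, h_remove]
  ring

theorem measurePreserving_insertCoordEquiv (k : ι) :
    MeasurePreserving (insertCoordEquiv k) (volume.prod volume) volume := by
  let _ : Unique {l : ι // ¬ l ≠ k} := ⟨⟨⟨k, by simp⟩⟩, fun l => Subtype.ext (not_not.1 l.2)⟩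
  have h_split := (volume_preserving_piEquivPiSubtypeProd (fun _ : ι => ℝ) (fun l => l ≠ k)).symm
  have h_unique : MeasurePreserving (MeasurableEquiv.funUnique {l : ι // ¬ l ≠ k} ℝ).symm
      (volume : Measure ℝ) volume := by
    convert (volume_preserving_funUnique {l : ι // ¬ l ≠ k} ℝ).symm
  exact h_split.comp ((MeasurePreserving.id _).prod h_unique)

theorem measurePreserving_insertCoordEquiv_restrict (lam : ι → ℝ) (k : ι) :
    MeasurePreserving (insertCoordEquiv k)
      ((volume.restrict (tailSet (removeCoord lam k))).prod (volume.restrict (Ioi (lam k))))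
      (volume.restrict (tailSet lam)) := by
  have h_restrict := (measurePreserving_insertCoordEquiv k).restrict_preimage_emb
    (MeasurableEquiv.measurableEmbedding _) (tailSet lam)
  rwa [insertCoordEquiv_preimage_tailSet, ← Measure.prod_restrict] at h_restrict

theorem integrableOn_tailSet_iff (lam : ι → ℝ) (k : ι) (f : (ι → ℝ) → ℝ) :
    IntegrableOn f (tailSet lam) ↔ Integrable (fun p => f (insertCoord k p.2 p.1))
      ((volume.restrict (tailSet (removeCoord lam k))).prod (volume.restrict (Ioi (lam k)))) :=
  ((measurePreserving_insertCoordEquiv_restrict lam k).integrable_comp_emb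
    (MeasurableEquiv.measurableEmbedding _)).symm

theorem setIntegral_tailSet {lam : ι → ℝ} (k : ι) {f : (ι → ℝ) → ℝ}
    (hf : IntegrableOn f (tailSet lam)) :
    ∫ x in tailSet lam, f x =
      ∫ w in tailSet (removeCoord lam k), ∫ s in Ioi (lam k), f (insertCoord k s w) := by
  rw [← integral_prod _ ((integrableOn_tailSet_iff lam k f).1 hf)]
  exact ((measurePreserving_insertCoordEquiv_restrict lam k).integral_comp
    (MeasurableEquiv.measurableEmbedding _) f).symm

end Coordinates

/-! ### Partial integration on an orthant -/

section Primitive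

variable {a : ℝ} {p φ ψ : ℝ → ℝ}

theorem integral_indicator_Ici_Ioi {t : ℝ} (ht : a < t) (p : ℝ → ℝ) :
    ∫ s in Ioi a, (Ici t).indicator p s = ∫ s in Ioi t, p s := by
  rw [integral_indicator measurableSet_Ici, Measure.restrict_restrict measurableSet_Ici,
    inter_eq_left.2 (Ici_subset_Ioi.2 ht), integral_Ici_eq_integral_Ioi]

theorem integrable_indicator_snd_le_fst (hp : IntegrableOn p (Ioi a))
    (hψ : AEStronglyMeasurable ψ (volume.restrict (Ioi a)))
    (h_tail : IntegrableOn (fun t => ψ t * ∫ s in Ioi t, |p s|) (Ioi a)) :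
    Integrable ({x : ℝ × ℝ | x.2 ≤ x.1}.indicator fun x => p x.1 * ψ x.2)
      ((volume.restrict (Ioi a)).prod (volume.restrict (Ioi a))) := by
  have h_meas : AEStronglyMeasurable ({x : ℝ × ℝ | x.2 ≤ x.1}.indicator fun x => p x.1 * ψ x.2)
      ((volume.restrict (Ioi a)).prod (volume.restrict (Ioi a))) :=
    (hp.1.comp_fst.mul hψ.comp_snd).indicator (measurableSet_le measurable_snd measurable_fst)
  have h_section : ∀ s t, {x : ℝ × ℝ | x.2 ≤ x.1}.indicator (fun x => p x.1 * ψ x.2) (s, t) =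
      (Ici t).indicator p s * ψ t := fun s t => by
    by_cases h : t ≤ s <;> simp [indicator, h]
  refine (integrable_prod_iff' h_meas).2 ⟨Eventually.of_forall fun t => ?_, ?_⟩
  · simp only [h_section]
    exact (Integrable.indicator hp measurableSet_Ici).mul_const _
  · refine (IntegrableOn.congr_fun (f := fun t => abs (ψ t * ∫ s in Ioi t, |p s|)) h_tail.abs
      (fun t ht => ?_) measurableSet_Ioi)
    have h_norm : ∀ s, ‖(Ici t).indicator p s‖ = (Ici t).indicator (fun s => |p s|) s := fun s => by
      by_cases h : t ≤ s <;> simp [indicator, h]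
    simp only [h_section, norm_mul, h_norm]
    rw [integral_mul_const, integral_indicator_Ici_Ioi ht, abs_mul,
      abs_of_nonneg (integral_nonneg fun s => abs_nonneg _), norm_eq_abs, mul_comm]

/-- The order of integration over the triangle `a < t ≤ s` is exchanged; no boundary term at
infinity has to be controlled. -/
theorem integral_Ioi_primitive_mul (hp : IntegrableOn p (Ioi a))
    (hψ : AEStronglyMeasurable ψ (volume.restrict (Ioi a)))
    (h_tail : IntegrableOn (fun t => ψ t * ∫ s in Ioi t, |p s|) (Ioi a))
    (hφ : ∀ s, a < s → φ s = φ a + ∫ t in Ioc a s, ψ t) :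
    IntegrableOn (fun s => φ s * p s) (Ioi a) ∧
      ∫ s in Ioi a, φ s * p s =
        φ a * (∫ s in Ioi a, p s) + ∫ t in Ioi a, ψ t * ∫ s in Ioi t, p s := by
  have h_int := integrable_indicator_snd_le_fst hp hψ h_tail
  set f : ℝ × ℝ → ℝ := {x : ℝ × ℝ | x.2 ≤ x.1}.indicator fun x => p x.1 * ψ x.2 with hf
  have h_inner_t : ∀ s ∈ Ioi a, φ s * p s = φ a * p s + ∫ t in Ioi a, f (s, t) := fun s hs => by
    have h_section : ∀ t, f (s, t) = p s * (Iic s).indicator ψ t := fun t => by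
      by_cases h : t ≤ s <;> simp [hf, indicator, h]
    simp only [h_section]
    rw [integral_const_mul, integral_indicator measurableSet_Iic,
      Measure.restrict_restrict measurableSet_Iic, inter_comm, Ioi_inter_Iic, hφ s hs]
    ring
  have h_inner_s : ∀ t ∈ Ioi a, ∫ s in Ioi a, f (s, t) = ψ t * ∫ s in Ioi t, p s := fun t ht => by
    have h_section : ∀ s, f (s, t) = (Ici t).indicator p s * ψ t := fun s => by
      by_cases h : t ≤ s <;> simp [hf, indicator, h]
    simp only [h_section]
    rw [integral_mul_const, integral_indicator_Ici_Ioi ht, mul_comm]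
  have h_left := hp.const_mul (φ a)
  have h_right : IntegrableOn (fun s => ∫ t in Ioi a, f (s, t)) (Ioi a) :=
    h_int.integral_prod_left
  refine ⟨IntegrableOn.congr_fun (h_left.add h_right) (fun s hs => (h_inner_t s hs).symm)
    measurableSet_Ioi, ?_⟩
  rw [setIntegral_congr_fun measurableSet_Ioi h_inner_t, integral_add h_left h_right,
    integral_const_mul, integral_integral_swap (f := fun s t => f (s, t)) h_int,
    setIntegral_congr_fun measurableSet_Ioi h_inner_s]

theorem integral_Ioi_abs_primitive_mul_le (hp : IntegrableOn p (Ioi a))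
    (hψ : AEStronglyMeasurable ψ (volume.restrict (Ioi a)))
    (h_tail : IntegrableOn (fun t => ψ t * ∫ s in Ioi t, |p s|) (Ioi a))
    (hφ : ∀ s, a < s → φ s = φ a + ∫ t in Ioc a s, ψ t) :
    ∫ s in Ioi a, |φ s * p s| ≤
      |φ a| * (∫ s in Ioi a, |p s|) + ∫ t in Ioi a, |ψ t| * ∫ s in Ioi t, |p s| := by
  have h_tail_abs : IntegrableOn (fun t => |ψ t| * ∫ s in Ioi t, abs |p s|) (Ioi a) := by
    refine h_tail.abs.congr (Eventually.of_forall fun t => ?_)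
    have h_nonneg : 0 ≤ ∫ s in Ioi t, |p s| := integral_nonneg fun s => abs_nonneg (p s)
    simp only [abs_mul, abs_abs, abs_of_nonneg h_nonneg]
  obtain ⟨h_int, h_eq⟩ := integral_Ioi_primitive_mul
    (φ := fun s => |φ a| + ∫ t in Ioc a s, |ψ t|) (ψ := fun t => |ψ t|) hp.abs hψ.norm
    h_tail_abs (by simp)
  simp only [Ioc_self, Measure.restrict_empty, integral_zero_measure, add_zero] at h_eq
  rw [← h_eq]
  refine setIntegral_mono_on (integral_Ioi_primitive_mul hp hψ h_tail hφ).1.abs h_int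
    measurableSet_Ioi fun s hs => ?_
  rw [abs_mul, hφ s hs]
  gcongr
  exact (abs_add_le _ _).trans (add_le_add_right (abs_integral_le_integral_abs) _)

end Primitive

namespace IsRegularGen

variable {g : ℝ → ℝ} (hg : IsRegularGen g)
include hg

theorem tendsto_atTop_zero : Tendsto g atTop (𝓝 0) := by
  obtain ⟨C, hC⟩ := hg.rapid_decay 1
  refine squeeze_zero' (g := fun t => C / (1 + t))
    ((eventually_ge_atTop 0).mono fun t ht => (hg.pos t ht).le)
    ((eventually_ge_atTop 0).mono fun t ht => ?_)
    (tendsto_const_nhds.div_atTop (tendsto_atTop_add_const_left _ _ tendsto_id))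
  rw [le_div_iff₀ (by linarith), mul_comm]
  simpa only [pow_one] using hC t ht

theorem integral_Ioi_id_mul_comp_half_sq {b : ℝ} (hb : 0 ≤ b) (t : ℝ) :
    IntegrableOn (fun s => s * g (b + (1 / 2) * s ^ 2)) (Ioi t) ∧
      ∫ s in Ioi t, s * g (b + (1 / 2) * s ^ 2) = cumGen g (b + (1 / 2) * t ^ 2) := by
  have h_deriv (s : ℝ) : HasDerivAt (fun s => cumGen g (b + (1 / 2) * s ^ 2))
      (-(s * g (b + (1 / 2) * s ^ 2))) s := by
    have h_inner : HasDerivAt (fun s : ℝ => b + (1 / 2) * s ^ 2) s s := by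
      refine (((hasDerivAt_pow 2 s).const_mul (1 / 2)).const_add b).congr_deriv ?_
      simp
    exact ((hg.hasDerivAt_cumGen _).comp s h_inner).congr_deriv (by ring)
  have h_lim : Tendsto (fun s : ℝ => cumGen g (b + (1 / 2) * s ^ 2)) atTop (𝓝 0) :=
    hg.cumGen.tendsto_atTop_zero.comp (tendsto_atTop_add_const_left _ b
      (Tendsto.const_mul_atTop (by norm_num) (tendsto_pow_atTop two_ne_zero)))
  have h_Ioi_zero : IntegrableOn (fun s => s * g (b + (1 / 2) * s ^ 2)) (Ioi 0) := by
    simpa only [Pi.neg_def, neg_neg] using (integrableOn_Ioi_deriv_of_nonpos' (fun s _ => h_deriv s)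
      (fun s hs => neg_nonpos.2 (mul_nonneg (mem_Ioi.1 hs).le (hg.pos _ (by positivity)).le))
      h_lim).neg
  have h_int : IntegrableOn (fun s => s * g (b + (1 / 2) * s ^ 2)) (Ioi t) :=
    integrableOn_Ioi_of_continuous (by have := hg.continuous; fun_prop) h_Ioi_zero t
  refine ⟨h_int, ?_⟩
  have h_ftc := integral_Ioi_of_hasDerivAt_of_tendsto' (fun s _ => h_deriv s) h_int.neg h_lim
  rwa [integral_neg, zero_sub, neg_inj] at h_ftc

theorem exists_integral_Ioi_abs_id_mul_le (a : ℝ) :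
    ∃ C, ∀ b, 0 ≤ b → ∀ t, a ≤ t →
      ∫ s in Ioi t, |s * g (b + (1 / 2) * s ^ 2)| ≤ C * cumGen g (b + (1 / 2) * t ^ 2) := by
  obtain ⟨C, hC⟩ := hg.cumGen.le_mul_shift ((1 / 2) * a ^ 2) (by positivity)
  have h_eq {b : ℝ} (hb : 0 ≤ b) {t : ℝ} (ht : 0 ≤ t) :
      ∫ s in Ioi t, |s * g (b + (1 / 2) * s ^ 2)| = cumGen g (b + (1 / 2) * t ^ 2) := by
    rw [← (hg.integral_Ioi_id_mul_comp_half_sq hb t).2]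
    exact setIntegral_congr_fun measurableSet_Ioi fun s hs =>
      abs_of_nonneg (mul_nonneg (ht.trans (mem_Ioi.1 hs).le) (hg.pos _ (by positivity)).le)
  have hC_pos : 0 < C := (pos_iff_pos_of_mul_pos ((hg.cumGen_pos le_rfl).trans_le (hC 0 le_rfl))).2
    (hg.cumGen_pos (by positivity))
  refine ⟨max 1 (2 * C), fun b hb t ht => ?_⟩
  have h_pos : 0 < cumGen g (b + (1 / 2) * t ^ 2) := hg.cumGen_pos (by positivity)
  rcases le_total 0 t with ht₀ | ht₀
  · rw [h_eq hb ht₀]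
    exact le_mul_of_one_le_left h_pos.le (le_max_left _ _)
  have h_even : ∫ s, |s * g (b + (1 / 2) * s ^ 2)| = 2 * cumGen g b := by
    have h_zero : ∫ s in Ioi 0, |s * g (b + (1 / 2) * s ^ 2)| = cumGen g b := by
      simpa using h_eq hb le_rfl
    rw [← h_zero, ← integral_comp_abs]
    simp only [abs_mul, sq_abs, abs_abs]
  have h_int : Integrable fun s => |s * g (b + (1 / 2) * s ^ 2)| := by
    refine Integrable.of_integral_ne_zero ?_
    rw [h_even]
    exact mul_ne_zero two_ne_zero (hg.cumGen_pos hb).ne'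
  calc ∫ s in Ioi t, |s * g (b + (1 / 2) * s ^ 2)|
      ≤ ∫ s, |s * g (b + (1 / 2) * s ^ 2)| :=
        setIntegral_le_integral h_int (Eventually.of_forall fun s => abs_nonneg _)
    _ = 2 * cumGen g b := h_even
    _ ≤ 2 * (C * cumGen g (b + (1 / 2) * a ^ 2)) := by gcongr; exact hC b hb
    _ ≤ 2 * (C * cumGen g (b + (1 / 2) * t ^ 2)) := by
        have h_sq : t ^ 2 ≤ a ^ 2 := sq_le_sq.2 (abs_le_abs_of_nonpos ht₀ ht)
        gcongr
        exact hg.antitoneOn_cumGen (mem_Ici.2 (by positivity)) (mem_Ici.2 (by positivity))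
          (by gcongr)
    _ ≤ max 1 (2 * C) * cumGen g (b + (1 / 2) * t ^ 2) := by
        rw [← mul_assoc]; gcongr; exact le_max_right _ _

theorem integrableOn_mul_integral_Ioi_abs {ψ : ℝ → ℝ} {a b : ℝ} (hb : 0 ≤ b)
    (hψ : AEStronglyMeasurable ψ (volume.restrict (Ioi a)))
    (h_int : IntegrableOn (fun s => ψ s * cumGen g (b + (1 / 2) * s ^ 2)) (Ioi a)) :
    IntegrableOn (fun t => ψ t * ∫ s in Ioi t, |s * g (b + (1 / 2) * s ^ 2)|) (Ioi a) := by
  obtain ⟨C, hC⟩ := hg.exists_integral_Ioi_abs_id_mul_le a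
  have h_antitone : Antitone fun t => ∫ s in Ioi t, |s * g (b + (1 / 2) * s ^ 2)| := fun t _ htu =>
    setIntegral_mono_set (hg.integral_Ioi_id_mul_comp_half_sq hb t).1.abs
      (Eventually.of_forall fun s => abs_nonneg _) (Ioi_subset_Ioi htu).eventuallyLE
  refine (h_int.abs.const_mul C).mono' (hψ.mul h_antitone.measurable.aestronglyMeasurable)
    (ae_restrict_of_forall_mem measurableSet_Ioi fun t ht => ?_)
  have h_pos : 0 < cumGen g (b + (1 / 2) * t ^ 2) := hg.cumGen_pos (by positivity)
  rw [norm_mul, norm_of_nonneg (integral_nonneg fun s => abs_nonneg _), norm_eq_abs, abs_mul,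
    abs_of_pos h_pos, mul_left_comm]
  gcongr
  exact hC b hb t (mem_Ioi.1 ht).le

theorem integral_Ioi_id_mul_primitive_mul {φ ψ : ℝ → ℝ} {a b : ℝ} (hb : 0 ≤ b)
    (hψ : AEStronglyMeasurable ψ (volume.restrict (Ioi a)))
    (h_int : IntegrableOn (fun s => ψ s * cumGen g (b + (1 / 2) * s ^ 2)) (Ioi a))
    (hφ : ∀ s, a < s → φ s = φ a + ∫ t in Ioc a s, ψ t) :
    IntegrableOn (fun s => s * φ s * g (b + (1 / 2) * s ^ 2)) (Ioi a) ∧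
      ∫ s in Ioi a, s * φ s * g (b + (1 / 2) * s ^ 2) =
        φ a * cumGen g (b + (1 / 2) * a ^ 2) +
          ∫ s in Ioi a, ψ s * cumGen g (b + (1 / 2) * s ^ 2) := by
  have h_tail := hg.integral_Ioi_id_mul_comp_half_sq hb
  have h_comm : ∀ s, s * φ s * g (b + (1 / 2) * s ^ 2) = φ s * (s * g (b + (1 / 2) * s ^ 2)) :=
    fun s => by ring
  simp only [h_comm, ← (h_tail _).2]
  exact integral_Ioi_primitive_mul (h_tail a).1 hψ
    (hg.integrableOn_mul_integral_Ioi_abs hb hψ h_int) hφ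

theorem exists_integral_Ioi_abs_id_mul_primitive_mul_le (a : ℝ) :
    ∃ C, ∀ b, 0 ≤ b → ∀ φ ψ : ℝ → ℝ, AEStronglyMeasurable ψ (volume.restrict (Ioi a)) →
      IntegrableOn (fun s => ψ s * cumGen g (b + (1 / 2) * s ^ 2)) (Ioi a) →
      (∀ s, a < s → φ s = φ a + ∫ t in Ioc a s, ψ t) →
      ∫ s in Ioi a, |s * φ s * g (b + (1 / 2) * s ^ 2)| ≤
        C * (|φ a * cumGen g (b + (1 / 2) * a ^ 2)| +
          ∫ s in Ioi a, |ψ s * cumGen g (b + (1 / 2) * s ^ 2)|) := by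
  obtain ⟨C, hC⟩ := hg.exists_integral_Ioi_abs_id_mul_le a
  refine ⟨C, fun b hb φ ψ hψ h_int hφ => ?_⟩
  have h_pos : ∀ t, 0 < cumGen g (b + (1 / 2) * t ^ 2) := fun t => hg.cumGen_pos (by positivity)
  have h_tail := hg.integrableOn_mul_integral_Ioi_abs hb hψ h_int
  have h_tail_abs : IntegrableOn
      (fun t => |ψ t| * ∫ s in Ioi t, |s * g (b + (1 / 2) * s ^ 2)|) (Ioi a) := by
    refine h_tail.norm.congr (Eventually.of_forall fun t => ?_)
    simp only [norm_mul, norm_eq_abs]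
    rw [abs_of_nonneg (integral_nonneg fun s => abs_nonneg _)]
  calc ∫ s in Ioi a, |s * φ s * g (b + (1 / 2) * s ^ 2)|
      = ∫ s in Ioi a, |φ s * (s * g (b + (1 / 2) * s ^ 2))| := by
        simp only [mul_comm _ (φ _), mul_assoc]
    _ ≤ |φ a| * (∫ s in Ioi a, |s * g (b + (1 / 2) * s ^ 2)|) +
          ∫ t in Ioi a, |ψ t| * ∫ s in Ioi t, |s * g (b + (1 / 2) * s ^ 2)| :=
        integral_Ioi_abs_primitive_mul_le (hg.integral_Ioi_id_mul_comp_half_sq hb a).1 hψ h_tail hφ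
    _ ≤ |φ a| * (C * cumGen g (b + (1 / 2) * a ^ 2)) +
          ∫ t in Ioi a, |ψ t| * (C * cumGen g (b + (1 / 2) * t ^ 2)) := by
        refine add_le_add (by gcongr; exact hC b hb a le_rfl) (setIntegral_mono_on h_tail_abs ?_
          measurableSet_Ioi fun t ht => by gcongr; exact hC b hb t (mem_Ioi.1 ht).le)
        refine (h_int.abs.const_mul C).congr (Eventually.of_forall fun t => ?_)
        simp only [abs_mul, abs_of_pos (h_pos t)]
        ring
    _ = C * (|φ a * cumGen g (b + (1 / 2) * a ^ 2)| +
          ∫ s in Ioi a, |ψ s * cumGen g (b + (1 / 2) * s ^ 2)|) := by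
        simp only [abs_mul, abs_of_pos (h_pos _), mul_add, mul_left_comm _ C, integral_const_mul]

end IsRegularGen

section Orthant

variable {ι : Type*} [DecidableEq ι]

/-- `F` is an indefinite integral of `D` along every line parallel to the `k`-th axis: the weak
form of `∂F/∂x_k = D` needed for partial integration. -/
def HasIntegralPartial (k : ι) (F D : (ι → ℝ) → ℝ) : Prop :=
  ∀ w a b, F (insertCoord k b w) - F (insertCoord k a w) = ∫ s in a..b, D (insertCoord k s w)

theorem HasIntegralPartial.of_hasDerivAt {k : ι} {F D : (ι → ℝ) → ℝ} (hD : Continuous D)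
    (hFD : ∀ w s, HasDerivAt (fun s => F (insertCoord k s w)) (D (insertCoord k s w)) s) :
    HasIntegralPartial k F D := fun w _ _ =>
  (intervalIntegral.integral_eq_sub_of_hasDerivAt (fun s _ => hFD w s)
    ((hD.comp ((continuous_insertCoord k).comp
      (Continuous.prodMk_right w))).intervalIntegrable _ _)).symm

theorem HasIntegralPartial.eq_add_setIntegral {k : ι} {F D : (ι → ℝ) → ℝ}
    (hFD : HasIntegralPartial k F D) (w : {l : ι // l ≠ k} → ℝ) {a s : ℝ} (has : a < s) :
    F (insertCoord k s w) = F (insertCoord k a w) + ∫ t in Ioc a s, D (insertCoord k t w) := by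
  rw [← intervalIntegral.integral_of_le has.le, ← hFD, add_sub_cancel]

theorem measurable_comp_insertCoord {D : (ι → ℝ) → ℝ} (hD : Measurable D) (k : ι)
    (w : {l : ι // l ≠ k} → ℝ) : Measurable fun s => D (insertCoord k s w) :=
  hD.comp ((insertCoordEquiv k).measurable.comp measurable_prodMk_left)

theorem hasDerivAt_insertCoord (k j : ι) (w : {l : ι // l ≠ k} → ℝ) (s : ℝ) :
    HasDerivAt (fun s => insertCoord k s w j) (if j = k then 1 else 0) s := by
  by_cases hj : j = k
  · simpa only [hj, insertCoord_self, if_true] using hasDerivAt_id' s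
  · simpa only [insertCoord_of_ne hj, if_neg hj] using hasDerivAt_const s _

variable [Fintype ι]

theorem hasDerivAt_dotProduct_insertCoord (γ : ι → ℝ) (k : ι) (w : {l : ι // l ≠ k} → ℝ) (s : ℝ) :
    HasDerivAt (fun s => γ ⬝ᵥ insertCoord k s w) (γ k) s := by
  simp only [dotProduct_insertCoord]
  simpa using ((hasDerivAt_id s).const_mul (γ k)).const_add (removeCoord γ k ⬝ᵥ w)

theorem HasIntegralPartial.comp_dotProduct {φ : ℝ → ℝ}
    (hφ : ∀ a b, AbsolutelyContinuousOnInterval φ a b) (γ : ι → ℝ) (k : ι) :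
    HasIntegralPartial k (fun x => φ (γ ⬝ᵥ x)) (fun x => γ k * deriv φ (γ ⬝ᵥ x)) := by
  intro w a b
  simp only [dotProduct_insertCoord]
  rw [intervalIntegral.integral_const_mul, intervalIntegral.mul_integral_comp_add_mul,
    (hφ _ _).integral_deriv_eq_sub]

theorem HasIntegralPartial.coord_mul_comp_dotProduct {H : ℝ → ℝ} (hH : ContDiff ℝ 1 H)
    (γ : ι → ℝ) (k j : ι) :
    HasIntegralPartial k (fun x => x j * H (γ ⬝ᵥ x)) fun x =>
      (if j = k then 1 else 0) * H (γ ⬝ᵥ x) + γ k * (x j * deriv H (γ ⬝ᵥ x)) := by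
  have hH_cont := hH.continuous
  have := hH.continuous_deriv_one
  refine .of_hasDerivAt (by fun_prop) fun w s => ?_
  have hH_deriv := (hH.differentiable_one (γ ⬝ᵥ insertCoord k s w)).hasDerivAt.comp s
    (hasDerivAt_dotProduct_insertCoord γ k w s)
  refine ((hasDerivAt_insertCoord k j w s).mul hH_deriv).congr_deriv ?_
  simp only [Function.comp_apply]
  ring

namespace IsRegularGen

variable {g : ℝ → ℝ} {k : ι} {F D : (ι → ℝ) → ℝ} {lam : ι → ℝ}

theorem integrableOn_tailSet_coord_mul (hg : IsRegularGen g) (hFD : HasIntegralPartial k F D)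
    (hF : Measurable F) (hD : Measurable D)
    (h_face : IntegrableOn (fun w => F (insertCoord k (lam k) w) *
      cumGen g ((1 / 2) * (w ⬝ᵥ w) + (1 / 2) * lam k ^ 2)) (tailSet (removeCoord lam k)))
    (h_bulk : IntegrableOn (fun x => D x * cumGen g ((1 / 2) * (x ⬝ᵥ x))) (tailSet lam)) :
    IntegrableOn (fun x => x k * F x * g ((1 / 2) * (x ⬝ᵥ x))) (tailSet lam) := by
  rw [integrableOn_tailSet_iff lam k] at h_bulk ⊢
  have h_cont := continuous_comp_half_dotProduct_self (ι := ι) hg.continuous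
  have h_meas := (((measurable_pi_apply k).mul hF).mul h_cont.measurable).comp
    (insertCoordEquiv k).measurable
  simp only [half_insertCoord_dotProduct_self, insertCoord_self, insertCoordEquiv_apply,
    Function.comp_def, Pi.mul_apply] at h_bulk h_meas ⊢
  obtain ⟨C, hC⟩ := hg.exists_integral_Ioi_abs_id_mul_primitive_mul_le (lam k)
  have h_nonneg (w : {l : ι // l ≠ k} → ℝ) : 0 ≤ (1 / 2) * (w ⬝ᵥ w) := by
    have := dotProduct_self_nonneg w; positivity
  have h_fibre_meas (w : {l : ι // l ≠ k} → ℝ) :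
      AEStronglyMeasurable (fun s => D (insertCoord k s w)) (volume.restrict (Ioi (lam k))) :=
    (measurable_comp_insertCoord hD k w).aestronglyMeasurable
  refine (integrable_prod_iff h_meas.aestronglyMeasurable).2
    ⟨h_bulk.prod_right_ae.mono fun w hw => ?_, ?_⟩
  · exact (hg.integral_Ioi_id_mul_primitive_mul (h_nonneg w) (h_fibre_meas w) hw
      fun s hs => hFD.eq_add_setIntegral w hs).1
  · refine ((h_face.abs.add h_bulk.norm.integral_prod_left).const_mul C).mono'
      h_meas.norm.aestronglyMeasurable.integral_prod_right'
      (h_bulk.prod_right_ae.mono fun w hw => ?_)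
    rw [norm_of_nonneg (integral_nonneg fun s => norm_nonneg _)]
    exact hC _ (h_nonneg w) _ _ (h_fibre_meas w) hw fun s hs => hFD.eq_add_setIntegral w hs

theorem setIntegral_tailSet_coord_mul (hg : IsRegularGen g) (hFD : HasIntegralPartial k F D)
    (hF : Measurable F) (hD : Measurable D)
    (h_face : IntegrableOn (fun w => F (insertCoord k (lam k) w) *
      cumGen g ((1 / 2) * (w ⬝ᵥ w) + (1 / 2) * lam k ^ 2)) (tailSet (removeCoord lam k)))
    (h_bulk : IntegrableOn (fun x => D x * cumGen g ((1 / 2) * (x ⬝ᵥ x))) (tailSet lam)) :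
    ∫ x in tailSet lam, x k * F x * g ((1 / 2) * (x ⬝ᵥ x)) =
      (∫ w in tailSet (removeCoord lam k), F (insertCoord k (lam k) w) *
        cumGen g ((1 / 2) * (w ⬝ᵥ w) + (1 / 2) * lam k ^ 2)) +
      ∫ x in tailSet lam, D x * cumGen g ((1 / 2) * (x ⬝ᵥ x)) := by
  have h_fibre := (integrableOn_tailSet_iff lam k _).1 h_bulk
  rw [setIntegral_tailSet k (hg.integrableOn_tailSet_coord_mul hFD hF hD h_face h_bulk),
    setIntegral_tailSet k h_bulk]
  simp only [half_insertCoord_dotProduct_self, insertCoord_self] at h_fibre ⊢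
  rw [← integral_add h_face h_fibre.integral_prod_left]
  refine integral_congr_ae (h_fibre.prod_right_ae.mono fun w hw => ?_)
  have h_nonneg : 0 ≤ (1 / 2) * (w ⬝ᵥ w) := by have := dotProduct_self_nonneg w; positivity
  exact (hg.integral_Ioi_id_mul_primitive_mul h_nonneg
    (measurable_comp_insertCoord hD k w).aestronglyMeasurable hw
    fun s hs => hFD.eq_add_setIntegral w hs).2

end IsRegularGen

end Orthant

/-! ### Stein's identity for tail expectations -/

section Stein

variable {ι : Type*} [Fintype ι]

theorem tailExp_const_mul (f : (ι → ℝ) → ℝ) (t : ι → ℝ) (c : ℝ) (h : (ι → ℝ) → ℝ) :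
    tailExp f t (fun x => c * h x) = c * tailExp f t h := by
  simp only [tailExp, mul_assoc, integral_const_mul]

theorem tailExp_add {f : (ι → ℝ) → ℝ} {t : ι → ℝ} {h₁ h₂ : (ι → ℝ) → ℝ}
    (hh₁ : HasTailExp f t h₁) (hh₂ : HasTailExp f t h₂) :
    tailExp f t (fun x => h₁ x + h₂ x) = tailExp f t h₁ + tailExp f t h₂ := by
  simp only [tailExp, add_mul]
  exact integral_add hh₁ hh₂

theorem HasTailExp.add {f : (ι → ℝ) → ℝ} {t : ι → ℝ} {h₁ h₂ : (ι → ℝ) → ℝ}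
    (hh₁ : HasTailExp f t h₁) (hh₂ : HasTailExp f t h₂) :
    HasTailExp f t fun x => h₁ x + h₂ x := by
  simp only [HasTailExp, add_mul]
  exact Integrable.add hh₁ hh₂

theorem HasTailExp.const_mul {f : (ι → ℝ) → ℝ} {t : ι → ℝ} {h : (ι → ℝ) → ℝ}
    (hh : HasTailExp f t h) (c : ℝ) : HasTailExp f t fun x => c * h x := by
  simp only [HasTailExp, mul_assoc]
  exact Integrable.const_mul hh c

theorem tailExp_sphDensity_comp_equiv {κ : Type*} [Fintype κ] (e : ι ≃ κ) (g : ℝ → ℝ)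
    (t : κ → ℝ) (h : (κ → ℝ) → ℝ) :
    tailExp (sphDensity g) t h =
      tailExp (sphDensity g) (t ∘ e) fun x => h (x ∘ e.symm) := by
  have h_mp := volume_preserving_arrowCongr' e (MeasurableEquiv.refl ℝ) (MeasurePreserving.id _)
  have h_tail : MeasurableEquiv.arrowCongr' e (MeasurableEquiv.refl ℝ) ⁻¹' tailSet t =
      tailSet (t ∘ e) := by
    ext x
    exact e.forall_congr_right.symm.trans (forall_congr' fun l => by
      simp [MeasurableEquiv.arrowCongr', Equiv.arrowCongr'])
  rw [tailExp, tailExp, ← h_mp.setIntegral_preimage_emb (MeasurableEquiv.measurableEmbedding _),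
    h_tail]
  refine integral_congr_ae (Eventually.of_forall fun x => congrArg (h (x ∘ e.symm) * ·) ?_)
  simp only [sphDensity, Fintype.card_congr e]
  exact congrArg (fun r => normConst (Fintype.card κ) g * g ((1 / 2) * r))
    (e.symm.sum_comp fun l => x l * x l)

variable [DecidableEq ι] {g : ℝ → ℝ} {k : ι} {F D : (ι → ℝ) → ℝ} {lam : ι → ℝ}

theorem abs_insertCoord_le (k j : ι) (s : ℝ) (w : {l : ι // l ≠ k} → ℝ) :
    |insertCoord k s w j| ≤ (1 + |s|) * (1 + √(w ⬝ᵥ w)) := by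
  have h_sqrt := Real.sqrt_nonneg (w ⬝ᵥ w)
  have h_abs := abs_nonneg s
  by_cases hj : j = k
  · rw [hj, insertCoord_self]
    nlinarith
  · rw [insertCoord_of_ne hj]
    nlinarith [abs_le_sqrt_dotProduct_self w ⟨j, hj⟩]

namespace IsRegularGen

theorem hasTailExp_coord_mul (hg : IsRegularGen g) (hFD : HasIntegralPartial k F D)
    (hF : Measurable F) (hD : Measurable D)
    (h_face : HasTailExp (sphDensity fun u => cumGen g (u + (1 / 2) * lam k ^ 2))
      (removeCoord lam k) fun w => F (insertCoord k (lam k) w))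
    (h_bulk : HasTailExp (sphDensity (cumGen g)) lam D) :
    HasTailExp (sphDensity g) lam fun x => x k * F x :=
  (hg.hasTailExp_sphDensity_iff _ _).2 <| hg.integrableOn_tailSet_coord_mul hFD hF hD
    (((hg.cumGen.comp_add_right (by positivity)).hasTailExp_sphDensity_iff _ _).1 h_face)
    ((hg.cumGen.hasTailExp_sphDensity_iff _ _).1 h_bulk)

theorem div_normConst_mul_tailExp_coord_mul (hg : IsRegularGen g)
    (hFD : HasIntegralPartial k F D) (hF : Measurable F) (hD : Measurable D)
    (h_face : HasTailExp (sphDensity fun u => cumGen g (u + (1 / 2) * lam k ^ 2))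
      (removeCoord lam k) fun w => F (insertCoord k (lam k) w))
    (h_bulk : HasTailExp (sphDensity (cumGen g)) lam D) (c : ℝ) :
    c / normConst (Fintype.card ι) g * tailExp (sphDensity g) lam (fun x => x k * F x) =
      c / normConst (Fintype.card {l // l ≠ k}) (fun u => cumGen g (u + (1 / 2) * lam k ^ 2)) *
          tailExp (sphDensity fun u => cumGen g (u + (1 / 2) * lam k ^ 2)) (removeCoord lam k)
            (fun w => F (insertCoord k (lam k) w)) +
        c / normConst (Fintype.card ι) (cumGen g) * tailExp (sphDensity (cumGen g)) lam D := by
  have hg_shift := hg.cumGen.comp_add_right (a := (1 / 2) * lam k ^ 2) (by positivity)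
  rw [hg.div_normConst_mul_tailExp, hg_shift.div_normConst_mul_tailExp,
    hg.cumGen.div_normConst_mul_tailExp, ← mul_add]
  exact congrArg (c * ·) (hg.setIntegral_tailSet_coord_mul hFD hF hD
    ((hg_shift.hasTailExp_sphDensity_iff _ _).1 h_face)
    ((hg.cumGen.hasTailExp_sphDensity_iff _ _).1 h_bulk))

end IsRegularGen

end Stein

/-! ### Tail moments in terms of the reduced densities -/

section TailMoments

variable {n : ℕ}

theorem tailExp_densU_eq_sphDensity (g : ℝ → ℝ) (lam : Fin n → ℝ) {i j : Fin n} (hji : j ≠ i)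
    (h : (Fin n → ℝ) → ℝ) :
    tailExp (densU g lam i j) (drop₂ lam i j) (fun u => h (put₂ lam i j u)) =
      tailExp (sphDensity (genU g lam i j)) (removeCoord (drop lam i) ⟨j, hji⟩)
        fun u => h (put lam i (insertCoord ⟨j, hji⟩ (lam j) u)) := by
  let e : {l : {l : Fin n // l ≠ i} // l ≠ ⟨j, hji⟩} ≃ {l : Fin n // l ≠ i ∧ l ≠ j} :=
    { toFun := fun l => ⟨l.1.1, l.1.2, fun h => l.2 (Subtype.ext h)⟩
      invFun := fun l => ⟨⟨l.1, l.2.1⟩, fun h => l.2.2 (congrArg Subtype.val h)⟩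
      left_inv := fun _ => rfl
      right_inv := fun _ => rfl }
  rw [densU_eq_sphDensity g lam hji.symm, tailExp_sphDensity_comp_equiv e]
  refine congrArg (tailExp _ _) (funext fun u => congrArg h (funext fun l => ?_))
  by_cases hi : l = i
  · simp [put, put₂, hi]
  · by_cases hj : l = j
    · subst hj
      simp [put, put₂, hi]
    · simp [put, put₂, insertCoord, hi, hj, e]

theorem card_ne_ne {i j : Fin n} (hji : j ≠ i) :
    Fintype.card {l : {l : Fin n // l ≠ i} // l ≠ ⟨j, hji⟩} = n - 2 := by
  rw [Fintype.card_subtype_compl, card_ne, Fintype.card_subtype_eq, Nat.sub_sub]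

theorem put_eq_insertCoord (lam : Fin n → ℝ) (k : Fin n) : put lam k = insertCoord k (lam k) := by
  ext w l
  by_cases h : l = k <;> simp [put, insertCoord, h]

theorem continuous_put (lam : Fin n → ℝ) (k : Fin n) : Continuous (put lam k) := by
  rw [put_eq_insertCoord]
  exact (continuous_insertCoord k).comp (Continuous.prodMk_left (lam k))

theorem continuous_of_absolutelyContinuousOnInterval {φ : ℝ → ℝ}
    (hφ : ∀ a b, AbsolutelyContinuousOnInterval φ a b) : Continuous φ :=
  continuous_iff_continuousAt.2 fun x => (hφ (x - 1) (x + 1)).continuousOn.continuousAt (by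
    rw [uIcc_of_le (by linarith)]
    exact Icc_mem_nhds (by linarith) (by linarith))

theorem cumGen_genW (g : ℝ → ℝ) (lam : Fin n → ℝ) (k : Fin n) :
    cumGen (genW g lam k) = genV g lam k :=
  funext fun _ => cumGen_comp_add_right _ _ _

theorem HasIntegralPartial.comp_dotProduct_put {H : ℝ → ℝ} (hH : ContDiff ℝ 1 H)
    (γ lam : Fin n → ℝ) {i j : Fin n} (hji : j ≠ i) :
    HasIntegralPartial (⟨j, hji⟩ : {l // l ≠ i}) (fun w => H (γ ⬝ᵥ put lam i w))
      fun w => γ j * deriv H (γ ⬝ᵥ put lam i w) := by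
  have hH_shift : ContDiff ℝ 1 fun s => H (s + γ i * lam i) := hH.comp (by fun_prop)
  have h_partial := HasIntegralPartial.comp_dotProduct
    (fun a b => hH_shift.contDiffOn.absolutelyContinuousOnInterval) (removeCoord γ i) ⟨j, hji⟩
  simpa only [put_eq_insertCoord, dotProduct_insertCoord, deriv_comp_add_const, removeCoord]
    using h_partial

namespace IsRegularGen

variable {g : ℝ → ℝ} {lam γ : Fin n → ℝ} {H : ℝ → ℝ} {C : ℝ}

theorem hasTailExp_comp_dotProduct (hg : IsRegularGen g) {ι : Type*} [Fintype ι] (t γ : ι → ℝ)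
    (hH : Measurable H) (hHC : ∀ x, |H x| ≤ C) :
    HasTailExp (sphDensity g) t fun x => H (γ ⬝ᵥ x) :=
  hg.hasTailExp_of_abs_le t (k := 0) (hH.comp (by fun_prop))
    fun x => by simpa only [pow_zero, mul_one] using hHC _

theorem hasTailExp_comp_dotProduct_put (hg : IsRegularGen g) (lam γ : Fin n → ℝ) (k : Fin n)
    (t : {l // l ≠ k} → ℝ) (hH : Measurable H) (hHC : ∀ x, |H x| ≤ C) :
    HasTailExp (sphDensity g) t fun w => H (γ ⬝ᵥ put lam k w) := by
  simp only [put_eq_insertCoord, dotProduct_insertCoord]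
  exact hg.hasTailExp_comp_dotProduct (H := fun s => H (s + γ k * lam k)) _ _ (by fun_prop)
    fun x => hHC _

theorem div_normConst_mul_tailExp_coord_mul_densW (hg : IsRegularGen g) {k : Fin n}
    {F D : (Fin n → ℝ) → ℝ} (hFD : HasIntegralPartial k F D) (hF : Measurable F)
    (hD : Measurable D) (h_face : HasTailExp (densW g lam k) (drop lam k) fun w => F (put lam k w))
    (h_bulk : HasTailExp (sphDensity (cumGen g)) lam D) (c : ℝ) :
    c / normConst n g * tailExp (sphDensity g) lam (fun x => x k * F x) =
      c / constW g lam k * tailExp (densW g lam k) (drop lam k) (fun w => F (put lam k w)) +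
        c / normConst n (cumGen g) * tailExp (sphDensity (cumGen g)) lam D := by
  rw [densW_eq_sphDensity, put_eq_insertCoord] at h_face
  have h_stein := hg.div_normConst_mul_tailExp_coord_mul hFD hF hD h_face h_bulk c
  rw [Fintype.card_fin, card_ne] at h_stein
  rwa [densW_eq_sphDensity, put_eq_insertCoord]

theorem tailExp_coord_mul_comp_dotProduct (hg : IsRegularGen g)
    (hH : ∀ a b, AbsolutelyContinuousOnInterval H a b) (hHC : ∀ x, |H x| ≤ C) (k : Fin n)
    (h_bulk : HasTailExp (sphDensity (cumGen g)) lam fun x => deriv H (γ ⬝ᵥ x)) :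
    tailExp (sphDensity g) lam (fun x => x k * H (γ ⬝ᵥ x)) =
      normConst n g / constW g lam k *
          tailExp (densW g lam k) (drop lam k) (fun w => H (γ ⬝ᵥ put lam k w)) +
        γ k * (normConst n g / normConst n (cumGen g) *
          tailExp (sphDensity (cumGen g)) lam fun x => deriv H (γ ⬝ᵥ x)) := by
  have hH_cont := continuous_of_absolutelyContinuousOnInterval hH
  have h_stein := hg.div_normConst_mul_tailExp_coord_mul_densW
    (.comp_dotProduct hH γ k) (hH_cont.measurable.comp (by fun_prop))
    (((measurable_deriv H).comp (by fun_prop)).const_mul _)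
    (by
      rw [densW_eq_sphDensity]
      exact (hg.genW lam k).hasTailExp_comp_dotProduct_put lam γ k _ hH_cont.measurable hHC)
    (h_bulk.const_mul (γ k)) (normConst n g)
  rwa [div_self (hg.normConst_pos n).ne', one_mul, tailExp_const_mul, mul_left_comm] at h_stein

theorem hasTailExp_coord_mul_deriv (hg : IsRegularGen g)
    (hH' : ∀ a b, AbsolutelyContinuousOnInterval (deriv H) a b) {j : Fin n}
    (h_face : HasTailExp (densV g lam j) (drop lam j) fun v => deriv H (γ ⬝ᵥ put lam j v))
    (h_bulk : HasTailExp (sphDensity (cumGen (cumGen g))) lam fun x => deriv (deriv H) (γ ⬝ᵥ x)) :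
    HasTailExp (sphDensity (cumGen g)) lam fun x => x j * deriv H (γ ⬝ᵥ x) := by
  rw [densV_eq_sphDensity, put_eq_insertCoord] at h_face
  exact hg.cumGen.hasTailExp_coord_mul (.comp_dotProduct hH' γ j)
    ((measurable_deriv H).comp (by fun_prop))
    (((measurable_deriv _).comp (by fun_prop)).const_mul _) h_face (h_bulk.const_mul (γ j))

theorem div_normConst_mul_tailExp_coord_mul_deriv (hg : IsRegularGen g)
    (hH' : ∀ a b, AbsolutelyContinuousOnInterval (deriv H) a b) {j : Fin n}
    (h_face : HasTailExp (densV g lam j) (drop lam j) fun v => deriv H (γ ⬝ᵥ put lam j v))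
    (h_bulk : HasTailExp (sphDensity (cumGen (cumGen g))) lam fun x => deriv (deriv H) (γ ⬝ᵥ x))
    (c : ℝ) :
    c / normConst n (cumGen g) *
        tailExp (sphDensity (cumGen g)) lam (fun x => x j * deriv H (γ ⬝ᵥ x)) =
      c / constV g lam j *
          tailExp (densV g lam j) (drop lam j) (fun v => deriv H (γ ⬝ᵥ put lam j v)) +
        γ j * (c / normConst n (cumGen (cumGen g)) *
          tailExp (sphDensity (cumGen (cumGen g))) lam fun x => deriv (deriv H) (γ ⬝ᵥ x)) := by
  have h_stein := hg.cumGen.div_normConst_mul_tailExp_coord_mul_densW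
    (.comp_dotProduct hH' γ j) ((measurable_deriv H).comp (by fun_prop))
    (((measurable_deriv _).comp (by fun_prop)).const_mul _) h_face (h_bulk.const_mul (γ j)) c
  rwa [tailExp_const_mul, mul_left_comm] at h_stein

theorem tailExp_coord_mul_coord_mul_comp_dotProduct (hg : IsRegularGen g) (hH : ContDiff ℝ 1 H)
    (hHC : ∀ x, |H x| ≤ C) (k j : Fin n)
    (h_bulk : HasTailExp (sphDensity (cumGen g)) lam fun x => x j * deriv H (γ ⬝ᵥ x)) :
    tailExp (sphDensity g) lam (fun x => x k * (x j * H (γ ⬝ᵥ x))) =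
      normConst n g / constW g lam k * tailExp (densW g lam k) (drop lam k)
          (fun w => put lam k w j * H (γ ⬝ᵥ put lam k w)) +
        normConst n g / normConst n (cumGen g) *
          ((if j = k then 1 else 0) *
              tailExp (sphDensity (cumGen g)) lam (fun x => H (γ ⬝ᵥ x)) +
            γ k * tailExp (sphDensity (cumGen g)) lam fun x => x j * deriv H (γ ⬝ᵥ x)) := by
  have hH_cont := hH.continuous
  have := hH.continuous_deriv_one
  have h_face : HasTailExp (densW g lam k) (drop lam k)
      fun w => put lam k w j * H (γ ⬝ᵥ put lam k w) := by
    rw [densW_eq_sphDensity, put_eq_insertCoord]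
    have := put_eq_insertCoord lam k ▸ continuous_put lam k
    refine (hg.genW lam k).hasTailExp_of_abs_le _ (C := (1 + |lam k|) * C) (k := 1)
      (Continuous.measurable (by fun_prop)) fun w => ?_
    rw [abs_mul, pow_one, mul_right_comm]
    exact mul_le_mul (abs_insertCoord_le k j _ w) (hHC _) (abs_nonneg _) (by positivity)
  have h_const := (hg.cumGen.hasTailExp_comp_dotProduct lam γ hH_cont.measurable hHC).const_mul
    (if j = k then 1 else 0)
  have h_stein := hg.div_normConst_mul_tailExp_coord_mul_densW
    (.coord_mul_comp_dotProduct hH γ k j) (Continuous.measurable (by fun_prop))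
    (Continuous.measurable (by fun_prop)) h_face (h_const.add (h_bulk.const_mul (γ k)))
    (normConst n g)
  rwa [div_self (hg.normConst_pos n).ne', one_mul,
    tailExp_add h_const (h_bulk.const_mul (γ k)), tailExp_const_mul, tailExp_const_mul] at h_stein

theorem div_constW_mul_tailExp_coord_mul_comp_dotProduct (hg : IsRegularGen g)
    (hH : ContDiff ℝ 1 H) (hHC : ∀ x, |H x| ≤ C) {i j : Fin n} (hji : j ≠ i)
    (h_bulk : HasTailExp (densV g lam i) (drop lam i) fun v => deriv H (γ ⬝ᵥ put lam i v))
    (c : ℝ) :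
    c / constW g lam i * tailExp (densW g lam i) (drop lam i)
        (fun w => put lam i w j * H (γ ⬝ᵥ put lam i w)) =
      c / constU g lam i j * tailExp (densU g lam i j) (drop₂ lam i j)
          (fun u => H (γ ⬝ᵥ put₂ lam i j u)) +
        γ j * (c / constV g lam i *
          tailExp (densV g lam i) (drop lam i) fun v => deriv H (γ ⬝ᵥ put lam i v)) := by
  have h_gen : (fun u => cumGen (genW g lam i) (u + (1 / 2) * drop lam i ⟨j, hji⟩ ^ 2)) =
      genU g lam i j := by
    simp only [cumGen_genW]
    exact funext fun u => congrArg (cumGen (cumGen g)) (add_right_comm _ _ _)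
  have h_face : HasTailExp (sphDensity (genU g lam i j)) (removeCoord (drop lam i) ⟨j, hji⟩)
      fun u => H (γ ⬝ᵥ put lam i (insertCoord ⟨j, hji⟩ (lam j) u)) := by
    simp only [put_eq_insertCoord, dotProduct_insertCoord, add_assoc]
    exact (hg.genU lam i j).hasTailExp_comp_dotProduct (H := fun s => H (s + _)) _ _
      (hH.continuous.measurable.comp (by fun_prop)) fun x => hHC _
  have h_put := continuous_put lam i
  have hH_cont := hH.continuous
  have hH'_cont := hH.continuous_deriv_one
  rw [densV_eq_sphDensity, ← cumGen_genW] at h_bulk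
  have h_stein := (hg.genW lam i).div_normConst_mul_tailExp_coord_mul
    (.comp_dotProduct_put hH γ lam hji) (Continuous.measurable (by fun_prop))
    (Continuous.measurable (by fun_prop)) (by rwa [h_gen]) (h_bulk.const_mul (γ j)) c
  rw [h_gen, cumGen_genW, card_ne, card_ne_ne, tailExp_const_mul, mul_left_comm] at h_stein
  rw [tailExp_densU_eq_sphDensity g lam hji fun x => H (γ ⬝ᵥ x), densW_eq_sphDensity,
    densV_eq_sphDensity]
  simp only [put, dif_pos hji]
  exact h_stein

theorem tailExp_coord_mul_coord_mul_comp_dotProduct_of_ne (hg : IsRegularGen g)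
    (hH : ContDiff ℝ 1 H) (hHC : ∀ x, |H x| ≤ C)
    (hH' : ∀ a b, AbsolutelyContinuousOnInterval (deriv H) a b)
    (h_face : ∀ k, HasTailExp (densV g lam k) (drop lam k) fun v => deriv H (γ ⬝ᵥ put lam k v))
    (h_bulk : HasTailExp (sphDensity (cumGen (cumGen g))) lam fun x => deriv (deriv H) (γ ⬝ᵥ x))
    {i j : Fin n} (hij : i ≠ j) :
    tailExp (sphDensity g) lam (fun x => x i * (x j * H (γ ⬝ᵥ x))) =
      normConst n g / constU g lam i j *
          tailExp (densU g lam i j) (drop₂ lam i j) (fun u => H (γ ⬝ᵥ put₂ lam i j u)) +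
        normConst n g / constV g lam i * γ j *
          tailExp (densV g lam i) (drop lam i) (fun v => deriv H (γ ⬝ᵥ put lam i v)) +
        normConst n g / constV g lam j * γ i *
          tailExp (densV g lam j) (drop lam j) (fun v => deriv H (γ ⬝ᵥ put lam j v)) +
        normConst n g / normConst n (cumGen (cumGen g)) * γ i * γ j *
          tailExp (sphDensity (cumGen (cumGen g))) lam (fun x => deriv (deriv H) (γ ⬝ᵥ x)) := by
  have h_mean := hg.hasTailExp_coord_mul_deriv hH' (h_face j) h_bulk
  rw [hg.tailExp_coord_mul_coord_mul_comp_dotProduct hH hHC i j h_mean,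
    hg.div_constW_mul_tailExp_coord_mul_comp_dotProduct hH hHC hij.symm (h_face i),
    if_neg hij.symm, zero_mul, zero_add, mul_left_comm _ (γ i),
    hg.div_normConst_mul_tailExp_coord_mul_deriv hH' (h_face j) h_bulk]
  ring

theorem tailExp_coord_mul_coord_mul_comp_dotProduct_self (hg : IsRegularGen g)
    (hH : ContDiff ℝ 1 H) (hHC : ∀ x, |H x| ≤ C)
    (hH' : ∀ a b, AbsolutelyContinuousOnInterval (deriv H) a b) {i : Fin n}
    (h_face : HasTailExp (densV g lam i) (drop lam i) fun v => deriv H (γ ⬝ᵥ put lam i v))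
    (h_bulk : HasTailExp (sphDensity (cumGen (cumGen g))) lam fun x => deriv (deriv H) (γ ⬝ᵥ x)) :
    tailExp (sphDensity g) lam (fun x => x i * (x i * H (γ ⬝ᵥ x))) =
      normConst n g / constW g lam i * lam i *
          tailExp (densW g lam i) (drop lam i) (fun w => H (γ ⬝ᵥ put lam i w)) +
        normConst n g / constV g lam i * γ i *
          tailExp (densV g lam i) (drop lam i) (fun v => deriv H (γ ⬝ᵥ put lam i v)) +
        normConst n g / normConst n (cumGen (cumGen g)) * γ i ^ 2 *
          tailExp (sphDensity (cumGen (cumGen g))) lam (fun x => deriv (deriv H) (γ ⬝ᵥ x)) +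
        normConst n g / normConst n (cumGen g) *
          tailExp (sphDensity (cumGen g)) lam (fun x => H (γ ⬝ᵥ x)) := by
  have h_mean := hg.hasTailExp_coord_mul_deriv hH' h_face h_bulk
  have h_put (w : {l : Fin n // l ≠ i} → ℝ) : put lam i w i = lam i := by simp [put]
  rw [hg.tailExp_coord_mul_coord_mul_comp_dotProduct hH hHC i i h_mean, if_pos rfl, one_mul,
    mul_add, mul_left_comm _ (γ i),
    hg.div_normConst_mul_tailExp_coord_mul_deriv hH' h_face h_bulk]
  simp only [h_put, tailExp_const_mul]
  ring

end IsRegularGen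

end TailMoments

/-! ### Conditional covariance -/

section CondCov

variable {ι Ω : Type*} [MeasurableSpace Ω] {P : Measure Ω} {A : Set Ω}

theorem condCov_apply_eq_covariance (A : Set Ω) (X : Ω → ι → ℝ) (i j : ι) :
    condCov P A X i j = covariance (fun ω => X ω i) (fun ω => X ω j) P[|A] := rfl

theorem condCov_of_measure_eq_zero (hA : P A = 0) (X : Ω → ι → ℝ) :
    condCov P A X = 0 := by
  ext i j
  rw [condCov_apply_eq_covariance, cond_eq_zero_of_meas_eq_zero hA, covariance_zero_measure,
    Matrix.zero_apply]

theorem memLp_cond {X : Ω → ℝ} (hX : MemLp X 2 P) (hA : P A ≠ 0) :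
    MemLp X 2 P[|A] :=
  (hX.restrict A).smul_measure (ENNReal.inv_ne_top.2 hA)

theorem condCov_mulVec_add [Fintype ι] [IsFiniteMeasure P] {X : Ω → ι → ℝ}
    (h_mem : ∀ k, MemLp (fun ω => X ω k) 2 P) (hA : P A ≠ 0) (S : Matrix ι ι ℝ)
    (b : ι → ℝ) :
    condCov P A (fun ω => S *ᵥ X ω + b) = S * condCov P A X * Sᵀ := by
  ext i j
  have := cond_isProbabilityMeasure hA
  have h_mem_mul : ∀ i k, MemLp (fun ω => S i k * X ω k) 2 P[|A] :=
    fun i k => (memLp_cond (h_mem k) hA).const_mul _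
  have h_int : ∀ i, Integrable (fun ω => ∑ k, S i k * X ω k) P[|A] :=
    fun i => integrable_finsetSum _ fun k _ => (h_mem_mul i k).integrable one_le_two
  rw [condCov_apply_eq_covariance]
  simp only [Pi.add_apply, mulVec, dotProduct]
  rw [covariance_add_const_left (h_int i), covariance_add_const_right (h_int j),
    covariance_fun_sum_fun_sum (h_mem_mul i) (h_mem_mul j), Finset.sum_comm]
  simp only [covariance_const_mul_left, covariance_const_mul_right, mul_apply, transpose_apply,
    condCov_apply_eq_covariance, Finset.sum_mul]
  exact Finset.sum_congr rfl fun k _ => Finset.sum_congr rfl fun l _ => by ring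

end CondCov

/-! ### Standardization -/

section Standardize

variable {ι : Type*} [Fintype ι]

theorem measurable_mulVec (M : Matrix ι ι ℝ) : Measurable fun z : ι → ℝ => M *ᵥ z :=
  (Continuous.matrix_mulVec continuous_const continuous_id).measurable

variable [DecidableEq ι]

theorem volume_eq_smul_map_mulVec_add {M : Matrix ι ι ℝ} (hM : M.det ≠ 0) (b : ι → ℝ) :
    (volume : Measure (ι → ℝ)) = ENNReal.ofReal |M.det| • volume.map fun z => M *ᵥ z + b := by
  have h_map : (volume.map (toLin' M)).map (· + b) = volume.map fun z => M *ᵥ z + b :=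
    Measure.map_map (by fun_prop) (toLin' M).continuous_of_finiteDimensional.measurable
  rw [← h_map, Real.map_matrix_volume_pi_eq_smul_volume_pi hM, Measure.map_smul,
    map_add_right_eq_self, smul_smul, ← ENNReal.ofReal_mul (abs_nonneg _), ← abs_mul,
    mul_inv_cancel₀ hM, abs_one, ENNReal.ofReal_one, one_smul]

theorem map_lawOf_inv_mulVec_sub {M : Matrix ι ι ℝ} (hM : M.det ≠ 0) (b : ι → ℝ)
    {f : (ι → ℝ) → ℝ} (hf : Measurable f) :
    (lawOf f).map (fun y => M⁻¹ *ᵥ (y - b)) = lawOf fun z => |M.det| * f (M *ᵥ z + b) := by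
  have h_inv : Measurable fun y : ι → ℝ => M⁻¹ *ᵥ (y - b) :=
    (measurable_mulVec _).comp (measurable_id.sub_const b)
  have h_aff : Measurable fun z : ι → ℝ => M *ᵥ z + b := (measurable_mulVec M).add_const b
  ext s hs
  have h_preimage : (fun z => M *ᵥ z + b) ⁻¹' ((fun y => M⁻¹ *ᵥ (y - b)) ⁻¹' s) = s := by
    ext z
    simp [mulVec_mulVec, nonsing_inv_mul _ hM.isUnit]
  rw [Measure.map_apply h_inv hs, lawOf, lawOf, withDensity_apply _ (h_inv hs),
    withDensity_apply _ hs, volume_eq_smul_map_mulVec_add hM b, Measure.restrict_smul,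
    lintegral_smul_measure, setLIntegral_map (h_inv hs) (by fun_prop) h_aff,
    ← volume_eq_smul_map_mulVec_add hM b, h_preimage, smul_eq_mul,
    ← lintegral_const_mul _ (by fun_prop)]
  simp only [ENNReal.ofReal_mul (abs_nonneg _)]

variable {Sg : Matrix ι ι ℝ}

theorem det_sqrt (hSg : Sg.PosDef) : (CFC.sqrt Sg).det = √Sg.det := by
  rw [hSg.posSemidef.det_sqrt, RCLike.sqrt_of_nonneg hSg.det_pos.le]
  rfl

theorem det_sqrt_pos (hSg : Sg.PosDef) : 0 < (CFC.sqrt Sg).det := by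
  rw [det_sqrt hSg]
  exact sqrt_pos.2 hSg.det_pos

theorem sqrt_diagonal {d : ι → ℝ} (hd : ∀ i, 0 ≤ d i) :
    CFC.sqrt (diagonal d) = diagonal fun i => √(d i) := by
  refine CFC.sqrt_unique ?_ (PosSemidef.diagonal fun i => sqrt_nonneg _).nonneg
  simp only [diagonal_mul_diagonal, mul_self_sqrt (hd _)]

theorem sqrt_mulVec_standardize (hSg : Sg.PosDef) (μ y : ι → ℝ) :
    CFC.sqrt Sg *ᵥ standardize μ Sg y + μ = y := by
  rw [standardize, mulVec_mulVec, mul_nonsing_inv _ (det_sqrt_pos hSg).ne'.isUnit, one_mulVec,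
    sub_add_cancel]

theorem standardize_sqrt_mulVec (hSg : Sg.PosDef) (μ z : ι → ℝ) :
    standardize μ Sg (CFC.sqrt Sg *ᵥ z + μ) = z := by
  rw [standardize, add_sub_cancel_right, mulVec_mulVec,
    nonsing_inv_mul _ (det_sqrt_pos hSg).ne'.isUnit, one_mulVec]

theorem measurable_standardize (μ : ι → ℝ) (Sg : Matrix ι ι ℝ) : Measurable (standardize μ Sg) :=
  (measurable_mulVec _).comp (measurable_id.sub_const μ)

theorem measurable_ellDensity {g : ℝ → ℝ} (hg : Measurable g) (μ : ι → ℝ) (Sg : Matrix ι ι ℝ) :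
    Measurable (ellDensity μ Sg g) := by
  have h_inv : Continuous fun x : ι → ℝ => Sg⁻¹ *ᵥ (x - μ) :=
    Continuous.matrix_mulVec continuous_const (continuous_id.sub continuous_const)
  have h_form : Continuous fun x : ι → ℝ => (x - μ) ⬝ᵥ (Sg⁻¹ *ᵥ (x - μ)) :=
    (continuous_id.sub continuous_const).dotProduct h_inv
  exact (hg.comp (h_form.measurable.const_mul _)).const_mul _

theorem measurable_gseDensity {g : ℝ → ℝ} (hg : Measurable g) {H : (ι → ℝ) → ℝ}
    (hH : Measurable H) (μ : ι → ℝ) (Sg : Matrix ι ι ℝ) : Measurable (gseDensity μ Sg g H) :=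
  ((measurable_ellDensity hg μ Sg).const_mul 2).mul (hH.comp (measurable_standardize μ Sg))

theorem ellDensity_zero_one (g : ℝ → ℝ) : ellDensity (0 : ι → ℝ) 1 g = sphDensity g := by
  ext x
  simp [ellDensity, sphDensity]

theorem gseDensity_zero_one (g : ℝ → ℝ) (H : (ι → ℝ) → ℝ) (x : ι → ℝ) :
    gseDensity 0 1 g H x = 2 * sphDensity g x * H x := by
  have h_sqrt : CFC.sqrt (1 : Matrix ι ι ℝ) = 1 := CFC.sqrt_one
  rw [gseDensity, ellDensity_zero_one, standardize, h_sqrt, inv_one, one_mulVec, sub_zero]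

theorem sqrt_mulVec_dotProduct_inv_mulVec (hSg : Sg.PosDef) (z : ι → ℝ) :
    (CFC.sqrt Sg *ᵥ z) ⬝ᵥ (Sg⁻¹ *ᵥ (CFC.sqrt Sg *ᵥ z)) = z ⬝ᵥ z := by
  have h_symm : (CFC.sqrt Sg).IsSymm :=
    isHermitian_iff_isSymm.1 (CFC.sqrt_nonneg Sg).posSemidef.isHermitian
  have h_unit := (det_sqrt_pos hSg).ne'.isUnit
  have h_inv : Sg⁻¹ = (CFC.sqrt Sg)⁻¹ * (CFC.sqrt Sg)⁻¹ := by
    rw [← Matrix.mul_inv_rev, CFC.sqrt_mul_sqrt_self Sg hSg.posSemidef.nonneg]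
  rw [h_inv, mulVec_mulVec, mul_assoc, nonsing_inv_mul _ h_unit, mul_one, dotProduct_mulVec,
    vecMul_mulVec, h_symm.eq, mul_nonsing_inv _ h_unit, vecMul_one]

theorem det_sqrt_mul_gseDensity (hSg : Sg.PosDef) (μ : ι → ℝ) (g : ℝ → ℝ) (H : (ι → ℝ) → ℝ)
    (z : ι → ℝ) :
    (CFC.sqrt Sg).det * gseDensity μ Sg g H (CFC.sqrt Sg *ᵥ z + μ) = gseDensity 0 1 g H z := by
  have h_pos := det_sqrt_pos hSg
  rw [gseDensity_zero_one, gseDensity, standardize_sqrt_mulVec hSg, ellDensity,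
    add_sub_cancel_right, sqrt_mulVec_dotProduct_inv_mulVec hSg, ← det_sqrt hSg, sphDensity]
  field_simp

theorem exceed_standardize_of_isDiag {Ω : Type*} (hSg : Sg.PosDef) (hd : Sg.IsDiag)
    (μ t : ι → ℝ) (Y : Ω → ι → ℝ) :
    exceed (fun ω => standardize μ Sg (Y ω)) (standardize μ Sg t) = exceed Y t := by
  have h_sqrt : CFC.sqrt Sg = diagonal fun i => √(Sg i i) := by
    conv_lhs => rw [← hd.diagonal_diag]
    exact sqrt_diagonal fun _ => hSg.diag_pos.le
  have h_coord : ∀ y i, y i = √(Sg i i) * standardize μ Sg y i + μ i := fun y i => by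
    conv_lhs => rw [← sqrt_mulVec_standardize hSg μ y, h_sqrt, Pi.add_apply, mulVec_diagonal]
  ext ω
  refine forall_congr' fun i => ?_
  rw [h_coord t, h_coord (Y ω), add_lt_add_iff_right,
    mul_lt_mul_iff_right₀ (sqrt_pos.2 hSg.diag_pos)]

variable {Ω : Type*} [MeasurableSpace Ω] {P : Measure Ω} {Y : Ω → ι → ℝ} {μ : ι → ℝ}

theorem hasLaw_standardize (hSg : Sg.PosDef) {g : ℝ → ℝ} (hg : Measurable g)
    {H : (ι → ℝ) → ℝ} (hH : Measurable H) (hY : HasLaw Y (lawOf (gseDensity μ Sg g H)) P) :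
    HasLaw (fun ω => standardize μ Sg (Y ω)) (lawOf (gseDensity 0 1 g H)) P := by
  refine HasLaw.fun_comp ⟨(measurable_standardize μ Sg).aemeasurable, ?_⟩ hY
  refine (map_lawOf_inv_mulVec_sub (det_sqrt_pos hSg).ne' μ
    (measurable_gseDensity hg hH μ Sg)).trans ?_
  simp only [abs_of_pos (det_sqrt_pos hSg), det_sqrt_mul_gseDensity hSg]

theorem memLp_of_memLp_standardize [IsFiniteMeasure P] (hSg : Sg.PosDef)
    (h_mem : ∀ k, MemLp (fun ω => standardize μ Sg (Y ω) k) 2 P) (k : ι) :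
    MemLp (fun ω => Y ω k) 2 P := by
  have h_affine : (fun ω => Y ω k) =
      fun ω => ∑ l, CFC.sqrt Sg k l * standardize μ Sg (Y ω) l + μ k :=
    funext fun ω => (congrFun (sqrt_mulVec_standardize hSg μ (Y ω)) k).symm
  rw [h_affine]
  exact (memLp_finsetSum _ fun l _ => (h_mem l).const_mul _).add (memLp_const _)

theorem condCov_eq_sqrt_mul_condCov_standardize_mul_sqrt [IsFiniteMeasure P] (hSg : Sg.PosDef)
    (h_mem : ∀ k, MemLp (fun ω => standardize μ Sg (Y ω) k) 2 P) (A : Set Ω) :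
    condCov P A Y =
      CFC.sqrt Sg * condCov P A (fun ω => standardize μ Sg (Y ω)) * CFC.sqrt Sg := by
  by_cases hA : P A = 0
  · simp only [condCov_of_measure_eq_zero hA, mul_zero, zero_mul]
  · have h_symm : (CFC.sqrt Sg).IsSymm :=
      isHermitian_iff_isSymm.1 (CFC.sqrt_nonneg Sg).posSemidef.isHermitian
    have h_affine := condCov_mulVec_add h_mem hA (CFC.sqrt Sg) μ
    simpa only [sqrt_mulVec_standardize hSg, h_symm.eq] using h_affine

theorem MTCov_eq_sqrt_mul_MTCov_standardize_mul_sqrt [IsFiniteMeasure P] (hSg : Sg.PosDef)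
    (hd : Sg.IsDiag) (h_mem : ∀ k, MemLp (fun ω => standardize μ Sg (Y ω) k) 2 P) (t : ι → ℝ) :
    MTCov P Y t =
      CFC.sqrt Sg * MTCov P (fun ω => standardize μ Sg (Y ω)) (standardize μ Sg t) *
        CFC.sqrt Sg := by
  rw [MTCov, MTCov, exceed_standardize_of_isDiag hSg hd,
    condCov_eq_sqrt_mul_condCov_standardize_mul_sqrt hSg h_mem]

end Standardize

/-! ### Tail conditional moments -/

section TailConditional

variable {ι Ω : Type*} [Fintype ι] [MeasurableSpace Ω] {P : Measure Ω} {f h : (ι → ℝ) → ℝ}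
  {Z : Ω → ι → ℝ}

theorem setIntegral_exceed (hf : Measurable f) (hf₀ : ∀ x, 0 ≤ f x) (hZ : HasLaw Z (lawOf f) P)
    (t : ι → ℝ) (hh : Measurable h) : ∫ ω in exceed Z t, h (Z ω) ∂P = tailExp f t h := by
  have h_tail := measurableSet_tailSet t
  refine (setIntegral_map h_tail hh.aestronglyMeasurable hZ.aemeasurable).symm.trans ?_
  rw [hZ.map_eq, lawOf, setIntegral_withDensity_eq_setIntegral_toReal_smul₀ (by fun_prop)
    (by simp) _ h_tail]
  simp only [ENNReal.toReal_ofReal (hf₀ _), smul_eq_mul, mul_comm (f _), tailExp]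

theorem measureReal_exceed (hf : Measurable f) (hf₀ : ∀ x, 0 ≤ f x) (hZ : HasLaw Z (lawOf f) P)
    (t : ι → ℝ) : P.real (exceed Z t) = tailFn f t := by
  simpa [tailExp, tailFn] using setIntegral_exceed hf hf₀ hZ t (h := fun _ => 1) measurable_const

theorem integral_cond_exceed (hf : Measurable f) (hf₀ : ∀ x, 0 ≤ f x)
    (hZ : HasLaw Z (lawOf f) P) (t : ι → ℝ) (hh : Measurable h) :
    ∫ ω, h (Z ω) ∂P[|exceed Z t] = tailExp f t h / tailFn f t := by
  rw [ProbabilityTheory.cond, integral_smul_measure, setIntegral_exceed hf hf₀ hZ t hh,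
    ENNReal.toReal_inv, smul_eq_mul, ← measureReal_def, measureReal_exceed hf hf₀ hZ t, mul_comm,
    div_eq_mul_inv]

theorem MTCE_eq_tailExp_div_tailFn (hf : Measurable f) (hf₀ : ∀ x, 0 ≤ f x)
    (hZ : HasLaw Z (lawOf f) P) (t : ι → ℝ) (k : ι) :
    MTCE P Z t k = tailExp f t (fun x => x k) / tailFn f t :=
  integral_cond_exceed hf hf₀ hZ t (measurable_pi_apply k)

theorem MTCov_eq_tailExp_div_tailFn_sub [IsFiniteMeasure P] (hf : Measurable f)
    (hf₀ : ∀ x, 0 ≤ f x) (hZ : HasLaw Z (lawOf f) P) (h_mem : ∀ k, MemLp (fun ω => Z ω k) 2 P)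
    {t : ι → ℝ} (h_pos : 0 < P (exceed Z t)) (i j : ι) :
    MTCov P Z t i j =
      tailExp f t (fun x => x i * x j) / tailFn f t - MTCE P Z t i * MTCE P Z t j := by
  have := cond_isProbabilityMeasure h_pos.ne'
  have h_prod := integral_cond_exceed hf hf₀ hZ t (h := fun x => x i * x j) (by fun_prop)
  rw [← h_prod]
  exact covariance_eq_sub (memLp_cond (h_mem i) h_pos.ne') (memLp_cond (h_mem j) h_pos.ne')

theorem isOpen_tailSet {ι : Type*} [Finite ι] (t : ι → ℝ) : IsOpen (tailSet t) := by
  simp only [tailSet, ofPred_forall]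
  exact isOpen_iInter_of_finite fun k => isOpen_lt continuous_const (continuous_apply k)

theorem measure_exceed_pos (hf : Measurable f) (hf_pos : ∀ x, 0 < f x)
    (hZ : HasLaw Z (lawOf f) P) (t : ι → ℝ) : 0 < P (exceed Z t) := by
  have h_eq : P (exceed Z t) = lawOf f (tailSet t) := by
    rw [← hZ.map_eq, Measure.map_apply_of_aemeasurable hZ.aemeasurable (measurableSet_tailSet t)]
    rfl
  have h_support : {x | ENNReal.ofReal (f x) ≠ 0} = univ := by
    simpa [eq_univ_iff_forall] using hf_pos
  rw [h_eq, pos_iff_ne_zero, lawOf, Ne, withDensity_apply_eq_zero (by fun_prop), h_support,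
    univ_inter]
  exact ((isOpen_tailSet t).measure_pos volume ⟨fun k => t k + 1, fun k => by simp⟩).ne'

variable [DecidableEq ι] {g : ℝ → ℝ} {H : (ι → ℝ) → ℝ}

theorem tailExp_gseDensity (g : ℝ → ℝ) (H : (ι → ℝ) → ℝ) (t : ι → ℝ) (h : (ι → ℝ) → ℝ) :
    tailExp (gseDensity 0 1 g H) t h = 2 * tailExp (sphDensity g) t fun x => h x * H x := by
  simp only [tailExp, gseDensity_zero_one, ← integral_const_mul]
  congr 1 with x
  ring

theorem tailFn_gseDensity (g : ℝ → ℝ) (H : (ι → ℝ) → ℝ) (t : ι → ℝ) :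
    tailFn (gseDensity 0 1 g H) t = 2 * tailExp (sphDensity g) t H := by
  simpa [tailExp, tailFn] using tailExp_gseDensity g H t fun _ => 1

namespace IsRegularGen

theorem measurable_gseDensity (hg : IsRegularGen g) (hH : Measurable H) :
    Measurable (gseDensity 0 1 g H) :=
  SkewLaplace.measurable_gseDensity hg.continuous.measurable hH 0 1

theorem gseDensity_nonneg (hg : IsRegularGen g) (hH : ∀ x, 0 ≤ H x) (x : ι → ℝ) :
    0 ≤ gseDensity 0 1 g H x := by
  have := hg.sphDensity_pos x
  have := hH x
  rw [gseDensity_zero_one]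
  positivity

theorem gseDensity_pos (hg : IsRegularGen g) (hH : ∀ x, 0 < H x) (x : ι → ℝ) :
    0 < gseDensity 0 1 g H x := by
  have := hg.sphDensity_pos x
  have := hH x
  rw [gseDensity_zero_one]
  positivity

theorem memLp_coord_of_hasLaw_gse (hg : IsRegularGen g) (hH : Measurable H)
    (hH_mem : ∀ x, H x ∈ Icc (0 : ℝ) 1) (hZ : HasLaw Z (lawOf (gseDensity 0 1 g H)) P) (k : ι) :
    MemLp (fun ω => Z ω k) 2 P := by
  have h_meas : Measurable fun x : ι → ℝ => x k := measurable_pi_apply k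
  have h_dens := hg.measurable_gseDensity hH
  have h_le (x : ι → ℝ) : |x k ^ 2 * H x| ≤ 1 * (1 + √(x ⬝ᵥ x)) ^ 2 := by
    have h_coord : |x k| ≤ 1 + √(x ⬝ᵥ x) := (abs_le_sqrt_dotProduct_self x k).trans (by simp)
    rw [abs_mul, abs_of_nonneg (hH_mem x).1, abs_pow, mul_comm]
    exact mul_le_mul (hH_mem x).2 (pow_le_pow_left₀ (abs_nonneg _) h_coord 2) (by positivity)
      zero_le_one
  suffices MemLp (fun x : ι → ℝ => x k) 2 (P.map Z) from
    (memLp_map_measure_iff h_meas.aestronglyMeasurable hZ.aemeasurable).1 this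
  rw [hZ.map_eq, memLp_two_iff_integrable_sq h_meas.aestronglyMeasurable, lawOf,
    integrable_withDensity_iff_integrable_smul' (by fun_prop) (by simp)]
  have h_int := (hg.integrable_mul (by fun_prop) h_le).const_mul
    (2 * normConst (Fintype.card ι) g)
  refine h_int.congr (Eventually.of_forall fun x => ?_)
  dsimp only
  rw [ENNReal.toReal_ofReal (hg.gseDensity_nonneg (fun y => (hH_mem y).1) x), smul_eq_mul,
    gseDensity_zero_one, sphDensity]
  ring

theorem MTCE_gse_eq_tailExp (hg : IsRegularGen g) (hH : Measurable H) (hH₀ : ∀ x, 0 ≤ H x)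
    (hZ : HasLaw Z (lawOf (gseDensity 0 1 g H)) P) (t : ι → ℝ) (k : ι) :
    MTCE P Z t k =
      2 / tailFn (gseDensity 0 1 g H) t * tailExp (sphDensity g) t fun x => x k * H x := by
  rw [MTCE_eq_tailExp_div_tailFn (hg.measurable_gseDensity hH) (hg.gseDensity_nonneg hH₀) hZ,
    tailExp_gseDensity]
  ring

theorem MTCov_gse_eq_tailExp [IsFiniteMeasure P] (hg : IsRegularGen g) (hH : Measurable H)
    (hH_mem : ∀ x, H x ∈ Icc (0 : ℝ) 1) (hZ : HasLaw Z (lawOf (gseDensity 0 1 g H)) P)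
    {t : ι → ℝ} (h_pos : 0 < P (exceed Z t)) (i j : ι) :
    MTCov P Z t i j =
      2 / tailFn (gseDensity 0 1 g H) t *
          tailExp (sphDensity g) t (fun x => x i * (x j * H x)) -
        MTCE P Z t i * MTCE P Z t j := by
  rw [MTCov_eq_tailExp_div_tailFn_sub (hg.measurable_gseDensity hH)
    (hg.gseDensity_nonneg fun x => (hH_mem x).1) hZ (hg.memLp_coord_of_hasLaw_gse hH hH_mem hZ)
    h_pos, tailExp_gseDensity]
  simp only [mul_assoc]
  ring

end IsRegularGen

end TailConditional

/-! ### Tail risk of generalized skew-elliptical vectors -/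

section LaplaceDensity

variable {ι : Type*} [Fintype ι]

theorem hasTailExp_sphDensity_cumGen_lapGen_iff (t : ι → ℝ) (h : (ι → ℝ) → ℝ) :
    HasTailExp (sphDensity (cumGen lapGen)) t h ↔
      HasTailExp (sphDensity lapGen) t fun x => (1 + √(x ⬝ᵥ x)) * h x := by
  rw [isRegularGen_lapGen.hasTailExp_sphDensity_iff,
    isRegularGen_lapGen.cumGen.hasTailExp_sphDensity_iff]
  simp only [cumGen_lapGen_half_mul (dotProduct_self_nonneg _), mul_left_comm, mul_assoc]

theorem div_normConst_mul_tailExp_cumGen_lapGen (t : ι → ℝ) (h : (ι → ℝ) → ℝ) :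
    normConst (Fintype.card ι) lapGen / normConst (Fintype.card ι) (cumGen lapGen) *
        tailExp (sphDensity (cumGen lapGen)) t h =
      tailExp (sphDensity lapGen) t fun x => (1 + √(x ⬝ᵥ x)) * h x := by
  rw [isRegularGen_lapGen.cumGen.div_normConst_mul_tailExp, tailExp_sphDensity]
  simp only [cumGen_lapGen_half_mul (dotProduct_self_nonneg _), mul_left_comm, mul_assoc]

end LaplaceDensity

section SkewElliptical

variable {n : ℕ} {Ω : Type*} [MeasurableSpace Ω] {P : Measure Ω} {Z : Ω → Fin n → ℝ}
  {g H : ℝ → ℝ} {lam γ : Fin n → ℝ}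

theorem contDiff_one_of_absolutelyContinuousOnInterval_deriv (hH : Differentiable ℝ H)
    (hH' : ∀ a b, AbsolutelyContinuousOnInterval (deriv H) a b) : ContDiff ℝ 1 H :=
  contDiff_one_iff_deriv.2 ⟨hH, continuous_of_absolutelyContinuousOnInterval hH'⟩

theorem abs_le_one_of_mem_Icc {x : ℝ} (hx : x ∈ Icc (0 : ℝ) 1) : |x| ≤ 1 :=
  abs_le.2 ⟨by linarith [hx.1], hx.2⟩

theorem measurable_comp_dotProduct {ι : Type*} [Fintype ι] (hH : Measurable H) (γ : ι → ℝ) :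
    Measurable fun z => H (γ ⬝ᵥ z) :=
  hH.comp (by fun_prop)

namespace IsRegularGen

theorem MTCE_gse (hg : IsRegularGen g) (hH : ∀ a b, AbsolutelyContinuousOnInterval H a b)
    (hH_mem : ∀ s, H s ∈ Icc (0 : ℝ) 1)
    (hZ : HasLaw Z (lawOf (gseDensity 0 1 g fun z => H (γ ⬝ᵥ z))) P)
    (h_bulk : HasTailExp (sphDensity (cumGen g)) lam fun x => deriv H (γ ⬝ᵥ x)) (k : Fin n) :
    MTCE P Z lam k =
      2 / tailFn (gseDensity 0 1 g fun z => H (γ ⬝ᵥ z)) lam *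
        (normConst n g / constW g lam k *
            tailExp (densW g lam k) (drop lam k) (fun w => H (γ ⬝ᵥ put lam k w)) +
          γ k * (normConst n g / normConst n (cumGen g) *
            tailExp (sphDensity (cumGen g)) lam fun x => deriv H (γ ⬝ᵥ x))) := by
  have h_meas := (continuous_of_absolutelyContinuousOnInterval hH).measurable
  rw [hg.MTCE_gse_eq_tailExp (measurable_comp_dotProduct h_meas γ) (fun x => (hH_mem _).1) hZ,
    hg.tailExp_coord_mul_comp_dotProduct hH (fun s => abs_le_one_of_mem_Icc (hH_mem s)) k h_bulk]

theorem MTCov_gse_of_ne [IsFiniteMeasure P] (hg : IsRegularGen g) (hH : ContDiff ℝ 1 H)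
    (hH_mem : ∀ s, H s ∈ Icc (0 : ℝ) 1)
    (hH' : ∀ a b, AbsolutelyContinuousOnInterval (deriv H) a b)
    (hZ : HasLaw Z (lawOf (gseDensity 0 1 g fun z => H (γ ⬝ᵥ z))) P)
    (h_pos : 0 < P (exceed Z lam))
    (h_face : ∀ k, HasTailExp (densV g lam k) (drop lam k) fun v => deriv H (γ ⬝ᵥ put lam k v))
    (h_bulk : HasTailExp (sphDensity (cumGen (cumGen g))) lam fun x => deriv (deriv H) (γ ⬝ᵥ x))
    {i j : Fin n} (hij : i ≠ j) :
    MTCov P Z lam i j =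
      2 / tailFn (gseDensity 0 1 g fun z => H (γ ⬝ᵥ z)) lam *
          (normConst n g / constU g lam i j *
              tailExp (densU g lam i j) (drop₂ lam i j) (fun u => H (γ ⬝ᵥ put₂ lam i j u)) +
            normConst n g / constV g lam i * γ j *
              tailExp (densV g lam i) (drop lam i) (fun v => deriv H (γ ⬝ᵥ put lam i v)) +
            normConst n g / constV g lam j * γ i *
              tailExp (densV g lam j) (drop lam j) (fun v => deriv H (γ ⬝ᵥ put lam j v)) +
            normConst n g / normConst n (cumGen (cumGen g)) * γ i * γ j *
              tailExp (sphDensity (cumGen (cumGen g))) lam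
                (fun x => deriv (deriv H) (γ ⬝ᵥ x))) -
        MTCE P Z lam i * MTCE P Z lam j := by
  rw [hg.MTCov_gse_eq_tailExp (measurable_comp_dotProduct hH.continuous.measurable γ)
    (fun x => hH_mem _) hZ h_pos, hg.tailExp_coord_mul_coord_mul_comp_dotProduct_of_ne hH
    (fun s => abs_le_one_of_mem_Icc (hH_mem s)) hH' h_face h_bulk hij]

theorem MTCov_gse_self [IsFiniteMeasure P] (hg : IsRegularGen g) (hH : ContDiff ℝ 1 H)
    (hH_mem : ∀ s, H s ∈ Icc (0 : ℝ) 1)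
    (hH' : ∀ a b, AbsolutelyContinuousOnInterval (deriv H) a b)
    (hZ : HasLaw Z (lawOf (gseDensity 0 1 g fun z => H (γ ⬝ᵥ z))) P)
    (h_pos : 0 < P (exceed Z lam)) {i : Fin n}
    (h_face : HasTailExp (densV g lam i) (drop lam i) fun v => deriv H (γ ⬝ᵥ put lam i v))
    (h_bulk : HasTailExp (sphDensity (cumGen (cumGen g))) lam
      fun x => deriv (deriv H) (γ ⬝ᵥ x)) :
    MTCov P Z lam i i =
      2 / tailFn (gseDensity 0 1 g fun z => H (γ ⬝ᵥ z)) lam *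
          (normConst n g / constW g lam i * lam i *
              tailExp (densW g lam i) (drop lam i) (fun w => H (γ ⬝ᵥ put lam i w)) +
            normConst n g / constV g lam i * γ i *
              tailExp (densV g lam i) (drop lam i) (fun v => deriv H (γ ⬝ᵥ put lam i v)) +
            normConst n g / normConst n (cumGen (cumGen g)) * γ i ^ 2 *
              tailExp (sphDensity (cumGen (cumGen g))) lam
                (fun x => deriv (deriv H) (γ ⬝ᵥ x))) +
          normConst n g / normConst n (cumGen g) *
            (tailFn (gseDensity 0 1 (cumGen g) fun z => H (γ ⬝ᵥ z)) lam /
              tailFn (gseDensity 0 1 g fun z => H (γ ⬝ᵥ z)) lam) -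
        MTCE P Z lam i ^ 2 := by
  rw [hg.MTCov_gse_eq_tailExp (measurable_comp_dotProduct hH.continuous.measurable γ)
    (fun x => hH_mem _) hZ h_pos, hg.tailExp_coord_mul_coord_mul_comp_dotProduct_self hH
    (fun s => abs_le_one_of_mem_Icc (hH_mem s)) hH' h_face h_bulk,
    tailFn_gseDensity (cumGen g)]
  ring

end IsRegularGen

theorem MTCE_gse_lapGen (hH : ∀ a b, AbsolutelyContinuousOnInterval H a b)
    (hH_mem : ∀ s, H s ∈ Icc (0 : ℝ) 1)
    (hZ : HasLaw Z (lawOf (gseDensity 0 1 lapGen fun z => H (γ ⬝ᵥ z))) P)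
    (h_bulk : HasTailExp (sphDensity lapGen) lam fun m => (1 + √(m ⬝ᵥ m)) * deriv H (γ ⬝ᵥ m))
    (k : Fin n) :
    MTCE P Z lam k =
      2 / tailFn (gseDensity 0 1 lapGen fun z => H (γ ⬝ᵥ z)) lam *
        (normConst n lapGen / constW lapGen lam k *
            tailExp (densW lapGen lam k) (drop lam k) (fun w => H (γ ⬝ᵥ put lam k w)) +
          γ k * tailExp (sphDensity lapGen) lam
            fun m => (1 + √(m ⬝ᵥ m)) * deriv H (γ ⬝ᵥ m)) := by
  rw [← hasTailExp_sphDensity_cumGen_lapGen_iff] at h_bulk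
  have h_ratio := div_normConst_mul_tailExp_cumGen_lapGen lam fun x => deriv H (γ ⬝ᵥ x)
  rw [Fintype.card_fin] at h_ratio
  rw [isRegularGen_lapGen.MTCE_gse hH hH_mem hZ h_bulk, h_ratio]

end SkewElliptical

/-! ### The univariate Laplace distribution -/

section UnivariateLaplace

theorem continuous_lapPdf : Continuous lapPdf := by unfold lapPdf; fun_prop

theorem lapPdf_pos (x : ℝ) : 0 < lapPdf x := by unfold lapPdf; positivity

theorem abs_lapPdf_le_one (x : ℝ) : |lapPdf x| ≤ 1 := by
  have : Real.exp (-|x|) ≤ 1 := Real.exp_le_one_iff.2 (neg_nonpos.2 (abs_nonneg x))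
  rw [abs_of_pos (lapPdf_pos x), lapPdf]
  linarith

theorem integral_lapPdf : ∫ x, lapPdf x = 1 := by
  have h := integral_comp_abs (f := fun x => Real.exp (-x) / 2)
  rw [integral_div 2 fun x => Real.exp (-x), integral_exp_neg_Ioi_zero] at h
  simpa [lapPdf] using h

theorem integrable_lapPdf : Integrable lapPdf := integrable_of_integral_eq_one integral_lapPdf

theorem lapCdf_add_integral_Ioi (x : ℝ) : lapCdf x + ∫ t in Ioi x, lapPdf t = 1 := by
  rw [lapCdf, intervalIntegral.integral_Iic_add_Ioi integrable_lapPdf.integrableOn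
    integrable_lapPdf.integrableOn, integral_lapPdf]

theorem lapCdf_mem_Icc (x : ℝ) : lapCdf x ∈ Icc (0 : ℝ) 1 := by
  have h_nonneg (s : Set ℝ) : 0 ≤ ∫ t in s, lapPdf t := integral_nonneg fun t => (lapPdf_pos t).le
  exact ⟨h_nonneg _, by linarith [lapCdf_add_integral_Ioi x, h_nonneg (Ioi x)]⟩

theorem lapCdf_pos (x : ℝ) : 0 < lapCdf x := by
  have h_support : Function.support lapPdf = univ :=
    eq_univ_of_forall fun t => (lapPdf_pos t).ne'
  rw [lapCdf, setIntegral_pos_iff_support_of_nonneg_ae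
    (Eventually.of_forall fun t => (lapPdf_pos t).le) integrable_lapPdf.integrableOn, h_support]
  simp

theorem hasDerivAt_integral_Iic {f : ℝ → ℝ} (hf : Continuous f) (h_int : Integrable f) (x : ℝ) :
    HasDerivAt (fun y => ∫ t in Iic y, f t) (f x) x := by
  have h_eq (y : ℝ) : ∫ t in Iic y, f t = (∫ t in Iic x, f t) + ∫ t in x..y, f t := by
    rw [← intervalIntegral.integral_Iic_sub_Iic h_int.integrableOn h_int.integrableOn,
      add_sub_cancel]
  exact ((hf.integral_hasStrictDerivAt x x).hasDerivAt.const_add _).congr_of_eventuallyEq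
    (.of_forall h_eq)

theorem hasDerivAt_lapCdf (x : ℝ) : HasDerivAt lapCdf (lapPdf x) x :=
  hasDerivAt_integral_Iic continuous_lapPdf integrable_lapPdf x

theorem deriv_lapCdf : deriv lapCdf = lapPdf := funext fun x => (hasDerivAt_lapCdf x).deriv

theorem contDiff_lapCdf : ContDiff ℝ 1 lapCdf :=
  contDiff_one_iff_deriv.2
    ⟨fun x => (hasDerivAt_lapCdf x).differentiableAt, deriv_lapCdf ▸ continuous_lapPdf⟩

theorem not_differentiableAt_lapPdf_zero : ¬ DifferentiableAt ℝ lapPdf 0 := by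
  intro h
  have h_log : DifferentiableAt ℝ (fun x => -Real.log (2 * lapPdf x)) 0 :=
    ((h.const_mul 2).log (mul_pos two_pos (lapPdf_pos 0)).ne').neg
  refine not_differentiableAt_abs_zero (h_log.congr_of_eventuallyEq (.of_forall fun x => ?_))
  simp only [lapPdf, mul_div_cancel₀ _ (two_ne_zero' ℝ), Real.log_exp, neg_neg]

theorem deriv_lapPdf (x : ℝ) : deriv lapPdf x = -(x / |x| * lapPdf x) := by
  rcases eq_or_ne x 0 with rfl | hx
  · rw [deriv_zero_of_not_differentiableAt not_differentiableAt_lapPdf_zero]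
    simp
  · have h_deriv : HasDerivAt lapPdf (Real.exp (-|x|) * -(SignType.sign x : ℝ) / 2) x :=
      ((hasDerivAt_abs hx).neg.exp).div_const 2
    rw [h_deriv.deriv, (div_eq_iff (abs_ne_zero.2 hx)).2 (sign_mul_abs x).symm, lapPdf]
    ring

theorem abs_exp_sub_exp_le {a b : ℝ} (ha : a ≤ 0) (hb : b ≤ 0) :
    |Real.exp a - Real.exp b| ≤ |a - b| := by
  simpa using (convex_Iic (0 : ℝ)).norm_image_sub_le_of_norm_deriv_le (f := Real.exp) (C := 1)
    (fun x _ => Real.differentiableAt_exp) (fun x hx => by simpa using hx) hb ha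

theorem lipschitzWith_lapPdf : LipschitzWith 1 lapPdf := by
  refine LipschitzWith.of_le_add fun x y => ?_
  have h_exp := abs_exp_sub_exp_le (neg_nonpos.2 (abs_nonneg x)) (neg_nonpos.2 (abs_nonneg y))
  have h_abs : abs (-|x| - -|y|) ≤ |x - y| := by
    rw [neg_sub_neg, abs_sub_comm]
    exact abs_abs_sub_abs_le x y
  have := le_of_abs_le h_exp
  have := abs_nonneg (x - y)
  rw [Real.dist_eq, lapPdf, lapPdf]
  linarith

theorem abs_deriv_lapPdf_le_one (x : ℝ) : |deriv lapPdf x| ≤ 1 :=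
  norm_deriv_le_of_lipschitz lipschitzWith_lapPdf

theorem absolutelyContinuousOnInterval_deriv_lapCdf (a b : ℝ) :
    AbsolutelyContinuousOnInterval (deriv lapCdf) a b := by
  rw [deriv_lapCdf]
  exact lipschitzWith_lapPdf.lipschitzOnWith.absolutelyContinuousOnInterval

end UnivariateLaplace

/-! ### Skewing by the Laplace distribution function, and no skewing -/

section Instances

variable {n : ℕ} {Ω : Type*} [MeasurableSpace Ω] {P : Measure Ω} {Y Z : Ω → Fin n → ℝ}
  {g H : ℝ → ℝ} {lam γ : Fin n → ℝ}

theorem tailExp_neg {ι : Type*} [Fintype ι] (f : (ι → ℝ) → ℝ) (t : ι → ℝ) (h : (ι → ℝ) → ℝ) :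
    tailExp f t (fun x => -h x) = -tailExp f t h := by
  simp only [tailExp, neg_mul, integral_neg]

theorem tailExp_const {ι : Type*} [Fintype ι] (f : (ι → ℝ) → ℝ) (t : ι → ℝ) (c : ℝ) :
    tailExp f t (fun _ => c) = c * tailFn f t := by
  simp only [tailExp, tailFn, integral_const_mul]

theorem hasTailExp_zero {ι : Type*} [Fintype ι] (f : (ι → ℝ) → ℝ) (t : ι → ℝ) :
    HasTailExp f t fun _ => 0 := by
  simp only [HasTailExp, zero_mul, integrableOn_zero]

theorem absolutelyContinuousOnInterval_const (c a b : ℝ) :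
    AbsolutelyContinuousOnInterval (fun _ => c) a b :=
  (contDiff_const (n := 1)).contDiffOn.absolutelyContinuousOnInterval

theorem gseDensity_half {ι : Type*} [Fintype ι] [DecidableEq ι] (μ : ι → ℝ) (Sg : Matrix ι ι ℝ)
    (g : ℝ → ℝ) : gseDensity μ Sg g (fun _ => 1 / 2) = ellDensity μ Sg g := by
  ext x
  rw [gseDensity]
  ring

theorem gseDensity_zero_one_half {ι : Type*} [Fintype ι] [DecidableEq ι] (g : ℝ → ℝ) :
    gseDensity (0 : ι → ℝ) 1 g (fun _ => 1 / 2) = sphDensity g := by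
  rw [gseDensity_half, ellDensity_zero_one]

theorem hasLaw_standardize_ellDensity {μ : Fin n → ℝ} {Sg : Matrix (Fin n) (Fin n) ℝ}
    (hSg : Sg.PosDef) (hg : Measurable g) (hY : HasLaw Y (lawOf (ellDensity μ Sg g)) P) :
    HasLaw (fun ω => standardize μ Sg (Y ω)) (lawOf (sphDensity g)) P := by
  rw [← gseDensity_half] at hY
  rw [← gseDensity_zero_one_half]
  exact hasLaw_standardize hSg hg measurable_const hY

theorem hasLaw_standardize_gsLaplaceLaw {μ : Fin n → ℝ} {Sg : Matrix (Fin n) (Fin n) ℝ}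
    (hSg : Sg.PosDef) (hH : Measurable H) (hY : HasLaw Y (gsLaplaceLaw μ Sg γ H) P) :
    HasLaw (fun ω => standardize μ Sg (Y ω)) (gsLaplaceLaw 0 1 γ H) P :=
  hasLaw_standardize hSg isRegularGen_lapGen.continuous.measurable
    (measurable_comp_dotProduct hH γ) hY

namespace IsRegularGen

theorem hasTailExp_densV_comp_dotProduct_put (hg : IsRegularGen g) (lam γ : Fin n → ℝ)
    (hH : Measurable H) {C : ℝ} (hHC : ∀ x, |H x| ≤ C) (k : Fin n) :
    HasTailExp (densV g lam k) (drop lam k) fun v => H (γ ⬝ᵥ put lam k v) := by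
  rw [densV_eq_sphDensity]
  exact (hg.genV lam k).hasTailExp_comp_dotProduct_put lam γ k _ hH hHC

theorem measure_exceed_pos_of_hasLaw_gse (hg : IsRegularGen g) (hH : Measurable H)
    (hH_pos : ∀ s, 0 < H s)
    (hZ : HasLaw Z (lawOf (gseDensity 0 1 g fun z => H (γ ⬝ᵥ z))) P) (t : Fin n → ℝ) :
    0 < P (exceed Z t) :=
  measure_exceed_pos (hg.measurable_gseDensity (measurable_comp_dotProduct hH γ))
    (hg.gseDensity_pos fun _ => hH_pos _) hZ t

theorem measure_exceed_pos_of_hasLaw_sph (hg : IsRegularGen g)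
    (hZ : HasLaw Z (lawOf (sphDensity g)) P) (t : Fin n → ℝ) : 0 < P (exceed Z t) := by
  rw [← gseDensity_zero_one_half] at hZ
  exact hg.measure_exceed_pos_of_hasLaw_gse (H := fun _ => 1 / 2) (γ := 0) measurable_const
    (fun _ => one_half_pos) hZ t

theorem hasTailExp_densV_deriv_lapCdf (hg : IsRegularGen g) (lam γ : Fin n → ℝ) (k : Fin n) :
    HasTailExp (densV g lam k) (drop lam k) fun v => deriv lapCdf (γ ⬝ᵥ put lam k v) := by
  rw [deriv_lapCdf]
  exact hg.hasTailExp_densV_comp_dotProduct_put lam γ continuous_lapPdf.measurable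
    abs_lapPdf_le_one k

theorem hasTailExp_sphDensity_deriv_lapCdf (hg : IsRegularGen g) (lam γ : Fin n → ℝ) :
    HasTailExp (sphDensity g) lam fun x => deriv lapCdf (γ ⬝ᵥ x) := by
  rw [deriv_lapCdf]
  exact hg.hasTailExp_comp_dotProduct lam γ continuous_lapPdf.measurable abs_lapPdf_le_one

theorem hasTailExp_sphDensity_deriv_deriv_lapCdf (hg : IsRegularGen g) (lam γ : Fin n → ℝ) :
    HasTailExp (sphDensity g) lam fun x => deriv (deriv lapCdf) (γ ⬝ᵥ x) := by
  rw [deriv_lapCdf]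
  exact hg.hasTailExp_comp_dotProduct lam γ (measurable_deriv _) abs_deriv_lapPdf_le_one

theorem MTCov_gse_lapCdf_of_ne [IsFiniteMeasure P] (hg : IsRegularGen g)
    (hZ : HasLaw Z (lawOf (gseDensity 0 1 g fun z => lapCdf (γ ⬝ᵥ z))) P) {i j : Fin n}
    (hij : i ≠ j) :
    MTCov P Z lam i j =
      2 / tailFn (gseDensity 0 1 g fun z => lapCdf (γ ⬝ᵥ z)) lam *
          (normConst n g / constU g lam i j *
              tailExp (densU g lam i j) (drop₂ lam i j) (fun u => lapCdf (γ ⬝ᵥ put₂ lam i j u)) +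
            normConst n g / constV g lam i * γ j *
              tailExp (densV g lam i) (drop lam i) (fun v => lapPdf (γ ⬝ᵥ put lam i v)) +
            normConst n g / constV g lam j * γ i *
              tailExp (densV g lam j) (drop lam j) (fun v => lapPdf (γ ⬝ᵥ put lam j v)) -
            normConst n g / normConst n (cumGen (cumGen g)) * γ i * γ j *
              tailExp (sphDensity (cumGen (cumGen g))) lam
                (fun x => (γ ⬝ᵥ x) / |γ ⬝ᵥ x| * lapPdf (γ ⬝ᵥ x))) -
        MTCE P Z lam i * MTCE P Z lam j := by
  rw [hg.MTCov_gse_of_ne contDiff_lapCdf lapCdf_mem_Icc absolutelyContinuousOnInterval_deriv_lapCdf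
    hZ (hg.measure_exceed_pos_of_hasLaw_gse contDiff_lapCdf.continuous.measurable lapCdf_pos hZ lam)
    (hg.hasTailExp_densV_deriv_lapCdf lam γ)
    (hg.cumGen.cumGen.hasTailExp_sphDensity_deriv_deriv_lapCdf lam γ) hij]
  simp only [deriv_lapCdf, deriv_lapPdf, tailExp_neg, mul_neg, ← sub_eq_add_neg]

theorem MTCov_gse_lapCdf_self [IsFiniteMeasure P] (hg : IsRegularGen g)
    (hZ : HasLaw Z (lawOf (gseDensity 0 1 g fun z => lapCdf (γ ⬝ᵥ z))) P) (i : Fin n) :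
    MTCov P Z lam i i =
      2 / tailFn (gseDensity 0 1 g fun z => lapCdf (γ ⬝ᵥ z)) lam *
          (normConst n g / constW g lam i * lam i *
              tailExp (densW g lam i) (drop lam i) (fun w => lapCdf (γ ⬝ᵥ put lam i w)) +
            normConst n g / constV g lam i * γ i *
              tailExp (densV g lam i) (drop lam i) (fun v => lapPdf (γ ⬝ᵥ put lam i v)) -
            normConst n g / normConst n (cumGen (cumGen g)) * γ i ^ 2 *
              tailExp (sphDensity (cumGen (cumGen g))) lam
                (fun x => (γ ⬝ᵥ x) / |γ ⬝ᵥ x| * lapPdf (γ ⬝ᵥ x))) +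
          normConst n g / normConst n (cumGen g) *
            (tailFn (gseDensity 0 1 (cumGen g) fun z => lapCdf (γ ⬝ᵥ z)) lam /
              tailFn (gseDensity 0 1 g fun z => lapCdf (γ ⬝ᵥ z)) lam) -
        MTCE P Z lam i ^ 2 := by
  rw [hg.MTCov_gse_self contDiff_lapCdf lapCdf_mem_Icc absolutelyContinuousOnInterval_deriv_lapCdf
    hZ (hg.measure_exceed_pos_of_hasLaw_gse contDiff_lapCdf.continuous.measurable lapCdf_pos hZ lam)
    (hg.hasTailExp_densV_deriv_lapCdf lam γ i)
    (hg.cumGen.cumGen.hasTailExp_sphDensity_deriv_deriv_lapCdf lam γ)]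
  simp only [deriv_lapCdf, deriv_lapPdf, tailExp_neg, mul_neg, ← sub_eq_add_neg]

theorem MTCE_sph (hg : IsRegularGen g) (hZ : HasLaw Z (lawOf (sphDensity g)) P) (k : Fin n) :
    MTCE P Z lam k =
      1 / tailFn (sphDensity g) lam *
        (normConst n g / constW g lam k * tailFn (densW g lam k) (drop lam k)) := by
  rw [← gseDensity_zero_one_half] at hZ
  rw [hg.MTCE_gse (H := fun _ => 1 / 2) (γ := 0)
    (absolutelyContinuousOnInterval_const _)
    (fun _ => ⟨by norm_num, by norm_num⟩) hZ (by simpa using hasTailExp_zero _ lam) k]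
  simp only [gseDensity_zero_one_half, tailExp_const, Pi.zero_apply]
  ring

theorem MTCov_sph_of_ne [IsFiniteMeasure P] (hg : IsRegularGen g)
    (hZ : HasLaw Z (lawOf (sphDensity g)) P) {i j : Fin n} (hij : i ≠ j) :
    MTCov P Z lam i j =
      1 / tailFn (sphDensity g) lam *
          (normConst n g / constU g lam i j * tailFn (densU g lam i j) (drop₂ lam i j)) -
        MTCE P Z lam i * MTCE P Z lam j := by
  have h_pos := hg.measure_exceed_pos_of_hasLaw_sph hZ lam
  rw [← gseDensity_zero_one_half] at hZ
  rw [hg.MTCov_gse_of_ne (H := fun _ => 1 / 2) (γ := 0) contDiff_const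
    (fun _ => ⟨by norm_num, by norm_num⟩)
    (by simpa using absolutelyContinuousOnInterval_const 0) hZ h_pos
    (fun k => by simpa using hasTailExp_zero _ _) (by simpa using hasTailExp_zero _ lam) hij]
  simp only [gseDensity_zero_one_half, tailExp_const, Pi.zero_apply]
  ring

theorem MTCov_sph_self [IsFiniteMeasure P] (hg : IsRegularGen g)
    (hZ : HasLaw Z (lawOf (sphDensity g)) P) (i : Fin n) :
    MTCov P Z lam i i =
      1 / tailFn (sphDensity g) lam *
          (normConst n g / constW g lam i * lam i * tailFn (densW g lam i) (drop lam i)) +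
          normConst n g / normConst n (cumGen g) *
            (tailFn (sphDensity (cumGen g)) lam / tailFn (sphDensity g) lam) -
        MTCE P Z lam i ^ 2 := by
  have h_pos := hg.measure_exceed_pos_of_hasLaw_sph hZ lam
  rw [← gseDensity_zero_one_half] at hZ
  rw [hg.MTCov_gse_self (H := fun _ => 1 / 2) (γ := 0) contDiff_const
    (fun _ => ⟨by norm_num, by norm_num⟩)
    (by simpa using absolutelyContinuousOnInterval_const 0) hZ h_pos
    (by simpa using hasTailExp_zero _ _) (by simpa using hasTailExp_zero _ lam)]
  simp only [gseDensity_zero_one_half, tailExp_const, Pi.zero_apply]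
  ring

end IsRegularGen

theorem MTCE_gse_lapGen_lapCdf
    (hZ : HasLaw Z (lawOf (gseDensity 0 1 lapGen fun z => lapCdf (γ ⬝ᵥ z))) P) (k : Fin n) :
    MTCE P Z lam k =
      2 / tailFn (gseDensity 0 1 lapGen fun z => lapCdf (γ ⬝ᵥ z)) lam *
        (normConst n lapGen / constW lapGen lam k *
            tailExp (densW lapGen lam k) (drop lam k) (fun w => lapCdf (γ ⬝ᵥ put lam k w)) +
          γ k * tailExp (sphDensity lapGen) lam
            fun m => (1 + √(m ⬝ᵥ m)) * lapPdf (γ ⬝ᵥ m)) := by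
  have h_bulk := (hasTailExp_sphDensity_cumGen_lapGen_iff lam _).1
    (isRegularGen_lapGen.cumGen.hasTailExp_sphDensity_deriv_lapCdf lam γ)
  rw [MTCE_gse_lapGen (fun _ _ => contDiff_lapCdf.contDiffOn.absolutelyContinuousOnInterval)
    lapCdf_mem_Icc hZ h_bulk, deriv_lapCdf]

end Instances

end SkewLaplace

end

theorem mainTheorem5 {Ω : Type*} [MeasurableSpace Ω] (P : Measure Ω) [IsProbabilityMeasure P]
    (n : ℕ) (hn : 1 ≤ n)
    (μ γ : Fin n → ℝ) (Sg : Matrix (Fin n) (Fin n) ℝ) (hSg : Sg.PosDef)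
    (q : Fin n → ℝ) (hq : ∀ k, q k ∈ Ioo (0 : ℝ) 1)
    (Y Z : Ω → Fin n → ℝ) (hZ : Z = fun ω => standardize μ Sg (Y ω))
    (lam : Fin n → ℝ) (hlam : lam = standardize μ Sg (vectorVaR P q Y)) :
    -- cumulative generators
    (∀ t : ℝ, 0 ≤ t →
      cumGen lapGen t = (1 + √(2 * t)) * Real.exp (-√(2 * t)) ∧
      cumGen (cumGen lapGen) t = (3 + 2 * t + 3 * √(2 * t)) * Real.exp (-√(2 * t))) ∧
    -- normalizing constants in dimension `n`
    (normConst n lapGen =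
        Real.Gamma ((n : ℝ) / 2) / (2 * π ^ ((n : ℝ) / 2) * Real.Gamma n) ∧
      normConst n (cumGen lapGen) =
        n * Real.Gamma ((n : ℝ) / 2) / (2 * π ^ ((n : ℝ) / 2) * Real.Gamma (n + 2)) ∧
      normConst n (cumGen (cumGen lapGen)) =
        n * (n + 2) * Real.Gamma ((n : ℝ) / 2) /
          (2 * π ^ ((n : ℝ) / 2) * Real.Gamma (n + 4))) ∧
    -- the functions used below are probability densities
    (∫ x : Fin n → ℝ, sphDensity lapGen x = 1 ∧
      ∫ x : Fin n → ℝ, sphDensity (cumGen (cumGen lapGen)) x = 1 ∧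
      (∀ k, ∫ w, densW lapGen lam k w = 1 ∧ ∫ v, densV lapGen lam k v = 1) ∧
      (∀ i j, i ≠ j → ∫ u, densU lapGen lam i j u = 1)) ∧
    -- explicit densities of `W_{-k}`, `V_{-k}`, `U_{-ij}`
    ((∀ k w, densW lapGen lam k w =
        constW lapGen lam k * (1 + √(w ⬝ᵥ w + lam k ^ 2)) *
          Real.exp (-√(w ⬝ᵥ w + lam k ^ 2))) ∧
      (∀ k v, densV lapGen lam k v =
        constV lapGen lam k *
          (3 + (v ⬝ᵥ v + lam k ^ 2) + 3 * √(v ⬝ᵥ v + lam k ^ 2)) *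
          Real.exp (-√(v ⬝ᵥ v + lam k ^ 2))) ∧
      (∀ i j u, i ≠ j → densU lapGen lam i j u =
        constU lapGen lam i j *
          (3 + (u ⬝ᵥ u + lam i ^ 2 + lam j ^ 2) + 3 * √(u ⬝ᵥ u + lam i ^ 2 + lam j ^ 2)) *
          Real.exp (-√(u ⬝ᵥ u + lam i ^ 2 + lam j ^ 2)))) ∧
    -- normalizing constants of `W_{-k}`, `V_{-k}`, `U_{-ij}` and the ratios with `c_n`
    (∀ k, 2 ≤ n →
      constW lapGen lam k =
        Real.Gamma (((n : ℝ) - 1) / 2) / (2 * π) ^ (((n : ℝ) - 1) / 2) *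
          (∫ t in Ioi (0 : ℝ), t ^ (((n : ℝ) - 3) / 2) *
            (1 + √(2 * t + lam k ^ 2)) * Real.exp (-√(2 * t + lam k ^ 2)))⁻¹ ∧
      constV lapGen lam k =
        Real.Gamma (((n : ℝ) - 1) / 2) / (2 * π) ^ (((n : ℝ) - 1) / 2) *
          (∫ t in Ioi (0 : ℝ), t ^ (((n : ℝ) - 3) / 2) *
            (3 + (2 * t + lam k ^ 2) + 3 * √(2 * t + lam k ^ 2)) *
            Real.exp (-√(2 * t + lam k ^ 2)))⁻¹ ∧
      normConst n lapGen / constW lapGen lam k =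
        Real.Gamma ((n : ℝ) / 2) * 2 ^ (((n : ℝ) - 3) / 2) /
            (Real.Gamma n * Real.Gamma (((n : ℝ) - 1) / 2) * √π) *
          ∫ t in Ioi (0 : ℝ), t ^ (((n : ℝ) - 3) / 2) *
            (1 + √(2 * t + lam k ^ 2)) * Real.exp (-√(2 * t + lam k ^ 2)) ∧
      normConst n lapGen / constV lapGen lam k =
        Real.Gamma ((n : ℝ) / 2) * 2 ^ (((n : ℝ) - 3) / 2) /
            (Real.Gamma n * Real.Gamma (((n : ℝ) - 1) / 2) * √π) *
          ∫ t in Ioi (0 : ℝ), t ^ (((n : ℝ) - 3) / 2) *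
            (3 + (2 * t + lam k ^ 2) + 3 * √(2 * t + lam k ^ 2)) *
            Real.exp (-√(2 * t + lam k ^ 2))) ∧
    (∀ i j, i ≠ j → 3 ≤ n →
      constU lapGen lam i j =
        Real.Gamma (((n : ℝ) - 2) / 2) / (2 * π) ^ (((n : ℝ) - 2) / 2) *
          (∫ t in Ioi (0 : ℝ), t ^ (((n : ℝ) - 4) / 2) *
            (3 + (2 * t + lam i ^ 2 + lam j ^ 2) + 3 * √(2 * t + lam i ^ 2 + lam j ^ 2)) *
            Real.exp (-√(2 * t + lam i ^ 2 + lam j ^ 2)))⁻¹ ∧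
      normConst n lapGen / constU lapGen lam i j =
        ((n : ℝ) - 2) * 2 ^ (((n : ℝ) - 6) / 2) / (Real.Gamma n * π) *
          ∫ t in Ioi (0 : ℝ), t ^ (((n : ℝ) - 4) / 2) *
            (3 + (2 * t + lam i ^ 2 + lam j ^ 2) + 3 * √(2 * t + lam i ^ 2 + lam j ^ 2)) *
            Real.exp (-√(2 * t + lam i ^ 2 + lam j ^ 2))) ∧
    -- reduction of `Y` to `Z`, for every skewing function
    (∀ H : ℝ → ℝ, IsSkewing H → Measurable H → HasLaw Y (gsLaplaceLaw μ Sg γ H) P →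
      HasLaw Z (gsLaplaceLaw 0 1 γ H) P ∧
      (∀ k, MemLp (fun ω => Y ω k) 2 P ∧ MemLp (fun ω => Z ω k) 2 P) ∧
      condCov P (exceed Z lam) Y = CFC.sqrt Sg * MTCov P Z lam * CFC.sqrt Sg ∧
      (Sg.IsDiag →
        MTCov P Y (vectorVaR P q Y) = CFC.sqrt Sg * MTCov P Z lam * CFC.sqrt Sg)) ∧
    -- generalized skew-Laplace: the entries of `Ω_q` and the tail conditional expectation of `Z`
    (∀ H : ℝ → ℝ, IsSkewing H → Differentiable ℝ H →
      (∀ a b : ℝ, AbsolutelyContinuousOnInterval (deriv H) a b) →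
      HasLaw Y (gsLaplaceLaw μ Sg γ H) P →
      0 < P (exceed Z lam) →
      (∀ k, HasTailExp (densV lapGen lam k) (drop lam k)
        fun v => deriv H (γ ⬝ᵥ put lam k v)) →
      HasTailExp (sphDensity (cumGen (cumGen lapGen))) lam
        (fun x => deriv (deriv H) (γ ⬝ᵥ x)) →
      HasTailExp (sphDensity lapGen) lam
        (fun m => (1 + √(m ⬝ᵥ m)) * deriv H (γ ⬝ᵥ m)) →
      (∀ i j, i ≠ j → MTCov P Z lam i j =
        2 / tailFn (gseDensity 0 1 lapGen fun z => H (γ ⬝ᵥ z)) lam *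
          (normConst n lapGen / constU lapGen lam i j *
              tailExp (densU lapGen lam i j) (drop₂ lam i j)
                (fun u => H (γ ⬝ᵥ put₂ lam i j u))
            + normConst n lapGen / constV lapGen lam i * γ j *
              tailExp (densV lapGen lam i) (drop lam i)
                (fun v => deriv H (γ ⬝ᵥ put lam i v))
            + normConst n lapGen / constV lapGen lam j * γ i *
              tailExp (densV lapGen lam j) (drop lam j)
                (fun v => deriv H (γ ⬝ᵥ put lam j v))
            + (n + 3) * (n + 1) * γ i * γ j *
              tailExp (sphDensity (cumGen (cumGen lapGen))) lam
                (fun x => deriv (deriv H) (γ ⬝ᵥ x)))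
          - MTCE P Z lam i * MTCE P Z lam j) ∧
      (∀ i, MTCov P Z lam i i =
        2 / tailFn (gseDensity 0 1 lapGen fun z => H (γ ⬝ᵥ z)) lam *
          (normConst n lapGen / constW lapGen lam i * lam i *
              tailExp (densW lapGen lam i) (drop lam i)
                (fun w => H (γ ⬝ᵥ put lam i w))
            + normConst n lapGen / constV lapGen lam i * γ i *
              tailExp (densV lapGen lam i) (drop lam i)
                (fun v => deriv H (γ ⬝ᵥ put lam i v))
            + (n + 3) * (n + 1) * γ i ^ 2 *
              tailExp (sphDensity (cumGen (cumGen lapGen))) lam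
                (fun x => deriv (deriv H) (γ ⬝ᵥ x)))
          + (n + 1) *
            (tailFn (gseDensity 0 1 (cumGen lapGen) fun z => H (γ ⬝ᵥ z)) lam /
              tailFn (gseDensity 0 1 lapGen fun z => H (γ ⬝ᵥ z)) lam)
          - MTCE P Z lam i ^ 2) ∧
      (∀ k, MTCE P Z lam k =
        2 / tailFn (gseDensity 0 1 lapGen fun z => H (γ ⬝ᵥ z)) lam *
          (normConst n lapGen / constW lapGen lam k *
              tailExp (densW lapGen lam k) (drop lam k)
                (fun w => H (γ ⬝ᵥ put lam k w))
            + γ k * tailExp (sphDensity lapGen) lam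
                (fun m => (1 + √(m ⬝ᵥ m)) * deriv H (γ ⬝ᵥ m))))) ∧
    -- skew-Laplace: `H` is the standard Laplace distribution function
    (HasLaw Y (gsLaplaceLaw μ Sg γ lapCdf) P →
      0 < P (exceed Z lam) ∧
      (∀ i j, i ≠ j → MTCov P Z lam i j =
        2 / tailFn (gseDensity 0 1 lapGen fun z => lapCdf (γ ⬝ᵥ z)) lam *
          (normConst n lapGen / constU lapGen lam i j *
              tailExp (densU lapGen lam i j) (drop₂ lam i j)
                (fun u => lapCdf (γ ⬝ᵥ put₂ lam i j u))
            + normConst n lapGen / constV lapGen lam i * γ j *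
              tailExp (densV lapGen lam i) (drop lam i)
                (fun v => lapPdf (γ ⬝ᵥ put lam i v))
            + normConst n lapGen / constV lapGen lam j * γ i *
              tailExp (densV lapGen lam j) (drop lam j)
                (fun v => lapPdf (γ ⬝ᵥ put lam j v))
            - (n + 3) * (n + 1) * γ i * γ j *
              tailExp (sphDensity (cumGen (cumGen lapGen))) lam
                (fun x => (γ ⬝ᵥ x) / |γ ⬝ᵥ x| * lapPdf (γ ⬝ᵥ x)))
          - MTCE P Z lam i * MTCE P Z lam j) ∧
      (∀ i, MTCov P Z lam i i =
        2 / tailFn (gseDensity 0 1 lapGen fun z => lapCdf (γ ⬝ᵥ z)) lam *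
          (normConst n lapGen / constW lapGen lam i * lam i *
              tailExp (densW lapGen lam i) (drop lam i)
                (fun w => lapCdf (γ ⬝ᵥ put lam i w))
            + normConst n lapGen / constV lapGen lam i * γ i *
              tailExp (densV lapGen lam i) (drop lam i)
                (fun v => lapPdf (γ ⬝ᵥ put lam i v))
            - (n + 3) * (n + 1) * γ i ^ 2 *
              tailExp (sphDensity (cumGen (cumGen lapGen))) lam
                (fun x => (γ ⬝ᵥ x) / |γ ⬝ᵥ x| * lapPdf (γ ⬝ᵥ x)))
          + (n + 1) *
            (tailFn (gseDensity 0 1 (cumGen lapGen) fun z => lapCdf (γ ⬝ᵥ z)) lam /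
              tailFn (gseDensity 0 1 lapGen fun z => lapCdf (γ ⬝ᵥ z)) lam)
          - MTCE P Z lam i ^ 2) ∧
      (∀ k, MTCE P Z lam k =
        2 / tailFn (gseDensity 0 1 lapGen fun z => lapCdf (γ ⬝ᵥ z)) lam *
          (normConst n lapGen / constW lapGen lam k *
              tailExp (densW lapGen lam k) (drop lam k)
                (fun w => lapCdf (γ ⬝ᵥ put lam k w))
            + γ k * tailExp (sphDensity lapGen) lam
                (fun m => (1 + √(m ⬝ᵥ m)) * lapPdf (γ ⬝ᵥ m))))) ∧
    -- symmetric Laplace: `H = 1/2`, so that `Y ~ E_n(μ, Σ, g)`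
    (HasLaw Y (lawOf (ellDensity μ Sg lapGen)) P →
      HasLaw Z (lawOf (sphDensity lapGen)) P ∧
      0 < P (exceed Z lam) ∧
      (∀ i j, i ≠ j → MTCov P Z lam i j =
        1 / tailFn (sphDensity lapGen) lam *
          (normConst n lapGen / constU lapGen lam i j *
            tailFn (densU lapGen lam i j) (drop₂ lam i j))
          - MTCE P Z lam i * MTCE P Z lam j) ∧
      (∀ i, MTCov P Z lam i i =
        1 / tailFn (sphDensity lapGen) lam *
          (normConst n lapGen / constW lapGen lam i * lam i *
            tailFn (densW lapGen lam i) (drop lam i))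
          + (n + 1) * (tailFn (sphDensity (cumGen lapGen)) lam / tailFn (sphDensity lapGen) lam)
          - MTCE P Z lam i ^ 2) ∧
      (∀ k, MTCE P Z lam k =
        1 / tailFn (sphDensity lapGen) lam *
          (normConst n lapGen / constW lapGen lam k *
            tailFn (densW lapGen lam k) (drop lam k)))) := by
  subst hZ
  have hg := isRegularGen_lapGen
  rw [← normConst_lapGen_div_cumGen_cumGen hn, ← normConst_lapGen_div_cumGen hn]
  refine ⟨fun t ht => ⟨cumGen_lapGen ht, cumGen_cumGen_lapGen ht⟩,
    ⟨normConst_lapGen hn, normConst_cumGen_lapGen hn, normConst_cumGen_cumGen_lapGen hn⟩,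
    ⟨hg.integral_sphDensity, hg.cumGen.cumGen.integral_sphDensity,
      fun k => ⟨hg.integral_densW lam k, hg.integral_densV lam k⟩,
      fun i j => hg.integral_densU lam⟩,
    ⟨densW_lapGen lam, densV_lapGen lam, fun i j u _ => densU_lapGen lam i j u⟩,
    fun k h2 => ⟨constW_lapGen lam h2 k, constV_lapGen lam h2 k,
      normConst_lapGen_div_constW lam h2 k, normConst_lapGen_div_constV lam h2 k⟩,
    fun i j _ h3 => ⟨constU_lapGen lam h3 i j, normConst_lapGen_div_constU lam h3 i j⟩,
    fun H hs hH hY => ?_, fun H hs hH hH' hY h_pos h_face h_bulk h_mean => ?_, fun hY => ?_,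
    fun hY => ?_⟩
  · have hZ := hasLaw_standardize_gsLaplaceLaw hSg hH hY
    have h_mem := hg.memLp_coord_of_hasLaw_gse (measurable_comp_dotProduct hH γ)
      (fun _ => hs.1 _) hZ
    exact ⟨hZ, fun k => ⟨memLp_of_memLp_standardize hSg h_mem k, h_mem k⟩,
      condCov_eq_sqrt_mul_condCov_standardize_mul_sqrt hSg h_mem _,
      fun hd => hlam ▸ MTCov_eq_sqrt_mul_MTCov_standardize_mul_sqrt hSg hd h_mem _⟩
  · have hH₁ := contDiff_one_of_absolutelyContinuousOnInterval_deriv hH hH'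
    have hZ := hasLaw_standardize_gsLaplaceLaw hSg hH.continuous.measurable hY
    exact ⟨fun i j => hg.MTCov_gse_of_ne hH₁ hs.1 hH' hZ h_pos h_face h_bulk,
      fun i => hg.MTCov_gse_self hH₁ hs.1 hH' hZ h_pos (h_face i) h_bulk,
      MTCE_gse_lapGen (fun _ _ => hH₁.contDiffOn.absolutelyContinuousOnInterval) hs.1 hZ h_mean⟩
  · have h_meas := contDiff_lapCdf.continuous.measurable
    have hZ := hasLaw_standardize_gsLaplaceLaw hSg h_meas hY
    exact ⟨hg.measure_exceed_pos_of_hasLaw_gse h_meas lapCdf_pos hZ _,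
      fun i j => hg.MTCov_gse_lapCdf_of_ne hZ, hg.MTCov_gse_lapCdf_self hZ,
      MTCE_gse_lapGen_lapCdf hZ⟩
  · have hZ := hasLaw_standardize_ellDensity hSg hg.continuous.measurable hY
    exact ⟨hZ, hg.measure_exceed_pos_of_hasLaw_sph hZ _, fun i j => hg.MTCov_sph_of_ne hZ,
      hg.MTCov_sph_self hZ, hg.MTCE_sph hZ⟩
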